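/- Let $t$ be an indeterminate. Framed links in $S^3$ are given by planar diagrams with the blackboard framing (generic with respect to the height function), two diagrams being identified when they are related by planar isotopy and the framed Reidemeister moves. The Kauffman bracket $\langle L\rangle\in\mathbb C[t,t^{-1}]$ is defined by $\langle L\rangle=t\langle H\rangle+t^{-1}\langle V\rangle$, where $H$ and $V$ are the two smoothings of a crossing of $L$ and $H$ is the smoothing that respects the orientations when the crossing is positive, by $\langle L\sqcup O\rangle=(-t^2-t^{-2})\langle L\rangle$ for a trivial component $O$, and by $\langle\emptyset\rangle=1$. The Kauffman bracket skein module $K_t(S^3)$ is the free $\mathbb C[t,t^{-1}]$-module on the isotopy classes of framed links in $S^3$ modulo the relations $L=tH+t^{-1}V$ and $L\sqcup O=(-t^2-t^{-2})L$. For a framed knot $K$ let $K^m$ be the framed link of $m$ parallel copies of $K$, pushed off along the framing, with $K^0=\emptyset$. For $n\ge 0$ let $S_n$ be the polynomial with $S_0=1$, $S_1=\xi$, $S_{n+1}=\xi S_n-S_{n-1}$ (so $S_n(2\cos\theta)=\sin((n+1)\theta)/\sin\theta$), and let $S_n(K)$ be obtained from $S_n(\xi)$ by replacing $\xi^m$ by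 $K^m$. The bracket is extended linearly to such combinations. Let $J(K,n)$ be the $n$th colored Jones polynomial of the framed knot $K$, that is, its Reshetikhin–Turaev invariant (not divided by the value of the unknot) for the coloring by the $(n+1)$-dimensional irreducible representation of the quantum group $U_q(\mathfrak{sl}_2)$, $q=t^2$, normalized so that the zero-framed unknot has the value $\frac{q^{n+1}-q^{-n-1}}{q-q^{-1}}$ and a positive change of the framing by one multiplies the invariant by $t^{n(n+2)}$. Theorem. Let $K$ be a framed knot in $S^3$ with framing zero, and let $n\ge 0$ be an integer. Then $J(K,n)\in\mathbb C[t,t^{-1}]$, $$J(K,n)=(-1)^n\,\langle S_n(K)\rangle ,$$ and in $K_t(S^3)$ $$S_n(K)=(-1)^n\,J(K,n)\,\emptyset .$$ -/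

import Mathlib

open scoped LaurentPolynomial

/-!
Framed links in the 3-sphere are represented by generic planar diagrams with the blackboard
framing.  A diagram is cut by horizontal lines into elementary slices and read from the bottom to
the top; two diagrams represent isotopic framed links when they are related by planar isotopies
and framed Reidemeister moves.
-/

namespace FramedSkein

/-! ### Link diagrams -/

/-- An elementary slice of a link diagram; `i` is the number of strands to the left of the
picture.  `cup i` is a local minimum, creating strands number `i` and `i + 1`; `cap i` is a local
maximum, joining strands number `i` and `i + 1`; `cross i b` is a crossing of the strands number
`i` and `i + 1`.  For `b = true` the strand running from the lower left to the upper right passes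
over the other one, for `b = false` it passes under. -/
inductive Slice : Type
  | cup (i : ℕ)
  | cap (i : ℕ)
  | cross (i : ℕ) (b : Bool)

namespace Slice

/-- The number of strands to the left of the picture. -/
def pos : Slice → ℕ
  | cup i => i
  | cap i => i
  | cross i _ => i

/-- The number of strands entering the picture from below. -/
def inn : Slice → ℕ
  | cup _ => 0
  | cap _ => 2
  | cross _ _ => 2

/-- The number of strands leaving the picture at the top. -/
def out : Slice → ℕ
  | cup _ => 2
  | cap _ => 0
  | cross _ _ => 2

/-- The same picture with `j` strands to its left. -/
def moveTo : Slice → ℕ → Slice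
  | cup _, j => cup j
  | cap _, j => cap j
  | cross _ b, j => cross j b

end Slice

/-- The slices of the list can be stacked, from bottom to top, to a tangle diagram with `a`
strands at the bottom and `b` strands at the top. -/
def IsTangle : List Slice → ℕ → ℕ → Prop
  | [], a, b => a = b
  | s :: w, a, b => s.pos + s.inn ≤ a ∧ IsTangle w (a - s.inn + s.out) b

/-- A diagram of a framed link in the 3-sphere, with the blackboard framing. -/
structure LinkDiagram : Type where
  word : List Slice
  closed : IsTangle word 0 0

/-- The local moves that generate isotopy of framed links. -/
inductive LocalMove : List Slice → List Slice → Prop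
  /-- the heights of two pictures that lie side by side can be exchanged -/
  | exchange (s s' : Slice) (m : ℕ) :
      LocalMove [s, s'.moveTo (s.pos + s.out + m)] [s'.moveTo (s.pos + s.inn + m), s]
  /-- straightening a strand -/
  | zigzag_right (i : ℕ) : LocalMove [.cup i, .cap (i + 1)] []
  | zigzag_left (i : ℕ) : LocalMove [.cup (i + 1), .cap i] []
  /-- moving a strand across a local minimum or maximum -/
  | slide_cup (i : ℕ) (b : Bool) :
      LocalMove [.cup i, .cross (i + 1) b] [.cup (i + 1), .cross i (!b)]
  | slide_cap (i : ℕ) (b : Bool) :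
      LocalMove [.cross (i + 1) b, .cap i] [.cross i (!b), .cap (i + 1)]
  /-- the first Reidemeister move for framed links: a curl can be replaced by the curl on the
  other side of the strand that has the same writhe -/
  | curl (i : ℕ) (b : Bool) :
      LocalMove [.cup (i + 1), .cross i b, .cap (i + 1)] [.cup i, .cross (i + 1) b, .cap i]
  /-- the second Reidemeister move -/
  | reidemeister_two (i : ℕ) (b : Bool) : LocalMove [.cross i b, .cross i (!b)] []
  /-- the third Reidemeister move -/
  | reidemeister_three (i : ℕ) (b : Bool) :
      LocalMove [.cross i b, .cross (i + 1) b, .cross i b]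
        [.cross (i + 1) b, .cross i b, .cross (i + 1) b]

/-- Two diagrams differ by one local move. -/
def Move (D D' : LinkDiagram) : Prop :=
  ∃ p s l l', LocalMove l l' ∧ D.word = p ++ l ++ s ∧ D'.word = p ++ l' ++ s

/-- Isotopy classes of framed links in the 3-sphere: the quotient of the set of diagrams by the
equivalence relation that the moves generate. -/
def FramedLink : Type := Quot Move

/-- The framed link with the given diagram. -/
def LinkDiagram.toFramedLink (D : LinkDiagram) : FramedLink := Quot.mk Move D

/-- The empty link. -/
def LinkDiagram.empty : LinkDiagram := ⟨[], rfl⟩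

/-- Auxiliary to `numComponents`: run through the diagram from the bottom to the top, with a label
on each strand such that two strands have the same label when they belong to the same component of
the part below; `f` is the next unused label.  A component is counted when it gets closed. -/
def numComponentsAux : List Slice → ℕ → List ℕ → ℕ
  | [], _, _ => 0
  | .cup i :: w, f, L => numComponentsAux w (f + 1) (L.take i ++ f :: f :: L.drop i)
  | .cap i :: w, f, L =>
      match L.drop i with
      | x :: y :: r =>
          if x = y then numComponentsAux w f (L.take i ++ r) + 1
          else numComponentsAux w f ((L.take i ++ r).map fun z => if z = y then x else z)
      | _ => numComponentsAux w f L
  | .cross i _ :: w, f, L =>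
      match L.drop i with
      | x :: y :: r => numComponentsAux w f (L.take i ++ y :: x :: r)
      | _ => numComponentsAux w f L

/-- The number of components of the link with the given diagram. -/
def numComponents (w : List Slice) : ℕ := numComponentsAux w 0 []

/-! ### Parallel copies -/

/-- The slices that replace one slice when each strand is replaced by `m` parallel strands. -/
def cableSlice (m : ℕ) : Slice → List Slice
  | .cup i => (List.range m).map fun k => .cup (m * i + k)
  | .cap i => (List.range m).reverse.map fun k => .cap (m * i + k)
  | .cross i b =>
      (List.range m).reverse.flatMap fun k => (List.range m).map fun l => .cross (m * i + k + l) b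

/-- Replace each strand by `m` parallel strands. -/
def cableWord (m : ℕ) (w : List Slice) : List Slice := w.flatMap (cableSlice m)

theorem IsTangle.append {w w' : List Slice} {a b c : ℕ} (h : IsTangle w a b)
    (h' : IsTangle w' b c) : IsTangle (w ++ w') a c := by
  induction w generalizing a with
  | nil => cases h; exact h'
  | cons s w ih => exact ⟨h.1, ih h.2⟩

theorem isTangle_cups (m i a : ℕ) (h : i ≤ a) :
    IsTangle ((List.range m).map fun k => Slice.cup (i + k)) a (a + 2 * m) := by
  induction m with
  | zero => simp [IsTangle]
  | succ m ih =>
    rw [List.range_succ, List.map_append]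
    refine ih.append ⟨?_, ?_⟩
    · simp [Slice.pos, Slice.inn]; omega
    · simp [Slice.inn, Slice.out, IsTangle]; omega

theorem isTangle_caps (m i a : ℕ) (h : i ≤ a) :
    IsTangle ((List.range m).reverse.map fun k => Slice.cap (i + k)) (a + 2 * m) a := by
  induction m with
  | zero => simp [IsTangle]
  | succ m ih =>
    rw [List.range_succ, List.reverse_append, List.map_append]
    have h1 : IsTangle ([m].reverse.map fun k => Slice.cap (i + k)) (a + 2 * (m + 1))
        (a + 2 * m) := by
      refine ⟨?_, ?_⟩
      · simp [Slice.pos, Slice.inn]; omega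
      · simp [Slice.inn, Slice.out, IsTangle]; omega
    exact h1.append ih

theorem isTangle_crossings {w : List Slice} {a : ℕ}
    (h : ∀ s ∈ w, ∃ i b, s = Slice.cross i b ∧ i + 2 ≤ a) : IsTangle w a a := by
  induction w with
  | nil => rfl
  | cons s w ih =>
    obtain ⟨i, b, rfl, hi⟩ := h s (by simp)
    refine ⟨hi, ?_⟩
    have : a - (Slice.cross i b).inn + (Slice.cross i b).out = a := by
      simp [Slice.inn, Slice.out]; omega
    rw [this]
    exact ih fun s hs => h s (by simp [hs])

theorem isTangle_cableSlice (m : ℕ) (s : Slice) (a : ℕ) (h : s.pos + s.inn ≤ a) :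
    IsTangle (cableSlice m s) (m * a) (m * (a - s.inn + s.out)) := by
  cases s with
  | cup i =>
    have := isTangle_cups m (m * i) (m * a) (Nat.mul_le_mul_left m h)
    simpa [cableSlice, Slice.inn, Slice.out, mul_add, mul_comm] using this
  | cap i =>
    obtain ⟨c, rfl⟩ := Nat.exists_eq_add_of_le h
    simp only [Slice.pos, Slice.inn] at h ⊢
    have := isTangle_caps m (m * i) (m * (i + c)) (Nat.mul_le_mul_left m (by omega))
    have e1 : m * (i + c) + 2 * m = m * (i + 2 + c) := by ring
    have e2 : m * (i + c) = m * (i + 2 + c - 2 + 0) := by congr 1; omega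
    rw [e1] at this
    simp only [Slice.out, ← e2]
    exact this
  | cross i b =>
    simp only [Slice.pos, Slice.inn, Slice.out] at h ⊢
    rw [show a - 2 + 2 = a by omega]
    refine isTangle_crossings fun s hs => ?_
    simp only [cableSlice, List.mem_flatMap, List.mem_reverse, List.mem_range, List.mem_map] at hs
    obtain ⟨k, hk, l, hl, rfl⟩ := hs
    refine ⟨_, _, rfl, ?_⟩
    have : m * (i + 2) ≤ m * a := Nat.mul_le_mul_left m h
    rw [mul_add] at this
    omega

theorem isTangle_cableWord (m : ℕ) {w : List Slice} {a b : ℕ} (h : IsTangle w a b) :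
    IsTangle (cableWord m w) (m * a) (m * b) := by
  induction w generalizing a with
  | nil => cases h; rfl
  | cons s w ih => exact (isTangle_cableSlice m s a h.1).append (ih h.2)

/-- `D.cable m` is the link with `m` parallel copies of each component of `D`, pushed off in the
direction of the framing; it is the empty link for `m = 0`. -/
def LinkDiagram.cable (D : LinkDiagram) (m : ℕ) : LinkDiagram :=
  ⟨cableWord m D.word, by simpa using isTangle_cableWord m D.closed⟩

/-! ### The Kauffman bracket and the Kauffman bracket skein module -/

/-- The value `-t² - t⁻²` of a trivial component; the variable `t` is `T 1`. -/
noncomputable def loopValue : ℂ[T;T⁻¹] :=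
  -LaurentPolynomial.T 2 - LaurentPolynomial.T (-2)

/-- The exponent of `t` that belongs to the resolution of a crossing into two vertical strands. -/
def smoothingExponent (b : Bool) : ℤ := if b then 1 else -1

/-- Auxiliary to `bracket`: resolve all crossings of the second argument; the first argument has
no crossings and stays unchanged. -/
noncomputable def bracketAux : List Slice → List Slice → ℂ[T;T⁻¹]
  | v, [] => loopValue ^ numComponents v
  | v, .cross i b :: w =>
      LaurentPolynomial.T (smoothingExponent b) * bracketAux v w +
        LaurentPolynomial.T (-smoothingExponent b) * bracketAux (v ++ [.cap i, .cup i]) w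
  | v, .cup i :: w => bracketAux (v ++ [.cup i]) w
  | v, .cap i :: w => bracketAux (v ++ [.cap i]) w

/-- The Kauffman bracket of a framed link, normalized to be `1` on the empty link. -/
noncomputable def bracket (D : LinkDiagram) : ℂ[T;T⁻¹] := bracketAux [] D.word

/-- The relations `L - t H - t⁻¹ V` and `L ∪ O - (-t² - t⁻²) L` of the Kauffman bracket skein
module of the 3-sphere. -/
inductive SkeinRelation : (FramedLink →₀ ℂ[T;T⁻¹]) → Prop
  | crossing (p s : List Slice) (i : ℕ) (b : Bool) (L H V : LinkDiagram)
      (hL : L.word = p ++ [.cross i b] ++ s) (hH : H.word = p ++ s)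
      (hV : V.word = p ++ [.cap i, .cup i] ++ s) :
      SkeinRelation (Finsupp.single L.toFramedLink 1 -
        Finsupp.single H.toFramedLink (LaurentPolynomial.T (smoothingExponent b)) -
        Finsupp.single V.toFramedLink (LaurentPolynomial.T (-smoothingExponent b)))
  | trivial (p s : List Slice) (i : ℕ) (L L' : LinkDiagram)
      (hL' : L'.word = p ++ [.cup i, .cap i] ++ s) (hL : L.word = p ++ s) :
      SkeinRelation (Finsupp.single L'.toFramedLink 1 -
        Finsupp.single L.toFramedLink loopValue)

/-- The Kauffman bracket skein module of the 3-sphere: the free module on the isotopy classes of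
framed links modulo the skein relations. -/
abbrev KauffmanSkeinModule : Type :=
  (FramedLink →₀ ℂ[T;T⁻¹]) ⧸ Submodule.span ℂ[T;T⁻¹] {x | SkeinRelation x}

/-- The skein of a framed link. -/
noncomputable def skein (D : LinkDiagram) : KauffmanSkeinModule :=
  Submodule.Quotient.mk (Finsupp.single D.toFramedLink 1)

/-- The skein `S_n(K)` of a framed knot: substitute the `m`-fold parallel copies of `K` for the
`m`th powers in the normalized Chebyshev polynomial of the second kind. -/
noncomputable def skeinS (n : ℕ) (K : LinkDiagram) : KauffmanSkeinModule :=
  (Polynomial.Chebyshev.S ℂ[T;T⁻¹] n).sum fun m c => c • skein (K.cable m)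

/-- The colored Kauffman bracket `⟨S_n(K)⟩`: the Kauffman bracket, extended linearly to linear
combinations of links, of `S_n(K)`. -/
noncomputable def coloredBracket (n : ℕ) (K : LinkDiagram) : ℂ[T;T⁻¹] :=
  (Polynomial.Chebyshev.S ℂ[T;T⁻¹] n).sum fun m c => c * bracket (K.cable m)

/-! ### Oriented diagrams -/

/-- A slice of an oriented diagram.  A strand is directed upwards (`true`) or downwards (`false`).
For a local minimum, `d` is the direction of the left one of the two new strands; the directions of
all other strands are determined by these. -/
inductive OrientedSlice : Type
  | cup (i : ℕ) (d : Bool)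
  | cap (i : ℕ)
  | cross (i : ℕ) (b : Bool)

namespace OrientedSlice

/-- Forget the orientation. -/
def forget : OrientedSlice → Slice
  | cup i _ => .cup i
  | cap i => .cap i
  | cross i b => .cross i b

/-- The slice fits on strands with the directions `u`. -/
def Fits : OrientedSlice → List Bool → Prop
  | cup i _, u => i ≤ u.length
  | cap i, u => ∃ d r, u.drop i = d :: (!d) :: r
  | cross i _, u => i + 2 ≤ u.length

/-- The directions of the strands above the slice, if those below it are `u`. -/
def directions : OrientedSlice → List Bool → List Bool
  | cup i d, u => u.take i ++ d :: (!d) :: u.drop i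
  | cap i, u => u.take i ++ u.drop (i + 2)
  | cross i _, u =>
      match u.drop i with
      | x :: y :: r => u.take i ++ y :: x :: r
      | _ => u

/-- The sign of a crossing of strands that have the directions `x` (lower left strand) and `y`
(lower right strand). -/
def crossingSign (b x y : Bool) : ℤ := if b = (x == y) then 1 else -1

end OrientedSlice

/-- The slices can be stacked, with matching orientations, on strands with the directions `u`, so
that no strand is left at the top. -/
def IsOrientedClosed : List OrientedSlice → List Bool → Prop
  | [], u => u = []
  | s :: w, u => s.Fits u ∧ IsOrientedClosed w (s.directions u)

/-- A diagram of an oriented framed link, with the blackboard framing. -/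
structure OrientedLinkDiagram : Type where
  word : List OrientedSlice
  closed : IsOrientedClosed word []

theorem isTangle_forget {w : List OrientedSlice} {u : List Bool} (h : IsOrientedClosed w u) :
    IsTangle (w.map OrientedSlice.forget) u.length 0 := by
  induction w generalizing u with
  | nil => cases h; rfl
  | cons s w ih =>
    obtain ⟨h1, h2⟩ := h
    have h3 := ih h2
    cases s with
    | cup i d =>
      have h1 : i ≤ u.length := h1
      refine ⟨h1, ?_⟩
      have e : (OrientedSlice.directions (.cup i d) u).length = u.length + 2 := by
        simp [OrientedSlice.directions]; omega
      rw [e] at h3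
      exact h3
    | cap i =>
      obtain ⟨d, r, hr⟩ := h1
      have hl := congrArg List.length hr
      simp at hl
      refine ⟨by simp [OrientedSlice.forget, Slice.pos, Slice.inn]; omega, ?_⟩
      have e : (OrientedSlice.directions (.cap i) u).length = u.length - 2 := by
        simp [OrientedSlice.directions]; omega
      rw [e] at h3
      exact h3
    | cross i b =>
      have h1 : i + 2 ≤ u.length := h1
      refine ⟨h1, ?_⟩
      have e : (OrientedSlice.directions (.cross i b) u).length = u.length - 2 + 2 := by
        simp only [OrientedSlice.directions]
        split
        · rename_i x y r hr
          have hl := congrArg List.length hr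
          simp at hl ⊢
          omega
        · omega
      rw [e] at h3
      exact h3

/-- The underlying unoriented diagram. -/
def OrientedLinkDiagram.toLinkDiagram (D : OrientedLinkDiagram) : LinkDiagram :=
  ⟨D.word.map OrientedSlice.forget, isTangle_forget D.closed⟩

/-- Auxiliary to `writhe`; `u` is the list of directions of the strands. -/
def writheAux : List OrientedSlice → List Bool → ℤ
  | [], _ => 0
  | .cross i b :: w, u =>
      OrientedSlice.crossingSign b (u.getD i true) (u.getD (i + 1) true) +
        writheAux w (OrientedSlice.directions (.cross i b) u)
  | s :: w, u => writheAux w (s.directions u)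

/-- The writhe, that is the sum of the signs of the crossings; for a knot it is the framing
number of the blackboard framing. -/
def OrientedLinkDiagram.writhe (D : OrientedLinkDiagram) : ℤ := writheAux D.word []

/-! ### The quantum group of `SU(2)` and the colored Jones polynomial

The quantum group is the algebra `U_q(sl₂)` with `q = t²`, generated by `E`, `F` and
`K = q ^ H`, where `K E K⁻¹ = q² E`, `K F K⁻¹ = q⁻² F`, `E F - F E = (K - K⁻¹) / (q - q⁻¹)`, and
`Δ E = E ⊗ K + 1 ⊗ E`, `Δ F = F ⊗ 1 + K⁻¹ ⊗ F`, `Δ K = K ⊗ K`,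
`S E = - E K⁻¹`, `S F = - K F`, `S K = K⁻¹`. -/

/-- The field of rational functions in `t`, as the field of fractions of the ring of Laurent
polynomials. -/
abbrev RationalFunctions : Type := FractionRing ℂ[T;T⁻¹]

/-- The parameter `t`. -/
noncomputable def tVar : RationalFunctions :=
  algebraMap ℂ[T;T⁻¹] RationalFunctions (LaurentPolynomial.T 1)

/-- The parameter `q = t²`. -/
noncomputable def qVar : RationalFunctions := tVar ^ 2

/-- The quantum integer `[k] = (q ^ k - q ^ (-k)) / (q - q⁻¹)`. -/
noncomputable def quantumInt (k : ℤ) : RationalFunctions :=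
  (qVar ^ k - qVar ^ (-k)) / (qVar - qVar⁻¹)

/-- The quantum factorial `[k]! = [1] [2] ⋯ [k]`. -/
noncomputable def quantumFactorial (k : ℕ) : RationalFunctions :=
  ∏ j ∈ Finset.range k, quantumInt (j + 1)

/-- The action of `E`, `F` and `H` on a module with a basis of weight vectors `e_a`; the vector
`e_a` has the weight `h a`, so `K e_a = q ^ h a • e_a`. -/
structure WeightModule (ι : Type) where
  E : Matrix ι ι RationalFunctions
  F : Matrix ι ι RationalFunctions
  h : ι → ℤ

namespace WeightModule

/-- The irreducible module of dimension `n + 1`, with basis `e_0, …, e_n`: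
`E e_a = [a + 1] e_{a+1}`, `F e_a = [n - a + 1] e_{a-1}`, `H e_a = (2 a - n) e_a`. -/
noncomputable def irrep (n : ℕ) : WeightModule (Fin (n + 1)) where
  E := Matrix.of fun b a => if (b : ℕ) = a + 1 then quantumInt (a + 1) else 0
  F := Matrix.of fun b a => if (a : ℕ) = b + 1 then quantumInt (n - a + 1) else 0
  h a := 2 * a - n

variable {ι : Type} [Fintype ι] [DecidableEq ι]

/-- The matrix of `K ^ k`. -/
noncomputable def K (M : WeightModule ι) (k : ℤ) : Matrix ι ι RationalFunctions :=
  Matrix.diagonal fun a => qVar ^ (k * M.h a)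

/-- The dual module in the dual basis; an element `x` acts by the transpose of `S x`. -/
noncomputable def dual (M : WeightModule ι) : WeightModule ι where
  E := (-(M.E * M.K (-1))).transpose
  F := (-(M.K 1 * M.F)).transpose
  h a := -M.h a

/-- The action on `M ⊗ N` of the universal `R`-matrix
`q ^ (H ⊗ H / 2) ∑ₖ q ^ (k (k - 1) / 2) (q - q⁻¹) ^ k / [k]! • E ^ k ⊗ F ^ k`.
The terms with `k` at least the dimension of `M` vanish, since `E` is nilpotent. -/
noncomputable def rMatrix (M N : WeightModule ι) : Matrix (ι × ι) (ι × ι) RationalFunctions :=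
  (Matrix.diagonal fun x : ι × ι => tVar ^ (M.h x.1 * N.h x.2)) *
    ∑ k ∈ Finset.range (Fintype.card ι),
      (qVar ^ (k * (k - 1) / 2) * (qVar - qVar⁻¹) ^ k / quantumFactorial k) •
        Matrix.kroneckerMap (· * ·) (M.E ^ k) (N.F ^ k)

/-- The matrix of a crossing, as a map from `M ⊗ N` to `N ⊗ M`: the coefficient of
`e_c ⊗ e_d` in the image of `e_a ⊗ e_b`.  For `s = true` the map is the braiding of `M` and `N`,
the `R`-matrix followed by the flip; for `s = false` it is the inverse of the braiding of `N` and
`M`. -/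
noncomputable def crossing (s : Bool) (M N : WeightModule ι) (a b c d : ι) : RationalFunctions :=
  if s then rMatrix M N (d, c) (a, b) else (rMatrix N M)⁻¹ (c, d) (b, a)

end WeightModule

/-- The module on a strand: the irreducible module of dimension `n + 1` if the strand is directed
upwards and its dual if the strand is directed downwards. -/
noncomputable def strandModule (n : ℕ) (d : Bool) : WeightModule (Fin (n + 1)) :=
  if d then WeightModule.irrep n else (WeightModule.irrep n).dual

/-- The invariant vector of a local minimum, with `d` the direction of the left strand:
`∑ e_a ⊗ e^a` in `V ⊗ V*`, or `∑ e^a ⊗ K⁻¹ e_a` in `V* ⊗ V`. -/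
noncomputable def cupCoeff (n : ℕ) (d : Bool) (a b : Fin (n + 1)) : RationalFunctions :=
  if d then (if a = b then 1 else 0) else (WeightModule.irrep n).K (-1) b a

/-- The invariant form of a local maximum, with `d` the direction of the left strand:
`v ⊗ f ↦ f (K v)` on `V ⊗ V*`, or `f ⊗ v ↦ f v` on `V* ⊗ V`. -/
noncomputable def capCoeff (n : ℕ) (d : Bool) (a b : Fin (n + 1)) : RationalFunctions :=
  if d then (WeightModule.irrep n).K 1 b a else (if a = b then 1 else 0)

/-- The linear map of one slice.  A vector in the tensor product of the modules on the strands,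
which have the directions `u` below the slice, is given by its coordinates: `x [a₀, …, aₖ]` is the
coefficient of `e_{a₀} ⊗ ⋯ ⊗ e_{aₖ}`. -/
noncomputable def sliceMap (n : ℕ) (u : List Bool) :
    OrientedSlice → (List (Fin (n + 1)) → RationalFunctions) →
      List (Fin (n + 1)) → RationalFunctions
  | .cup i d, x, l =>
      match l.drop i with
      | a :: b :: r => cupCoeff n d a b * x (l.take i ++ r)
      | _ => 0
  | .cap i, x, l =>
      ∑ a, ∑ b, capCoeff n (u.getD i true) a b * x (l.take i ++ a :: b :: l.drop i)
  | .cross i s, x, l =>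
      match l.drop i with
      | c :: d :: r =>
          ∑ a, ∑ b,
            (strandModule n (u.getD i true)).crossing s (strandModule n (u.getD (i + 1) true))
              a b c d * x (l.take i ++ a :: b :: r)
      | _ => 0

/-- The composition of the linear maps of the slices, from the bottom to the top. -/
noncomputable def wordMap (n : ℕ) :
    List OrientedSlice → List Bool → (List (Fin (n + 1)) → RationalFunctions) →
      List (Fin (n + 1)) → RationalFunctions
  | [], _, x => x
  | s :: w, u, x => wordMap n w (s.directions u) (sliceMap n u s x)

/-- The `n`th colored Jones polynomial in the Reshetikhin–Turaev normalization: the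
Reshetikhin–Turaev invariant of the framed link whose components are colored by the irreducible
module of dimension `n + 1`. -/
noncomputable def coloredJones (n : ℕ) (D : OrientedLinkDiagram) : RationalFunctions :=
  wordMap n D.word [] (fun l => if l = [] then 1 else 0) []

end FramedSkein

open scoped Kronecker

set_option linter.unusedSectionVars false

namespace FramedSkein

/-! ### Tangle words -/

/-! The skein module is handled by a uniqueness principle. A function on closed diagrams that obeys
the Kauffman relations and a few planar moves is the bracket times its value on the empty diagram
(`IsSkeinMap.eq_genericBracket`). Applied to the class of a diagram in the skein module, this shows
that the empty link generates the module and that the skein S_n(K) is ⟨S_n(K)⟩ times the empty link.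
What remains is the scalar identity J(K,n) = (-1)^n ⟨S_n(K)⟩; that J is a Laurent polynomial is then
automatic.

The scalar identity compares two state sums. Write V_k for the irreducible module of dimension k+1.
The braiding of V_1 with itself is t times the identity plus t⁻¹ times cup after cap
(`braid_irrep_one`), which is exactly the resolution of a crossing in the bracket. The two models
differ only through orientations: a downward strand carries the dual of V_1, identified with V_1 by
`selfDual`, and under this identification the cups and caps agree except for a factor -1 at each
minimum whose left strand points down and each maximum whose left strand points up. The R-matrix is
natural and is multiplicative in tensor products (`R_tensor_left`, `R_tensor_right`, which rest on
the exponential law for q-commuting variables), so the comparison extends from one strand to a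
bundle of m strands (`Cabled.step`). Hence the bracket of the m-cable is ((-1)^m)^turns times the
state sum of the m-th tensor power of V_1 (`Cabled.bracket_cable`).

For a knot with framing zero the number of turns is odd (`neg_one_pow_turns`). This parity comes
from the same comparison at t = -1 over `ZMod 3`: there the bracket of every diagram is 1, while the
state sum is that of a signed flip and can be evaluated directly.

Finally, the state sum of a knot is additive in direct sums of modules, because a single component
cannot pass from one summand to another (`value_directSum`). With the Clebsch–Gordan rule, V_k ⊗ V_1
is the sum of V_{k+1} and V_{k-1}, the signed state sums of V_k tensored with m copies of V_1 obey
the recursion of X^m S_k, and induction on k concludes (`algebraMap_cableBracket`).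

Vectors of the bracket model are functions on infinite sequences, so that an operator on the
leftmost strands need not know how many strands there are; moving it i strands to the right is the
i-th power of the algebra homomorphism `under`. -/

theorem isTangle_append_iff {w w' : List Slice} {a c : ℕ} :
    IsTangle (w ++ w') a c ↔ ∃ b, IsTangle w a b ∧ IsTangle w' b c := by
  induction w generalizing a with
  | nil => simp [IsTangle]
  | cons s w ih => simp only [List.cons_append, IsTangle, ih]; aesop

theorem IsTangle.cases_middle {p l s : List Slice} {a c : ℕ} (h : IsTangle (p ++ (l ++ s)) a c) :
    ∃ b b', IsTangle p a b ∧ IsTangle l b b' ∧ IsTangle s b' c := by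
  obtain ⟨b, h1, h2⟩ := isTangle_append_iff.1 h
  obtain ⟨b', h2, h3⟩ := isTangle_append_iff.1 h2
  exact ⟨b, b', h1, h2, h3⟩

theorem IsTangle.replace {p l l' s : List Slice} {a c : ℕ} (h : IsTangle (p ++ (l ++ s)) a c)
    (hl : ∀ b b', IsTangle l b b' → IsTangle l' b b') : IsTangle (p ++ (l' ++ s)) a c := by
  obtain ⟨b, b', h1, h2, h3⟩ := h.cases_middle
  exact h1.append ((hl _ _ h2).append h3)

/-! ### Counting components -/

theorem exists_eq_append_cons {α : Type*} {L : List α} {i : ℕ} (h : i < L.length) :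
    ∃ A x B, L = A ++ x :: B ∧ A.length = i :=
  ⟨L.take i, L[i], L.drop (i + 1), by simp, by simp; omega⟩

theorem exists_eq_append_cons_cons {α : Type*} {L : List α} {i : ℕ} (h : i + 2 ≤ L.length) :
    ∃ A x y B, L = A ++ x :: y :: B ∧ A.length = i := by
  obtain ⟨A, x, B, rfl, hA⟩ := exists_eq_append_cons (show i < L.length by omega)
  cases B with
  | nil => simp at h; omega
  | cons y B => exact ⟨A, x, y, B, rfl, hA⟩

theorem exists_eq_append {α : Type*} {L : List α} {i : ℕ} (h : i ≤ L.length) :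
    ∃ A B, L = A ++ B ∧ A.length = i :=
  ⟨L.take i, L.drop i, by simp, by simp; omega⟩

theorem numComponentsAux_cup (w : List Slice) (f : ℕ) (A B : List ℕ) :
    numComponentsAux (.cup A.length :: w) f (A ++ B) =
      numComponentsAux w (f + 1) (A ++ f :: f :: B) := by
  simp [numComponentsAux]

theorem numComponentsAux_cap_same (w : List Slice) (f x : ℕ) (A B : List ℕ) :
    numComponentsAux (.cap A.length :: w) f (A ++ x :: x :: B) =
      numComponentsAux w f (A ++ B) + 1 := by
  simp [numComponentsAux]

theorem numComponentsAux_cap_ne (w : List Slice) (f : ℕ) {x y : ℕ} (h : x ≠ y) (A B : List ℕ) :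
    numComponentsAux (.cap A.length :: w) f (A ++ x :: y :: B) =
      numComponentsAux w f ((A ++ B).map fun z => if z = y then x else z) := by
  simp [numComponentsAux, h]

theorem numComponentsAux_cross (w : List Slice) (f x y : ℕ) (b : Bool) (A B : List ℕ) :
    numComponentsAux (.cross A.length b :: w) f (A ++ x :: y :: B) =
      numComponentsAux w f (A ++ y :: x :: B) := by
  simp [numComponentsAux]

/-- Only the coincidences between labels matter to the count, not their values or the next unused
label. This absorbs the renaming that the zigzag moves cause. -/
theorem numComponentsAux_map {w : List Slice} {a : ℕ} {f f' : ℕ} {L : List ℕ} {g : ℕ → ℕ}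
    (hw : IsTangle w L.length a)
    (hL : ∀ x ∈ L, x < f) (hg : ∀ x ∈ L, g x < f') (hinj : ∀ x ∈ L, ∀ y ∈ L, g x = g y → x = y) :
    numComponentsAux w f' (L.map g) = numComponentsAux w f L := by
  induction w generalizing f f' L g with
  | nil => rfl
  | cons s w ih =>
    obtain ⟨h1, h2⟩ := hw
    cases s with
    | cup i =>
      obtain ⟨A, B, rfl, rfl⟩ := exists_eq_append (i := i)
          (by simpa [Slice.pos, Slice.inn] using h1)
      have e := numComponentsAux_cup w f' (A.map g) (B.map g)
      rw [List.length_map] at e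
      rw [numComponentsAux_cup, List.map_append, e]
      -- The relabelling is extended by sending the fresh label to the fresh label; the bounds `f`
      -- and `f'` keep it injective.
      set g' : ℕ → ℕ := fun z => if z = f then f' else g z with hg'
      have hgg : ∀ x, x ∈ A ++ B → g' x = g x := by
        intro x hx
        have := hL x hx
        simp [hg', this.ne]
      have hA : A.map g = A.map g' := List.map_congr_left fun x hx => (hgg x (by simp [hx])).symm
      have hB : B.map g = B.map g' := List.map_congr_left fun x hx => (hgg x (by simp [hx])).symm
      have e2 : A.map g ++ f' :: f' :: B.map g = (A ++ f :: f :: B).map g' := by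
        rw [hA, hB]; simp [hg']
      rw [e2]
      have hmem : ∀ x, x ∈ A ++ f :: f :: B → x = f ∨ x ∈ A ++ B := by
        intro x hx; simp at hx ⊢; tauto
      refine ih (by simpa [Slice.inn, Slice.out, add_assoc] using h2) ?_ ?_ ?_
      · intro x hx
        rcases hmem x hx with rfl | h
        · omega
        · have := hL x h; omega
      · intro x hx
        rcases hmem x hx with rfl | h
        · simp [hg']
        · rw [hgg x h]; have := hg x h; omega
      · intro x hx y hy hxy
        rcases hmem x hx with rfl | h <;> rcases hmem y hy with rfl | h'
        · rfl
        · rw [hgg y h'] at hxy; have := hg y h'; simp [hg'] at hxy; omega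
        · rw [hgg x h] at hxy; have := hg x h; simp [hg'] at hxy; omega
        · rw [hgg x h, hgg y h'] at hxy; exact hinj x h y h' hxy
    | cap i =>
      obtain ⟨A, x, y, B, rfl, rfl⟩ := exists_eq_append_cons_cons (i := i) h1
      have hmem : ∀ z, z ∈ A ++ B → z ∈ A ++ x :: y :: B := by
        intro z hz; simp at hz ⊢; tauto
      have hlen : IsTangle w (A ++ B).length a := by
        convert h2 using 1; simp [Slice.inn, Slice.out]; omega
      rw [List.map_append, List.map_cons, List.map_cons]
      by_cases hxy : x = y
      · subst hxy
        have e := numComponentsAux_cap_same w f' (g x) (A.map g) (B.map g)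
        rw [List.length_map] at e
        rw [numComponentsAux_cap_same, e, ← List.map_append]
        rw [ih hlen (fun z hz => hL z (hmem z hz)) (fun z hz => hg z (hmem z hz))
          (fun z hz z' hz' => hinj z (hmem z hz) z' (hmem z' hz'))]
      · have hgxy : g x ≠ g y := fun h => hxy (hinj x (by simp) y (by simp) h)
        have e := numComponentsAux_cap_ne w f' hgxy (A.map g) (B.map g)
        rw [List.length_map] at e
        rw [numComponentsAux_cap_ne w f hxy, e, ← List.map_append, List.map_map]
        have e2 : (A ++ B).map ((fun z => if z = g y then g x else z) ∘ g) =
            ((A ++ B).map fun z => if z = y then x else z).map g := by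
          rw [List.map_map]
          refine List.map_congr_left fun z hz => ?_
          by_cases hzy : z = y
          · simp [hzy]
          · have : g z ≠ g y := fun h => hzy (hinj z (hmem z hz) y (by simp) h)
            simp [hzy, this]
        have hmem' : ∀ z, z ∈ ((A ++ B).map fun z => if z = y then x else z) →
            z ∈ A ++ x :: y :: B := by
          intro z hz
          obtain ⟨z', hz', rfl⟩ := List.mem_map.1 hz
          split_ifs
          · simp
          · exact hmem z' hz'
        rw [e2]
        exact ih (by simpa using hlen) (fun z hz => hL z (hmem' z hz))
          (fun z hz => hg z (hmem' z hz))
          (fun z hz z' hz' => hinj z (hmem' z hz) z' (hmem' z' hz'))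
    | cross i b =>
      obtain ⟨A, x, y, B, rfl, rfl⟩ := exists_eq_append_cons_cons (i := i) h1
      have e := numComponentsAux_cross w f' (g x) (g y) b (A.map g) (B.map g)
      rw [List.length_map] at e
      rw [numComponentsAux_cross, List.map_append, List.map_cons, List.map_cons, e]
      have hmem : ∀ z, z ∈ A ++ y :: x :: B ↔ z ∈ A ++ x :: y :: B := by
        intro z; simp; tauto
      rw [← ih (L := A ++ y :: x :: B) (f := f) (f' := f') (g := g)]
      · simp
      · convert h2 using 1; simp [Slice.inn, Slice.out]; omega
      · exact fun z hz => hL z ((hmem z).1 hz)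
      · exact fun z hz => hg z ((hmem z).1 hz)
      · exact fun z hz z' hz' => hinj z ((hmem z).1 hz) z' ((hmem z').1 hz')

theorem numComponentsAux_label_succ {w : List Slice} {a f : ℕ} {L : List ℕ}
    (hw : IsTangle w L.length a) (hL : ∀ x ∈ L, x < f) :
    numComponentsAux w (f + 1) L = numComponentsAux w f L := by
  have := numComponentsAux_map (g := id) (f' := f + 1) hw hL
    (fun x hx => by have := hL x hx; simp; omega) (fun _ _ _ _ h => h)
  simpa using this

/-- The common lower part `p` transforms the labels in the same way on both sides and closes the
same components, so a comparison of the upper parts that holds for all label lists is inherited. The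
summands `c` and `k` allow a difference in the count, needed for a removed loop, without
subtraction. -/
theorem numComponentsAux_append_congr {w w' : List Slice} {c k : ℕ} {p : List Slice} {a f : ℕ}
    {L : List ℕ} (hp : IsTangle p L.length a) (hL : ∀ x ∈ L, x < f)
    (hw : ∀ f L, L.length = a → (∀ x ∈ L, x < f) →
      numComponentsAux w f L + c = numComponentsAux w' f L + k) :
    numComponentsAux (p ++ w) f L + c = numComponentsAux (p ++ w') f L + k := by
  induction p generalizing f L with
  | nil => exact hw f L hp hL
  | cons s p ih =>
    obtain ⟨h1, h2⟩ := hp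
    rw [List.cons_append, List.cons_append]
    cases s with
    | cup i =>
      obtain ⟨A, B, rfl, rfl⟩ := exists_eq_append (i := i)
          (by simpa [Slice.pos, Slice.inn] using h1)
      rw [numComponentsAux_cup, numComponentsAux_cup]
      refine ih (by simpa [Slice.inn, Slice.out, add_assoc] using h2) ?_
      intro x hx
      have : x = f ∨ x ∈ A ++ B := by simp at hx ⊢; tauto
      rcases this with rfl | h
      · omega
      · have := hL x h; omega
    | cap i =>
      obtain ⟨A, x, y, B, rfl, rfl⟩ := exists_eq_append_cons_cons (i := i) h1
      have hlen : IsTangle p (A ++ B).length a := by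
        convert h2 using 1; simp [Slice.inn, Slice.out]; omega
      by_cases hxy : x = y
      · subst hxy
        rw [numComponentsAux_cap_same, numComponentsAux_cap_same]
        have := ih hlen (f := f) fun z hz => hL z (by simp at hz ⊢; tauto)
        omega
      · rw [numComponentsAux_cap_ne _ _ hxy, numComponentsAux_cap_ne _ _ hxy]
        refine ih (by simpa using hlen) fun z hz => ?_
        obtain ⟨z', hz', rfl⟩ := List.mem_map.1 hz
        split_ifs
        · exact hL x (by simp)
        · exact hL z' (by simp at hz' ⊢; tauto)
    | cross i b =>
      obtain ⟨A, x, y, B, rfl, rfl⟩ := exists_eq_append_cons_cons (i := i) h1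
      rw [numComponentsAux_cross, numComponentsAux_cross]
      exact ih (by convert h2 using 1; simp [Slice.inn, Slice.out]; omega)
        fun z hz => hL z (by simp at hz ⊢; tauto)

theorem numComponents_loop {p s : List Slice} {i : ℕ}
    (h : IsTangle (p ++ (.cup i :: .cap i :: s)) 0 0) :
    numComponents (p ++ (.cup i :: .cap i :: s)) = numComponents (p ++ s) + 1 := by
  obtain ⟨b, b', h1, h2, h3⟩ := IsTangle.cases_middle (l := [.cup i, .cap i]) h
  refine numComponentsAux_append_congr (c := 0) (k := 1) h1 (by simp) fun f L hL hf => ?_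
  simp only [IsTangle, Slice.pos, Slice.inn, Slice.out] at h2
  obtain ⟨A, B, rfl, rfl⟩ := exists_eq_append (L := L) (i := i) (by omega)
  rw [numComponentsAux_cup, numComponentsAux_cap_same,
    numComponentsAux_label_succ (a := 0) (by convert h3 using 1; omega) hf]

/-- A cap keeps the label of its left strand, here the fresh one, so straightening renames the old
label `x` to `f` everywhere. This renaming is injective. -/
theorem numComponents_zigzag_right {p s : List Slice} {i : ℕ}
    (h : IsTangle (p ++ (.cup i :: .cap (i + 1) :: s)) 0 0) :
    numComponents (p ++ (.cup i :: .cap (i + 1) :: s)) = numComponents (p ++ s) := by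
  obtain ⟨b, b', h1, h2, h3⟩ := IsTangle.cases_middle (l := [.cup i, .cap (i + 1)]) h
  refine numComponentsAux_append_congr (c := 0) (k := 0) h1 (by simp) fun f L hL hf => ?_
  simp only [IsTangle, Slice.pos, Slice.inn, Slice.out] at h2
  obtain ⟨A, x, B, rfl, rfl⟩ := exists_eq_append_cons (L := L) (i := i) (by omega)
  have hx : f ≠ x := by have := hf x (by simp); omega
  have e := numComponentsAux_cap_ne s (f + 1) hx (A ++ [f]) B
  simp only [List.length_append, List.length_singleton, List.append_assoc, List.singleton_append]
    at e
  rw [numComponentsAux_cup, e]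
  rw [← numComponentsAux_map (a := 0) (f' := f + 1) (g := fun z => if z = x then f else z)
    (L := A ++ x :: B) (by convert h3 using 1; omega) hf]
  · simp [hx]
  · intro z hz
    have := hf z hz
    split_ifs <;> omega
  · intro z hz z' hz' hzz
    have := hf z hz
    have := hf z' hz'
    split_ifs at hzz <;> omega

/-- Here the left strand of the cap is the old one, so the label list is restored and only the next
unused label has grown. -/
theorem numComponents_zigzag_left {p s : List Slice} {i : ℕ}
    (h : IsTangle (p ++ (.cup (i + 1) :: .cap i :: s)) 0 0) :
    numComponents (p ++ (.cup (i + 1) :: .cap i :: s)) = numComponents (p ++ s) := by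
  obtain ⟨b, b', h1, h2, h3⟩ := IsTangle.cases_middle (l := [.cup (i + 1), .cap i]) h
  refine numComponentsAux_append_congr (c := 0) (k := 0) h1 (by simp) fun f L hL hf => ?_
  simp only [IsTangle, Slice.pos, Slice.inn, Slice.out] at h2
  obtain ⟨A, x, B, rfl, rfl⟩ := exists_eq_append_cons (L := L) (i := i) (by omega)
  have hx : x ≠ f := by have := hf x (by simp); omega
  have e := numComponentsAux_cup (.cap A.length :: s) f (A ++ [x]) B
  simp only [List.length_append, List.length_singleton, List.append_assoc, List.singleton_append]
    at e
  rw [e, numComponentsAux_cap_ne _ _ hx]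
  rw [← numComponentsAux_label_succ (L := A ++ x :: B) (a := 0) (by convert h3 using 1; omega) hf]
  congr 2
  have : ∀ C : List ℕ, (∀ z ∈ C, z ∈ A ++ x :: B) →
      C.map (fun z => if z = f then x else z) = C := by
    intro C hC
    conv_rhs => rw [← List.map_id C]
    refine List.map_congr_left fun z hz => ?_
    have := hf z (hC z hz)
    simp [this.ne]
  rw [List.map_append, List.map_cons, this A (by simp +contextual), this B (by simp +contextual)]
  simp

theorem numComponents_exchange_right {p s : List Slice} {j m : ℕ}
    (h : IsTangle (p ++ (.cup j :: .cap (j + 2 + m) :: s)) 0 0) :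
    numComponents (p ++ (.cup j :: .cap (j + 2 + m) :: s)) =
      numComponents (p ++ (.cap (j + m) :: .cup j :: s)) := by
  obtain ⟨b, b', h1, h2, h3⟩ := IsTangle.cases_middle (l := [.cup j, .cap (j + 2 + m)]) h
  refine numComponentsAux_append_congr (c := 0) (k := 0) h1 (by simp) fun f L hL hf => ?_
  simp only [IsTangle, Slice.pos, Slice.inn, Slice.out] at h2
  obtain ⟨A, x, y, B, rfl, hA⟩ := exists_eq_append_cons_cons (L := L) (i := j + m) (by omega)
  obtain ⟨A, C, rfl, rfl⟩ := exists_eq_append (L := A) (i := j) (by omega)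
  obtain rfl : C.length = m := by simpa using hA
  have e1 := numComponentsAux_cup (.cap (A.length + 2 + C.length) :: s) f A (C ++ x :: y :: B)
  rw [List.append_assoc, e1]
  by_cases hxy : x = y
  · subst hxy
    have e2 := numComponentsAux_cap_same s (f + 1) x (A ++ f :: f :: C) B
    have e3 := numComponentsAux_cap_same (.cup A.length :: s) f x (A ++ C) B
    have e4 := numComponentsAux_cup s f A (C ++ B)
    simp only [List.length_append, List.length_cons, List.append_assoc, List.cons_append] at e2 e3
    rw [show A.length + 2 + C.length = A.length + (C.length + 1 + 1) by omega, e2, e3, e4]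
  · have e2 := numComponentsAux_cap_ne s (f + 1) hxy (A ++ f :: f :: C) B
    have e3 := numComponentsAux_cap_ne (.cup A.length :: s) f hxy (A ++ C) B
    have e4 := numComponentsAux_cup s f (A.map fun z => if z = y then x else z)
      ((C ++ B).map fun z => if z = y then x else z)
    have hy : f ≠ y := by have := hf y (by simp); omega
    simp only [List.length_append, List.length_cons, List.append_assoc, List.cons_append,
      List.length_map, List.map_append, List.map_cons, hy, if_false] at e2 e3 e4
    rw [show A.length + 2 + C.length = A.length + (C.length + 1 + 1) by omega, e2, e3, e4]

theorem numComponents_exchange_left {p s : List Slice} {i m : ℕ}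
    (h : IsTangle (p ++ (.cup (i + 2 + m) :: .cap i :: s)) 0 0) :
    numComponents (p ++ (.cup (i + 2 + m) :: .cap i :: s)) =
      numComponents (p ++ (.cap i :: .cup (i + m) :: s)) := by
  obtain ⟨b, b', h1, h2, h3⟩ := IsTangle.cases_middle (l := [.cup (i + 2 + m), .cap i]) h
  refine numComponentsAux_append_congr (c := 0) (k := 0) h1 (by simp) fun f L hL hf => ?_
  simp only [IsTangle, Slice.pos, Slice.inn, Slice.out] at h2
  obtain ⟨A, x, y, B, rfl, rfl⟩ := exists_eq_append_cons_cons (L := L) (i := i) (by omega)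
  simp only [List.length_append, List.length_cons] at hL
  obtain ⟨C, B, rfl, rfl⟩ := exists_eq_append (L := B) (i := m) (by omega)
  have e1 := numComponentsAux_cup (.cap A.length :: s) f (A ++ x :: y :: C) B
  simp only [List.length_append, List.length_cons, List.append_assoc, List.cons_append] at e1
  rw [show A.length + 2 + C.length = A.length + (C.length + 1 + 1) by omega, e1]
  by_cases hxy : x = y
  · subst hxy
    rw [numComponentsAux_cap_same, numComponentsAux_cap_same]
    have e4 := numComponentsAux_cup s f (A ++ C) B
    simp only [List.length_append, List.append_assoc] at e4
    rw [e4]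
  · rw [numComponentsAux_cap_ne _ _ hxy, numComponentsAux_cap_ne _ _ hxy]
    have e4 := numComponentsAux_cup s f ((A ++ C).map fun z => if z = y then x else z)
      (B.map fun z => if z = y then x else z)
    have hy : f ≠ y := by have := hf y (by simp); omega
    simp only [List.length_append, List.append_assoc,
      List.length_map, List.map_append] at e4
    simp only [List.map_append, List.map_cons, hy, if_false]
    rw [e4]

end FramedSkein

namespace FramedSkein

/-! ### Functions of diagrams that satisfy the Kauffman relations -/

/-- A function on closed words that is unchanged by planar isotopies and satisfies the Kauffman
relations, with the coefficients `α b` and `β b` of the two smoothings of a crossing and the value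
`δ` of a trivial component. -/
structure IsSkeinMap {R M : Type*} [CommRing R] [AddCommGroup M] [Module R M] (α β : Bool → R)
    (δ : R) (Φ : List Slice → M) : Prop where
  cross : ∀ p s i b, IsTangle (p ++ (.cross i b :: s)) 0 0 →
    Φ (p ++ (.cross i b :: s)) = α b • Φ (p ++ s) + β b • Φ (p ++ (.cap i :: .cup i :: s))
  loop : ∀ p s i, IsTangle (p ++ (.cup i :: .cap i :: s)) 0 0 →
    Φ (p ++ (.cup i :: .cap i :: s)) = δ • Φ (p ++ s)
  zigzag_right : ∀ p s i, IsTangle (p ++ (.cup i :: .cap (i + 1) :: s)) 0 0 →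
    Φ (p ++ (.cup i :: .cap (i + 1) :: s)) = Φ (p ++ s)
  zigzag_left : ∀ p s i, IsTangle (p ++ (.cup (i + 1) :: .cap i :: s)) 0 0 →
    Φ (p ++ (.cup (i + 1) :: .cap i :: s)) = Φ (p ++ s)
  exchange_right : ∀ p s j m, IsTangle (p ++ (.cup j :: .cap (j + 2 + m) :: s)) 0 0 →
    Φ (p ++ (.cup j :: .cap (j + 2 + m) :: s)) = Φ (p ++ (.cap (j + m) :: .cup j :: s))
  exchange_left : ∀ p s i m, IsTangle (p ++ (.cup (i + 2 + m) :: .cap i :: s)) 0 0 →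
    Φ (p ++ (.cup (i + 2 + m) :: .cap i :: s)) = Φ (p ++ (.cap i :: .cup (i + m) :: s))

/-- The bracket with arbitrary coefficients. -/
def genericBracket {R : Type*} [CommRing R] (α β : Bool → R) (δ : R) :
    List Slice → List Slice → R
  | v, [] => δ ^ numComponents v
  | v, .cross i b :: w =>
      α b * genericBracket α β δ v w + β b * genericBracket α β δ (v ++ [.cap i, .cup i]) w
  | v, .cup i :: w => genericBracket α β δ (v ++ [.cup i]) w
  | v, .cap i :: w => genericBracket α β δ (v ++ [.cap i]) w

/-- A slice without crossing. -/
def Slice.IsPlanar : Slice → Prop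
  | .cross _ _ => False
  | _ => True

/-- A local minimum. -/
def Slice.IsCup : Slice → Prop
  | .cup _ => True
  | _ => False

theorem IsTangle.of_cups {w : List Slice} {a b : ℕ} (h : IsTangle w a b)
    (hw : ∀ s ∈ w, s.IsCup) : b = a + 2 * w.length := by
  induction w generalizing a with
  | nil => simpa [IsTangle] using h.symm
  | cons s w ih =>
    have := ih h.2 fun s hs => hw s (by simp [hs])
    cases s with
    | cup i => simp [Slice.inn, Slice.out] at this ⊢; omega
    | cap i => exact absurd (hw _ List.mem_cons_self) id
    | cross i b => exact absurd (hw _ List.mem_cons_self) id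

theorem cups_or_exists_cap {w : List Slice} (h : ∀ s ∈ w, s.IsPlanar) :
    (∀ s ∈ w, s.IsCup) ∨ ∃ p i s, w = p ++ (.cap i :: s) ∧ ∀ s ∈ p, s.IsCup := by
  induction w with
  | nil => simp
  | cons s w ih =>
    cases s with
    | cup i =>
      rcases ih fun s hs => h s (by simp [hs]) with h' | ⟨p, j, s, rfl, hp⟩
      · left
        intro s hs
        rcases List.mem_cons.1 hs with rfl | hs
        · trivial
        · exact h' s hs
      · refine Or.inr ⟨.cup i :: p, j, s, rfl, ?_⟩
        intro s hs
        rcases List.mem_cons.1 hs with rfl | hs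
        · trivial
        · exact hp s hs
    | cap i => exact Or.inr ⟨[], i, w, rfl, by simp⟩
    | cross i b => exact absurd (h _ List.mem_cons_self) id

theorem IsTangle.loop {p s : List Slice} {i : ℕ}
    (h : IsTangle (p ++ (.cup i :: .cap i :: s)) 0 0) : IsTangle (p ++ s) 0 0 :=
  IsTangle.replace (l := [.cup i, .cap i]) (l' := []) h fun b b' hb => by
    simp [IsTangle, Slice.pos, Slice.inn, Slice.out] at hb ⊢; omega

theorem IsTangle.zigzag_right {p s : List Slice} {i : ℕ}
    (h : IsTangle (p ++ (.cup i :: .cap (i + 1) :: s)) 0 0) : IsTangle (p ++ s) 0 0 :=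
  IsTangle.replace (l := [.cup i, .cap (i + 1)]) (l' := []) h fun b b' hb => by
    simp [IsTangle, Slice.pos, Slice.inn, Slice.out] at hb ⊢; omega

theorem IsTangle.zigzag_left {p s : List Slice} {i : ℕ}
    (h : IsTangle (p ++ (.cup (i + 1) :: .cap i :: s)) 0 0) : IsTangle (p ++ s) 0 0 :=
  IsTangle.replace (l := [.cup (i + 1), .cap i]) (l' := []) h fun b b' hb => by
    simp [IsTangle, Slice.pos, Slice.inn, Slice.out] at hb ⊢; omega

theorem IsTangle.exchange_right {p s : List Slice} {j m : ℕ}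
    (h : IsTangle (p ++ (.cup j :: .cap (j + 2 + m) :: s)) 0 0) :
    IsTangle (p ++ (.cap (j + m) :: .cup j :: s)) 0 0 :=
  IsTangle.replace (l := [.cup j, .cap (j + 2 + m)]) (l' := [.cap (j + m), .cup j]) h
    fun b b' hb => by
    simp [IsTangle, Slice.pos, Slice.inn, Slice.out] at hb ⊢; omega

theorem IsTangle.exchange_left {p s : List Slice} {i m : ℕ}
    (h : IsTangle (p ++ (.cup (i + 2 + m) :: .cap i :: s)) 0 0) :
    IsTangle (p ++ (.cap i :: .cup (i + m) :: s)) 0 0 :=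
  IsTangle.replace (l := [.cup (i + 2 + m), .cap i]) (l' := [.cap i, .cup (i + m)]) h
    fun b b' hb => by
    simp [IsTangle, Slice.pos, Slice.inn, Slice.out] at hb ⊢; omega

theorem IsTangle.smooth_id {p s : List Slice} {i : ℕ} {b : Bool}
    (h : IsTangle (p ++ (.cross i b :: s)) 0 0) : IsTangle (p ++ s) 0 0 :=
  IsTangle.replace (l := [.cross i b]) (l' := []) h fun b b' hb => by
    simp [IsTangle, Slice.pos, Slice.inn, Slice.out] at hb ⊢; omega

theorem IsTangle.smooth_cap_cup {p s : List Slice} {i : ℕ} {b : Bool}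
    (h : IsTangle (p ++ (.cross i b :: s)) 0 0) :
    IsTangle (p ++ (.cap i :: .cup i :: s)) 0 0 :=
  IsTangle.replace (l := [.cross i b]) (l' := [.cap i, .cup i]) h fun b b' hb => by
    simp [IsTangle, Slice.pos, Slice.inn, Slice.out] at hb ⊢; omega

namespace IsSkeinMap

variable {R M : Type*} [CommRing R] [AddCommGroup M] [Module R M] {α β : Bool → R} {δ : R}
  {Φ : List Slice → M}

/-- Look at the first cap and the cup just below it. They bound a loop, form a zigzag, or lie side
by side; in the first two cases the word gets shorter, in the last the cap moves down past the cup.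
The count of components follows each of these moves. -/
theorem planar (h : IsSkeinMap α β δ Φ) {v : List Slice} (hv : ∀ s ∈ v, s.IsPlanar)
    (hc : IsTangle v 0 0) : Φ v = δ ^ numComponents v • Φ [] := by
  induction hn : v.length using Nat.strong_induction_on generalizing v with
  | _ n ih =>
  subst hn
  rcases cups_or_exists_cap hv with h' | ⟨p, i, s, rfl, hp⟩
  · have := hc.of_cups h'
    obtain rfl : v = [] := List.eq_nil_of_length_eq_zero (by omega)
    simp [numComponents, numComponentsAux]
  -- An inner induction on the number of cups below the first cap: an exchange preserves the length
  -- of the word but lowers this number. It cannot be zero, since a cap at the very bottom has no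
  -- strands to join.
  induction hk : p.length generalizing p i s with
  | zero =>
    obtain rfl := List.eq_nil_of_length_eq_zero hk
    have := hc.1
    simp [Slice.pos, Slice.inn] at this
  | succ k ihk =>
    rcases List.eq_nil_or_concat p with rfl | ⟨p, c, rfl⟩
    · simp at hk
    rw [List.concat_eq_append] at *
    have hcup := hp c (by simp)
    have hp' : ∀ s ∈ p, s.IsCup := fun s hs => hp s (by simp [hs])
    have hv' : ∀ s ∈ p, s.IsPlanar := fun s hs => hv s (by simp [hs])
    have hs' : ∀ x ∈ s, x.IsPlanar := fun x hs => hv x (by simp [hs])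
    have hps : ∀ x ∈ p ++ s, x.IsPlanar := fun x hx =>
      (List.mem_append.1 hx).elim (hv' x) (hs' x)
    have hpl : ∀ i j, ∀ x ∈ p ++ (.cap i :: .cup j :: s), x.IsPlanar := by
      intro i j x hx
      simp only [List.mem_append, List.mem_cons] at hx
      rcases hx with hx | rfl | rfl | hx
      · exact hv' x hx
      · trivial
      · trivial
      · exact hs' x hx
    cases c with
    | cap j => exact hcup.elim
    | cross j b => exact hcup.elim
    | cup j =>
      simp only [List.append_assoc, List.singleton_append] at hc ih ihk ⊢
      have hlt : (p ++ s).length < (p ++ .cup j :: .cap i :: s).length := by simp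
      have hpk : p.length = k := by simpa using hk
      rcases lt_trichotomy i j with hij | rfl | hij
      · rcases Nat.lt_or_ge (i + 1) j with hij' | hij'
        · obtain ⟨m, rfl⟩ := Nat.exists_eq_add_of_le (show i + 2 ≤ j from hij')
          rw [h.exchange_left _ _ _ _ hc, numComponents_exchange_left hc]
          refine ihk p i (.cup (i + m) :: s) hp' (hpl _ _) hc.exchange_left ?_ hpk
          intro m' hm' v hv hvc hvl
          exact ih m' (by simpa using hm') hv hvc hvl
        · obtain rfl : j = i + 1 := by omega
          rw [h.zigzag_left _ _ _ hc, numComponents_zigzag_left hc]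
          exact ih _ hlt hps hc.zigzag_left rfl
      · rw [h.loop _ _ _ hc, numComponents_loop hc, ih _ hlt hps hc.loop rfl, smul_smul,
          pow_succ']
      · rcases Nat.lt_or_ge (j + 1) i with hij' | hij'
        · obtain ⟨m, rfl⟩ := Nat.exists_eq_add_of_le (show j + 2 ≤ i from hij')
          rw [h.exchange_right _ _ _ _ hc, numComponents_exchange_right hc]
          refine ihk p (j + m) (.cup j :: s) hp' (hpl _ _) hc.exchange_right ?_ hpk
          intro m' hm' v hv hvc hvl
          exact ih m' (by simpa using hm') hv hvc hvl
        · obtain rfl : i = j + 1 := by omega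
          rw [h.zigzag_right _ _ _ hc, numComponents_zigzag_right hc]
          exact ih _ hlt hps hc.zigzag_right rfl

/-- The prefix `v` plays the role of the first argument of the bracket: the part whose crossings are
already resolved. Once `w` is used up, the planar case applies. -/
theorem eq_genericBracket_append (h : IsSkeinMap α β δ Φ) {v w : List Slice}
    (hv : ∀ s ∈ v, s.IsPlanar) (hc : IsTangle (v ++ w) 0 0) :
    Φ (v ++ w) = genericBracket α β δ v w • Φ [] := by
  induction w generalizing v with
  | nil => simpa [genericBracket] using h.planar hv (by simpa using hc)
  | cons s w ih =>
    have hpl_append : ∀ l : List Slice, (∀ x ∈ l, x.IsPlanar) → ∀ x ∈ v ++ l, x.IsPlanar := by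
      intro l hl x hx
      exact (List.mem_append.1 hx).elim (hv x) (hl x)
    cases s with
    | cup i =>
      have := ih (v := v ++ [.cup i]) (hpl_append _ (by simp [Slice.IsPlanar])) (by simpa using hc)
      simpa [genericBracket] using this
    | cap i =>
      have := ih (v := v ++ [.cap i]) (hpl_append _ (by simp [Slice.IsPlanar])) (by simpa using hc)
      simpa [genericBracket] using this
    | cross i b =>
      have h1 := ih (v := v) hv hc.smooth_id
      have h2 := ih (v := v ++ [.cap i, .cup i]) (hpl_append _ (by simp [Slice.IsPlanar]))
        (by simpa using hc.smooth_cap_cup)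
      rw [List.append_assoc, List.cons_append, List.singleton_append] at h2
      rw [h.cross _ _ _ _ hc, h1, h2, genericBracket, add_smul, smul_smul, smul_smul]

/-- The uniqueness principle. It serves for classes in the skein module, for the state model over
the field of rational functions, and for the state model over `ZMod 3`. -/
theorem eq_genericBracket (h : IsSkeinMap α β δ Φ) {w : List Slice} (hc : IsTangle w 0 0) :
    Φ w = genericBracket α β δ [] w • Φ [] :=
  h.eq_genericBracket_append (v := []) (by simp) hc

end IsSkeinMap

theorem bracketAux_eq_genericBracket (v w : List Slice) :
    bracketAux v w = genericBracket (fun b => LaurentPolynomial.T (smoothingExponent b))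
      (fun b => LaurentPolynomial.T (-smoothingExponent b)) loopValue v w := by
  induction w generalizing v with
  | nil => rfl
  | cons s w ih => cases s <;> simp [bracketAux, genericBracket, ih]

/-! ### The skein module of the 3-sphere -/

open Classical in
/-- The skein of a word, which is zero if the word is not closed. -/
noncomputable def wordSkein (w : List Slice) : KauffmanSkeinModule :=
  if h : IsTangle w 0 0 then skein ⟨w, h⟩ else 0

theorem wordSkein_of_closed {w : List Slice} (h : IsTangle w 0 0) : wordSkein w = skein ⟨w, h⟩ :=
  dif_pos h

theorem wordSkein_eq_of_localMove {p l l' s : List Slice} (hl : LocalMove l l')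
    (h : IsTangle (p ++ (l ++ s)) 0 0) (h' : IsTangle (p ++ (l' ++ s)) 0 0) :
    wordSkein (p ++ (l ++ s)) = wordSkein (p ++ (l' ++ s)) := by
  rw [wordSkein_of_closed h, wordSkein_of_closed h', skein, skein]
  congr 2
  exact Quot.sound ⟨p, s, l, l', hl, by simp, by simp⟩

/-- No Reidemeister move enters: crossings are removed by the skein relation, and planar words need
only the zigzags and the exchange of a cup with a cap. -/
theorem isSkeinMap_wordSkein :
    IsSkeinMap (fun b => LaurentPolynomial.T (smoothingExponent b))
      (fun b => LaurentPolynomial.T (-smoothingExponent b)) loopValue wordSkein where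
  cross p s i b h := by
    rw [wordSkein_of_closed h, wordSkein_of_closed h.smooth_id,
      wordSkein_of_closed h.smooth_cap_cup]
    have := (Submodule.Quotient.mk_eq_zero _).2 (Submodule.subset_span
      (SkeinRelation.crossing p s i b ⟨_, h⟩ ⟨_, h.smooth_id⟩ ⟨_, h.smooth_cap_cup⟩
        (by simp) rfl (by simp)) : _ ∈ Submodule.span ℂ[T;T⁻¹] {x | SkeinRelation x})
    rw [Submodule.Quotient.mk_sub, Submodule.Quotient.mk_sub, sub_sub, sub_eq_zero] at this
    rw [skein, this, skein, skein, ← Submodule.Quotient.mk_smul, ← Submodule.Quotient.mk_smul,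
      Finsupp.smul_single, Finsupp.smul_single]
    simp
  loop p s i h := by
    rw [wordSkein_of_closed h, wordSkein_of_closed h.loop]
    have := (Submodule.Quotient.mk_eq_zero _).2 (Submodule.subset_span
      (SkeinRelation.trivial p s i ⟨_, h.loop⟩ ⟨_, h⟩ (by simp) rfl) :
        _ ∈ Submodule.span ℂ[T;T⁻¹] {x | SkeinRelation x})
    rw [Submodule.Quotient.mk_sub, sub_eq_zero] at this
    rw [skein, this, skein, ← Submodule.Quotient.mk_smul, Finsupp.smul_single]
    simp
  zigzag_right p s i h :=
    wordSkein_eq_of_localMove (l' := []) (.zigzag_right i) h h.zigzag_right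
  zigzag_left p s i h :=
    wordSkein_eq_of_localMove (l' := []) (.zigzag_left i) h h.zigzag_left
  exchange_right p s j m h := by
    -- The position 0 is a dummy, since `moveTo` discards it.
    have := LocalMove.exchange (.cup j) (.cap 0) m
    simp only [Slice.moveTo, Slice.pos, Slice.inn, Slice.out, add_zero] at this
    exact wordSkein_eq_of_localMove this h h.exchange_right
  exchange_left p s i m h := by
    have := LocalMove.exchange (.cap i) (.cup 0) m
    simp only [Slice.moveTo, Slice.pos, Slice.inn, Slice.out, add_zero] at this
    exact (wordSkein_eq_of_localMove this h.exchange_left h).symm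

/-- The empty link generates the skein module, with the bracket as coordinate. This reduces the
identity of skeins to one of Laurent polynomials. -/
theorem skein_eq_bracket_smul (D : LinkDiagram) :
    skein D = bracket D • skein LinkDiagram.empty := by
  have := isSkeinMap_wordSkein.eq_genericBracket D.closed
  rw [← bracketAux_eq_genericBracket, wordSkein_of_closed D.closed,
    wordSkein_of_closed (w := []) rfl] at this
  exact this

theorem skeinS_eq_coloredBracket_smul (n : ℕ) (K : LinkDiagram) :
    skeinS n K = coloredBracket n K • skein LinkDiagram.empty := by
  rw [skeinS, coloredBracket, Polynomial.sum, Polynomial.sum, Finset.sum_smul]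
  refine Finset.sum_congr rfl fun m _ => ?_
  rw [skein_eq_bracket_smul (K.cable m), smul_smul]

end FramedSkein

namespace FramedSkein

/-! ### Operators on functions of infinite sequences -/

/-- Functions on infinite sequences; they contain the tensor powers of the functions on `κ`. -/
abbrev StreamFun (R κ : Type*) : Type _ := Stream' κ → R

section Under

variable {R κ : Type*} [CommRing R]

/-- Let an operator act on the functions of the tail of a sequence. -/
def under : Module.End R (StreamFun R κ) →ₐ[R] Module.End R (StreamFun R κ) where
  toFun A :=
    { toFun := fun x l => A (fun r => x (Stream'.cons l.head r)) l.tail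
      map_add' := fun x y => by
        funext l
        exact congrFun (A.map_add (fun r => x (Stream'.cons l.head r)) fun r =>
          y (Stream'.cons l.head r)) l.tail
      map_smul' := fun c x => by
        funext l
        exact congrFun (A.map_smul c fun r => x (Stream'.cons l.head r)) l.tail }
  map_one' := by
    ext x l
    exact congrArg x (Stream'.eta l)
  map_mul' A B := by ext x l; rfl
  map_zero' := rfl
  map_add' A B := rfl
  commutes' c := by
    ext x l
    exact congrArg (fun l => c * x l) (Stream'.eta l)

theorem under_apply (A : Module.End R (StreamFun R κ)) (x : StreamFun R κ) (l : Stream' κ) :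
    under A x l = A (fun r => x (Stream'.cons l.head r)) l.tail := rfl

theorem under_pow_succ (i : ℕ) (A : Module.End R (StreamFun R κ)) :
    (under ^ (i + 1)) A = under ((under ^ i) A) := by
  rw [pow_succ']; rfl

theorem under_pow_add (i j : ℕ) (A : Module.End R (StreamFun R κ)) :
    (under ^ (i + j)) A = (under ^ i) ((under ^ j) A) := by
  rw [pow_add]; rfl

end Under

/-! ### The state model of the Kauffman bracket -/

section Kauffman

variable {R : Type*} [CommRing R]

/-- The coefficients of a local minimum. -/
def kauffmanCup (t : Rˣ) (a b : Fin 2) : R := !![0, 1; -(t : R) ^ 2, 0] a b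

/-- The coefficients of a local maximum. -/
def kauffmanCap (t : Rˣ) (a b : Fin 2) : R := !![0, -((t⁻¹ : Rˣ) : R) ^ 2; 1, 0] a b

/-- The operator of the local minimum on the left. -/
def cupOp (t : Rˣ) : Module.End R (StreamFun R (Fin 2)) where
  toFun x l := kauffmanCup t l.head l.tail.head * x l.tail.tail
  map_add' x y := by funext l; exact mul_add _ _ _
  map_smul' c x := by funext l; exact mul_left_comm _ _ _

/-- The operator of the local maximum on the left. -/
def capOp (t : Rˣ) : Module.End R (StreamFun R (Fin 2)) where
  toFun x l := ∑ a, ∑ b, kauffmanCap t a b * x (Stream'.cons a (Stream'.cons b l))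
  map_add' x y := by
    funext l; simp only [Pi.add_apply, mul_add, Finset.sum_add_distrib]
  map_smul' c x := by
    funext l
    simp only [Pi.smul_apply, smul_eq_mul, Finset.mul_sum, RingHom.id_apply, mul_left_comm]

/-- The coefficient of the resolution of a crossing into vertical strands. -/
def crossingCoeff (t : Rˣ) (b : Bool) : R := ((if b then t else t⁻¹ : Rˣ) : R)

/-- The operator of a slice in the state model of the Kauffman bracket. -/
def kauffmanOp (t : Rˣ) : Slice → Module.End R (StreamFun R (Fin 2))
  | .cup i => (under ^ i) (cupOp t)
  | .cap i => (under ^ i) (capOp t)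
  | .cross i b => (under ^ i)
      (crossingCoeff t b • 1 + crossingCoeff t (!b) • (cupOp t * capOp t))

/-- The operator of a word, read from the bottom to the top. -/
def kauffmanWord (t : Rˣ) : List Slice → Module.End R (StreamFun R (Fin 2))
  | [] => 1
  | s :: w => kauffmanWord t w * kauffmanOp t s

variable (t : Rˣ)

theorem kauffmanOp_cup_zero_apply (x : StreamFun R (Fin 2)) (l : Stream' (Fin 2)) :
    kauffmanOp t (.cup 0) x l = kauffmanCup t l.head l.tail.head * x l.tail.tail := rfl

theorem kauffmanOp_cap_zero_apply (x : StreamFun R (Fin 2)) (l : Stream' (Fin 2)) :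
    kauffmanOp t (.cap 0) x l =
      ∑ a, ∑ b, kauffmanCap t a b * x (Stream'.cons a (Stream'.cons b l)) := rfl

theorem kauffmanOp_cross_zero_apply (b : Bool) (x : StreamFun R (Fin 2))
    (l : Stream' (Fin 2)) :
    kauffmanOp t (.cross 0 b) x l = crossingCoeff t b * x l +
      crossingCoeff t (!b) * (kauffmanCup t l.head l.tail.head *
        ∑ a, ∑ b, kauffmanCap t a b * x (Stream'.cons a (Stream'.cons b l.tail.tail))) := rfl

theorem kauffmanWord_append (w w' : List Slice) :
    kauffmanWord t (w ++ w') = kauffmanWord t w' * kauffmanWord t w := by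
  induction w with
  | nil => simp [kauffmanWord]
  | cons s w ih => simp [kauffmanWord, ih, mul_assoc]

/-- The matrices `kauffmanCup` and `kauffmanCap` are inverse to each other; the two orders of their
product are this zigzag identity and the next one. -/
theorem cup_capOp_under : under (capOp t) * cupOp t = 1 := by
  ext x l
  have h : under (capOp t) (cupOp t x) l = ∑ a, ∑ b, kauffmanCap t a b *
    (kauffmanCup t l.head a * x (Stream'.cons b l.tail)) := rfl
  rw [Module.End.mul_apply, h, Module.End.one_apply]
  conv_rhs => rw [← Stream'.eta l]
  generalize l.head = c
  fin_cases c <;> simp [kauffmanCup, kauffmanCap, ← mul_assoc, ← mul_pow]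

theorem cap_under_cupOp : capOp t * under (cupOp t) = 1 := by
  ext x l
  have h : capOp t (under (cupOp t) x) l = ∑ a, ∑ b, kauffmanCap t a b *
    (kauffmanCup t b l.head * x (Stream'.cons a l.tail)) := rfl
  rw [Module.End.mul_apply, h, Module.End.one_apply]
  conv_rhs => rw [← Stream'.eta l]
  generalize l.head = c
  fin_cases c <;> simp [kauffmanCup, kauffmanCap, ← mul_assoc, ← mul_pow]

theorem capOp_mul_cupOp :
    capOp t * cupOp t = (-(t : R) ^ 2 - ((t⁻¹ : Rˣ) : R) ^ 2) • 1 := by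
  ext x l
  have h : capOp t (cupOp t x) l = ∑ a, ∑ b, kauffmanCap t a b *
    (kauffmanCup t a b * x l) := rfl
  rw [Module.End.mul_apply, h]
  simp [kauffmanCup, kauffmanCap]
  ring

/-- An operator to the right of the two strands of a cup does not see them, and linearity takes it
past the coefficient of the cup. This and its analogue for caps are the exchange moves. -/
theorem under_under_mul_cupOp (A : Module.End R (StreamFun R (Fin 2))) :
    under (under A) * cupOp t = cupOp t * A := by
  ext x l
  exact congrFun (A.map_smul (kauffmanCup t l.head l.tail.head) x) l.tail.tail

theorem capOp_mul_under_under (A : Module.End R (StreamFun R (Fin 2))) :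
    capOp t * under (under A) = A * capOp t := by
  ext x l
  have h : A (capOp t x) = ∑ a, ∑ b, kauffmanCap t a b •
      A (fun l => x (Stream'.cons a (Stream'.cons b l))) := by
    rw [show capOp t x = ∑ a, ∑ b, kauffmanCap t a b •
      (fun l => x (Stream'.cons a (Stream'.cons b l)) : StreamFun R (Fin 2)) by
        funext l; simp [capOp, Finset.sum_apply]]
    simp only [map_sum, map_smul]
  rw [Module.End.mul_apply, Module.End.mul_apply, h]
  simp only [Finset.sum_apply, Pi.smul_apply, smul_eq_mul]
  rfl

theorem kauffmanWord_middle (p l s : List Slice) (x : StreamFun R (Fin 2)) :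
    kauffmanWord t (p ++ (l ++ s)) x =
      kauffmanWord t s (kauffmanWord t l (kauffmanWord t p x)) := by
  rw [kauffmanWord_append, kauffmanWord_append]; rfl

/-- Each relation is an identity between operators on the leftmost strands, transported by the
homomorphism `under ^ i`. The initial vector `x` is arbitrary. -/
theorem isSkeinMap_kauffmanWord (x : StreamFun R (Fin 2)) :
    IsSkeinMap (crossingCoeff t) (fun b => crossingCoeff t (!b))
      (-(t : R) ^ 2 - ((t⁻¹ : Rˣ) : R) ^ 2) fun w => kauffmanWord t w x where
  cross p s i b _ := by
    rw [← List.singleton_append (x := Slice.cross i b),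
      show p ++ (.cap i :: .cup i :: s) = p ++ ([.cap i, .cup i] ++ s) from rfl,
      kauffmanWord_middle, kauffmanWord_middle, kauffmanWord_append]
    simp only [kauffmanWord, kauffmanOp, one_mul, map_add, map_smul, map_one, map_mul,
      LinearMap.add_apply, LinearMap.smul_apply, Module.End.mul_apply, Module.End.one_apply]
  loop p s i _ := by
    rw [show p ++ (.cup i :: .cap i :: s) = p ++ ([.cup i, .cap i] ++ s) from rfl,
      kauffmanWord_middle, kauffmanWord_append]
    simp only [kauffmanWord, kauffmanOp, one_mul, ← map_mul, capOp_mul_cupOp, map_smul, map_one]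
    simp
  zigzag_right p s i _ := by
    rw [show p ++ (.cup i :: .cap (i + 1) :: s) = p ++ ([.cup i, .cap (i + 1)] ++ s) from rfl,
      kauffmanWord_middle, kauffmanWord_append]
    simp only [kauffmanWord, kauffmanOp, one_mul, under_pow_add, pow_one, ← map_mul,
      cup_capOp_under, map_one, Module.End.one_apply]
    rfl
  zigzag_left p s i _ := by
    rw [show p ++ (.cup (i + 1) :: .cap i :: s) = p ++ ([.cup (i + 1), .cap i] ++ s) from rfl,
      kauffmanWord_middle, kauffmanWord_append]
    simp only [kauffmanWord, kauffmanOp, one_mul, under_pow_add, pow_one, ← map_mul,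
      cap_under_cupOp, map_one, Module.End.one_apply]
    rfl
  exchange_right p s j m _ := by
    rw [show p ++ (.cup j :: .cap (j + 2 + m) :: s) =
        p ++ ([.cup j, .cap (j + 2 + m)] ++ s) from rfl,
      show p ++ (.cap (j + m) :: .cup j :: s) = p ++ ([.cap (j + m), .cup j] ++ s) from rfl,
      kauffmanWord_middle, kauffmanWord_middle]
    simp only [kauffmanWord, kauffmanOp, one_mul, under_pow_add, ← map_mul]
    rw [← under_under_mul_cupOp]
    rfl
  exchange_left p s i m _ := by
    rw [show p ++ (.cup (i + 2 + m) :: .cap i :: s) =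
        p ++ ([.cup (i + 2 + m), .cap i] ++ s) from rfl,
      show p ++ (.cap i :: .cup (i + m) :: s) = p ++ ([.cap i, .cup (i + m)] ++ s) from rfl,
      kauffmanWord_middle, kauffmanWord_middle]
    simp only [kauffmanWord, kauffmanOp, one_mul, under_pow_add, ← map_mul]
    rw [← capOp_mul_under_under]
    rfl

end Kauffman

theorem map_genericBracket {R R' : Type*} [CommRing R] [CommRing R'] (φ : R →+* R')
    (α β : Bool → R) (δ : R) (v w : List Slice) :
    φ (genericBracket α β δ v w) =
      genericBracket (fun b => φ (α b)) (fun b => φ (β b)) (φ δ) v w := by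
  induction w generalizing v with
  | nil => simp [genericBracket]
  | cons s w ih => cases s <;> simp [genericBracket, ih]

theorem tVar_ne_zero : tVar ≠ 0 := by
  rw [tVar, Ne, FaithfulSMul.algebraMap_eq_zero_iff]
  exact (LaurentPolynomial.isUnit_T 1).ne_zero

/-- The parameter `t` as a unit. -/
noncomputable def tUnit : RationalFunctionsˣ := Units.mk0 tVar tVar_ne_zero

theorem algebraMap_T (k : ℤ) :
    algebraMap ℂ[T;T⁻¹] RationalFunctions (LaurentPolynomial.T k) = tVar ^ k := by
  have hnat : ∀ n : ℕ, algebraMap ℂ[T;T⁻¹] RationalFunctions (LaurentPolynomial.T n) =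
      tVar ^ n := by
    intro n
    rw [tVar, ← map_pow, LaurentPolynomial.T_pow, mul_one]
  have hT : algebraMap ℂ[T;T⁻¹] RationalFunctions (LaurentPolynomial.T k) *
      algebraMap ℂ[T;T⁻¹] RationalFunctions (LaurentPolynomial.T (-k)) = 1 := by
    rw [← map_mul, ← LaurentPolynomial.T_add]; simp
  obtain ⟨n, rfl | rfl⟩ := k.eq_nat_or_neg
  · rw [hnat, zpow_natCast]
  · rw [neg_neg, hnat] at hT
    rw [zpow_neg, zpow_natCast]
    exact eq_inv_of_mul_eq_one_left hT

/-- By uniqueness a closed word acts on any function by the scalar bracket, so the constant function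
1 can replace the empty tensor as initial vector. -/
theorem kauffmanWord_one {w : List Slice} (h : IsTangle w 0 0) :
    kauffmanWord tUnit w 1 =
      algebraMap ℂ[T;T⁻¹] RationalFunctions (bracket ⟨w, h⟩) • (1 : StreamFun _ (Fin 2)) := by
  have := (isSkeinMap_kauffmanWord tUnit 1).eq_genericBracket h
  rw [bracket, bracketAux_eq_genericBracket, map_genericBracket]
  refine this.trans ?_
  congr 2
  · funext b
    rw [algebraMap_T]
    cases b <;> simp [crossingCoeff, smoothingExponent, tUnit]
  · funext b
    rw [algebraMap_T]
    cases b <;> simp [crossingCoeff, smoothingExponent, tUnit]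
  · rw [loopValue, map_sub, map_neg, algebraMap_T, algebraMap_T, zpow_neg,
      show (2 : ℤ) = ((2 : ℕ) : ℤ) from rfl, zpow_natCast]
    simp [tUnit]

end FramedSkein

namespace FramedSkein

/-! ### State sums of oriented diagrams -/

/-- The coefficients of a state sum on oriented diagrams, with states `ι` on the strands.  The
coefficient of a crossing of type `s` of strands with directions `d` and `d'` is
`cross s d d' a b c e`, with the states `a`, `b` below and `c`, `e` above the crossing. -/
structure Tensors (R ι : Type*) where
  cup : Bool → ι → ι → R
  cap : Bool → ι → ι → R
  cross : Bool → Bool → Bool → ι → ι → ι → ι → R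

namespace Tensors

variable {R ι : Type*} [CommRing R] [Fintype ι]

/-- The linear map of one slice. -/
def slice (T : Tensors R ι) (u : List Bool) : OrientedSlice → (List ι → R) → List ι → R
  | .cup i d, x, l =>
      match l.drop i with
      | a :: b :: r => T.cup d a b * x (l.take i ++ r)
      | _ => 0
  | .cap i, x, l =>
      ∑ a, ∑ b, T.cap (u.getD i true) a b * x (l.take i ++ a :: b :: l.drop i)
  | .cross i s, x, l =>
      match l.drop i with
      | c :: d :: r =>
          ∑ a, ∑ b, T.cross s (u.getD i true) (u.getD (i + 1) true) a b c d *
            x (l.take i ++ a :: b :: r)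
      | _ => 0

/-- The composition of the linear maps of the slices, from the bottom to the top. -/
def eval (T : Tensors R ι) : List OrientedSlice → List Bool → (List ι → R) → List ι → R
  | [], _, x => x
  | s :: w, u, x => T.eval w (s.directions u) (T.slice u s x)

/-- The initial vector. -/
def vacuum : List ι → R
  | [] => 1
  | _ => 0

/-- The value of a closed diagram. -/
def value (T : Tensors R ι) (w : List OrientedSlice) : R := T.eval w [] vacuum []

end Tensors

/-- The same oriented slice with one more strand to its left. -/
def OrientedSlice.raise : OrientedSlice → OrientedSlice
  | cup i d => cup (i + 1) d
  | cap i => cap (i + 1)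
  | cross i b => cross (i + 1) b

theorem OrientedSlice.directions_raise (s : OrientedSlice) (d : Bool) (u : List Bool) :
    s.raise.directions (d :: u) = d :: s.directions u := by
  cases s with
  | cup i e => simp [raise, directions]
  | cap i =>
    simp only [raise, directions]
    rw [show i + 1 + 2 = (i + 2) + 1 by ring]
    simp
  | cross i b =>
    simp only [raise, directions, List.drop_succ_cons, List.take_succ_cons]
    split <;> simp

/-! ### Realizing state sums by operators, changes of basis and signs at turns -/

section Transfer

variable {R ι S : Type*} [CommRing R] [AddCommGroup S] [Module R S]

/-- Assemble a vector, given by its coordinates, with linear maps that insert one strand on the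
left. -/
def spread (G : Bool → (ι → S) →ₗ[R] S) (v : S) : List Bool → (List ι → R) →ₗ[R] S
  | [] => (LinearMap.proj (R := R) (φ := fun _ : List ι => R) []).smulRight v
  | d :: u => G d ∘ₗ LinearMap.pi fun a => spread G v u ∘ₗ LinearMap.funLeft R R (List.cons a)

theorem spread_nil (G : Bool → (ι → S) →ₗ[R] S) (v : S) (x : List ι → R) :
    spread G v [] x = x [] • v := rfl

theorem spread_cons (G : Bool → (ι → S) →ₗ[R] S) (v : S) (d : Bool) (u : List Bool)
    (x : List ι → R) :
    spread G v (d :: u) x = G d fun a => spread G v u fun r => x (a :: r) := rfl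

variable [Fintype ι]

/-- Operators `O u s` on `S` that correspond to the linear maps of the slices under `spread`. -/
structure Tensors.Realized (T : Tensors R ι) (G : Bool → (ι → S) →ₗ[R] S)
    (O : List Bool → OrientedSlice → S → S) : Prop where
  shift : ∀ d u (s : OrientedSlice) z, s.Fits u →
    O (d :: u) s.raise (G d z) = G d fun a => O u s (z a)
  cup : ∀ u d y, O u (.cup 0 d) y = G d fun a => G (!d) fun b => T.cup d a b • y
  cap : ∀ u d (z : ι → ι → S), O (d :: (!d) :: u) (.cap 0) (G d fun a => G (!d) fun b => z a b) =
    ∑ a, ∑ b, T.cap d a b • z a b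
  cross : ∀ u d d' s (z : ι → ι → S), O (d :: d' :: u) (.cross 0 s)
      (G d fun a => G d' fun b => z a b) =
    G d' fun c => G d fun e => ∑ a, ∑ b, T.cross s d d' a b c e • z a b

/-- The composition of the operators of the slices. -/
def operatorWord (O : List Bool → OrientedSlice → S → S) :
    List OrientedSlice → List Bool → S → S
  | [], _, x => x
  | s :: w, u, x => operatorWord O w (s.directions u) (O u s x)

variable {T : Tensors R ι} {G : Bool → (ι → S) →ₗ[R] S}
  {O : List Bool → OrientedSlice → S → S}

theorem Tensors.slice_raise (T : Tensors R ι) (d : Bool) (u : List Bool) (s : OrientedSlice)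
    (x : List ι → R) (a : ι) (l : List ι) :
    T.slice (d :: u) s.raise x (a :: l) = T.slice u s (fun r => x (a :: r)) l := by
  cases s with
  | cup i e => simp only [OrientedSlice.raise, slice, List.drop_succ_cons]; rfl
  | cap i => simp only [OrientedSlice.raise, slice, List.drop_succ_cons]; rfl
  | cross i b => simp only [OrientedSlice.raise, slice, List.drop_succ_cons]; rfl

namespace Tensors.Realized

theorem slice_raise (h : T.Realized G O) {v : S} {s : OrientedSlice}
    (hs : ∀ u x, s.Fits u →
      O u s (spread G v u x) = spread G v (s.directions u) (T.slice u s x))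
    (d : Bool) (u : List Bool) (x : List ι → R) (hf : s.Fits u) :
    O (d :: u) s.raise (spread G v (d :: u) x) =
      spread G v (s.raise.directions (d :: u)) (T.slice (d :: u) s.raise x) := by
  rw [spread_cons, h.shift _ _ _ _ hf, OrientedSlice.directions_raise, spread_cons]
  simp only [T.slice_raise, hs _ _ hf]

/-- Induction on the position of the slice: at position 0 this is the defining property of
`Realized` for that kind of slice, and `shift` peels off a strand to its left. -/
theorem slice_spread (h : T.Realized G O) (v : S) (s : OrientedSlice) (u : List Bool)
    (x : List ι → R) (hf : s.Fits u) :
    O u s (spread G v u x) = spread G v (s.directions u) (T.slice u s x) := by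
  cases s with
  | cup i d =>
    induction i generalizing u x with
    | zero =>
      rw [h.cup]
      have e : OrientedSlice.directions (.cup 0 d) u = d :: (!d) :: u := by
        simp [OrientedSlice.directions]
      rw [e, spread_cons]
      simp only [spread_cons, ← map_smul]
      rfl
    | succ i ih =>
      cases u with
      | nil => simp [OrientedSlice.Fits] at hf
      | cons e u => exact h.slice_raise ih e u x (by simpa [OrientedSlice.Fits] using hf)
  | cap i =>
    induction i generalizing u x with
    | zero =>
      obtain ⟨d, r, hr⟩ := hf
      obtain rfl : u = d :: (!d) :: r := by simpa using hr
      rw [spread_cons]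
      simp only [spread_cons]
      rw [h.cap]
      simp only [← map_smul, ← map_sum]
      have e : OrientedSlice.directions (.cap 0) (d :: (!d) :: r) = r := by
        simp [OrientedSlice.directions]
      rw [e]
      congr 1
      funext l
      simp [Tensors.slice, Finset.sum_apply]
    | succ i ih =>
      cases u with
      | nil => simp [OrientedSlice.Fits] at hf
      | cons e u => exact h.slice_raise ih e u x (by simpa [OrientedSlice.Fits] using hf)
  | cross i s =>
    induction i generalizing u x with
    | zero =>
      obtain ⟨d, d', r, rfl⟩ : ∃ d d' r, u = d :: d' :: r := by
        match u, hf with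
        | d :: d' :: r, _ => exact ⟨d, d', r, rfl⟩
        | [_], hf => simp [OrientedSlice.Fits] at hf
        | [], hf => simp [OrientedSlice.Fits] at hf
      rw [spread_cons]
      simp only [spread_cons]
      rw [h.cross]
      simp only [← map_smul, ← map_sum]
      have e : OrientedSlice.directions (.cross 0 s) (d :: d' :: r) = d' :: d :: r := by
        simp [OrientedSlice.directions]
      rw [e, spread_cons]
      simp only [spread_cons]
      congr 1
      funext c
      congr 1
      funext e
      congr 1
      funext l
      simp [Tensors.slice, Finset.sum_apply]
    | succ i ih =>
      cases u with
      | nil => simp [OrientedSlice.Fits] at hf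
      | cons e u =>
        refine h.slice_raise ih e u x ?_
        simp only [OrientedSlice.Fits, List.length_cons] at hf ⊢
        omega

theorem operatorWord_spread (h : T.Realized G O) (v : S) {w : List OrientedSlice}
    {u : List Bool} (hw : IsOrientedClosed w u) (x : List ι → R) :
    operatorWord O w u (spread G v u x) = T.eval w u x [] • v := by
  induction w generalizing u x with
  | nil => cases hw; rfl
  | cons s w ih =>
    rw [operatorWord, h.slice_spread v s u x hw.1, ih hw.2]
    rfl

/-- The principle by which state sums are compared: a closed diagram acts on any `v` by the value of
every state sum that its operators realize. -/
theorem operatorWord_eq (h : T.Realized G O) (v : S) {w : List OrientedSlice}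
    (hw : IsOrientedClosed w []) : operatorWord O w [] v = T.value w • v := by
  have := h.operatorWord_spread v hw vacuum
  rwa [spread_nil, vacuum, one_smul] at this

end Tensors.Realized

/-! ### Changing the states -/

/-- The operator of an oriented slice on the left, if the leftmost strands have the directions
`d` and `d'`. -/
def Tensors.leftOp (T : Tensors R ι) (d d' : Bool) :
    OrientedSlice → Module.End R (StreamFun R ι)
  | .cup _ e =>
    { toFun := fun x l => T.cup e l.head l.tail.head * x l.tail.tail
      map_add' := fun x y => by funext l; exact mul_add _ _ _
      map_smul' := fun c x => by funext l; exact mul_left_comm _ _ _ }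
  | .cap _ =>
    { toFun := fun x l => ∑ a, ∑ b, T.cap d a b * x (Stream'.cons a (Stream'.cons b l))
      map_add' := fun x y => by
        funext l; simp only [Pi.add_apply, mul_add, Finset.sum_add_distrib]
      map_smul' := fun c x => by
        funext l
        simp only [Pi.smul_apply, smul_eq_mul, Finset.mul_sum, RingHom.id_apply, mul_left_comm] }
  | .cross _ s =>
    { toFun := fun x l => ∑ a, ∑ b, T.cross s d d' a b l.head l.tail.head *
        x (Stream'.cons a (Stream'.cons b l.tail.tail))
      map_add' := fun x y => by
        funext l; simp only [Pi.add_apply, mul_add, Finset.sum_add_distrib]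
      map_smul' := fun c x => by
        funext l
        simp only [Pi.smul_apply, smul_eq_mul, Finset.mul_sum, RingHom.id_apply, mul_left_comm] }

/-- The operator of an oriented slice on the functions of sequences. -/
def Tensors.streamOp (T : Tensors R ι) (s : OrientedSlice) (u : List Bool) :
    Module.End R (StreamFun R ι) :=
  (under ^ s.forget.pos)
    (T.leftOp (u.getD s.forget.pos true) (u.getD (s.forget.pos + 1) true) s)

theorem Tensors.streamOp_raise (T : Tensors R ι) (s : OrientedSlice) (d : Bool) (u : List Bool) :
    T.streamOp s.raise (d :: u) = under (T.streamOp s u) := by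
  cases s <;> exact under_pow_succ _ _

/-- The insertion of a strand, with a change of the states. -/
def headInsert {κ : Type*} (g : Matrix κ ι R) : (ι → StreamFun R κ) →ₗ[R] StreamFun R κ where
  toFun z l := ∑ a, g l.head a * z a l.tail
  map_add' x y := by
    funext l; simp only [Pi.add_apply, mul_add, Finset.sum_add_distrib]
  map_smul' c x := by
    funext l
    simp only [Pi.smul_apply, smul_eq_mul, Finset.mul_sum, RingHom.id_apply, mul_left_comm]

theorem under_headInsert {κ : Type*} (g : Matrix κ ι R) (A : Module.End R (StreamFun R κ))
    (z : ι → StreamFun R κ) : under A (headInsert g z) = headInsert g fun a => A (z a) := by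
  funext l
  have h : (fun r => headInsert g z (Stream'.cons l.head r)) = ∑ a, g l.head a • z a := by
    funext r
    simp [headInsert, Finset.sum_apply]
  rw [under_apply, h, map_sum]
  simp [headInsert, Finset.sum_apply]

/-- Matrices that transform the states on the strands intertwine the coefficients. -/
structure Tensors.IsHom {κ : Type*} [Fintype κ] (T : Tensors R ι) (T' : Tensors R κ)
    (g : Bool → Matrix κ ι R) : Prop where
  cup : ∀ d a' b', T'.cup d a' b' = ∑ a, ∑ b, g d a' a * (g (!d) b' b * T.cup d a b)
  cap : ∀ d a b, ∑ a', ∑ b', T'.cap d a' b' * (g d a' a * g (!d) b' b) = T.cap d a b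
  cross : ∀ s d d' a b c' e', ∑ a', ∑ b', T'.cross s d d' a' b' c' e' * (g d a' a * g d' b' b) =
    ∑ c, ∑ e, g d' c' c * (g d e' e * T.cross s d d' a b c e)

theorem Tensors.IsHom.realized {κ : Type*} [Fintype κ] {T' : Tensors R κ}
    {g : Bool → Matrix κ ι R} (h : T.IsHom T' g) :
    T.Realized (fun d => headInsert (g d)) fun u s => T'.streamOp s u where
  shift d u s z _ := by rw [streamOp_raise, under_headInsert]
  cup u d y := by
    change T'.leftOp (u.getD 0 true) (u.getD 1 true) (.cup 0 d) y = _
    funext l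
    simp only [leftOp, headInsert, LinearMap.coe_mk, AddHom.coe_mk, h.cup, Finset.sum_mul,
      Finset.mul_sum, Pi.smul_apply, smul_eq_mul]
    refine Finset.sum_congr rfl fun a _ => Finset.sum_congr rfl fun b _ => ?_
    ring
  cap u d z := by
    change T'.leftOp d (!d) (.cap 0) _ = _
    funext l
    simp only [leftOp, headInsert, LinearMap.coe_mk, AddHom.coe_mk, ← h.cap, Finset.sum_mul,
      Finset.mul_sum, Pi.smul_apply, smul_eq_mul, Finset.sum_apply,
      Stream'.head_cons, Stream'.tail_cons]
    rw [Finset.sum_congr rfl fun a' _ => Finset.sum_comm]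
    rw [Finset.sum_comm]
    refine Finset.sum_congr rfl fun a _ => ?_
    rw [Finset.sum_congr rfl fun a' _ => Finset.sum_comm]
    rw [Finset.sum_comm]
    refine Finset.sum_congr rfl fun b _ => Finset.sum_congr rfl fun _ _ =>
      Finset.sum_congr rfl fun _ _ => ?_
    ring
  cross u d d' s z := by
    change T'.leftOp d d' (.cross 0 s) _ = _
    funext l
    have e1 : ∀ a b, (∑ a', ∑ b', T'.cross s d d' a' b' l.head l.tail.head *
        (g d a' a * g d' b' b)) * z a b l.tail.tail =
        (∑ c, ∑ e, g d' l.head c * (g d l.tail.head e * T.cross s d d' a b c e)) *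
          z a b l.tail.tail := fun a b => by rw [h.cross]
    have e2 := Finset.sum_congr (rfl : (Finset.univ : Finset ι) = _) fun a _ =>
      Finset.sum_congr (rfl : (Finset.univ : Finset ι) = _) fun b _ => e1 a b
    simp only [leftOp, headInsert, LinearMap.coe_mk, AddHom.coe_mk, Finset.sum_mul,
      Finset.mul_sum, Pi.smul_apply, smul_eq_mul, Finset.sum_apply,
      Stream'.head_cons, Stream'.tail_cons] at e2 ⊢
    calc _ = _ := ?_
      _ = _ := e2
      _ = _ := ?_
    · rw [Finset.sum_congr rfl fun a' _ => Finset.sum_comm]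
      rw [Finset.sum_comm]
      refine Finset.sum_congr rfl fun a _ => ?_
      rw [Finset.sum_congr rfl fun a' _ => Finset.sum_comm]
      rw [Finset.sum_comm]
      refine Finset.sum_congr rfl fun b _ => Finset.sum_congr rfl fun _ _ =>
        Finset.sum_congr rfl fun _ _ => ?_
      ring
    · have e3 : ∀ a, ∑ b, ∑ c, ∑ e, g d' l.head c * (g d l.tail.head e *
          T.cross s d d' a b c e) * z a b l.tail.tail =
          ∑ c, ∑ e, ∑ b, g d' l.head c * (g d l.tail.head e *
          T.cross s d d' a b c e) * z a b l.tail.tail := by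
        intro a
        rw [Finset.sum_comm]
        exact Finset.sum_congr rfl fun c _ => Finset.sum_comm
      simp only [e3]
      rw [Finset.sum_comm]
      refine Finset.sum_congr rfl fun c _ => ?_
      rw [Finset.sum_comm]
      refine Finset.sum_congr rfl fun e _ => Finset.sum_congr rfl fun a _ =>
        Finset.sum_congr rfl fun b _ => ?_
      ring

theorem Tensors.isHom_one [DecidableEq ι] (T : Tensors R ι) : T.IsHom T fun _ => 1 where
  cup d a b := by simp [Matrix.one_apply]
  cap d a b := by simp [Matrix.one_apply]
  cross s d d' a b c e := by simp [Matrix.one_apply]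

/-- The operators of `T'` realize `T` through `g` and `T'` through the identity, so both values are
the same scalar. The matrices `g` need not be invertible; later they are also inclusions of a
summand. -/
theorem Tensors.IsHom.value_eq {κ : Type*} [Fintype κ] [DecidableEq κ] [Nonempty κ]
    {T' : Tensors R κ} {g : Bool → Matrix κ ι R} (h : T.IsHom T' g) {w : List OrientedSlice}
    (hw : IsOrientedClosed w []) : T.value w = T'.value w := by
  have h1 := h.realized.operatorWord_eq 1 hw
  have h2 := T'.isHom_one.realized.operatorWord_eq 1 hw
  have h3 := congrFun (h1.symm.trans h2) (Stream'.const (Classical.arbitrary κ))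
  simpa using h3

/-! ### Changing signs of local minima and maxima -/

/-- Multiply by `ε` the coefficients of the local minima whose left strand is directed downwards
and of the local maxima whose left strand is directed upwards. -/
def Tensors.twist (ε : R) (T : Tensors R ι) : Tensors R ι where
  cup d a b := if d then T.cup d a b else ε * T.cup d a b
  cap d a b := if d then ε * T.cap d a b else T.cap d a b
  cross := T.cross

/-- The number of local minima whose left strand is directed downwards and of local maxima whose
left strand is directed upwards. -/
def turns : List OrientedSlice → List Bool → ℕ
  | [], _ => 0
  | .cup i d :: w, u => (if d then 0 else 1) + turns w (OrientedSlice.directions (.cup i d) u)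
  | .cap i :: w, u =>
      (if u.getD i true then 1 else 0) + turns w (OrientedSlice.directions (.cap i) u)
  | .cross i b :: w, u => turns w (OrientedSlice.directions (.cross i b) u)

theorem Tensors.slice_smul (T : Tensors R ι) (s : OrientedSlice) (u : List Bool) (c : R)
    (x : List ι → R) : T.slice u s (c • x) = c • T.slice u s x := by
  funext l
  cases s with
  | cup i d =>
    simp only [slice, Pi.smul_apply, smul_eq_mul]
    split <;> simp [mul_left_comm]
  | cap i =>
    simp only [slice, Pi.smul_apply, smul_eq_mul, Finset.mul_sum, mul_left_comm]
  | cross i b =>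
    simp only [slice, Pi.smul_apply, smul_eq_mul]
    split <;> simp [Finset.mul_sum, mul_left_comm]

theorem Tensors.eval_smul (T : Tensors R ι) (w : List OrientedSlice) (u : List Bool) (c : R)
    (x : List ι → R) : T.eval w u (c • x) = c • T.eval w u x := by
  induction w generalizing u x with
  | nil => rfl
  | cons s w ih => rw [eval, slice_smul, ih]; rfl

theorem Tensors.slice_add (T : Tensors R ι) (s : OrientedSlice) (u : List Bool)
    (x y : List ι → R) : T.slice u s (x + y) = T.slice u s x + T.slice u s y := by
  funext l
  cases s with
  | cup i d =>
    simp only [slice, Pi.add_apply]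
    split <;> simp [mul_add]
  | cap i =>
    simp only [slice, Pi.add_apply, mul_add, Finset.sum_add_distrib]
  | cross i b =>
    simp only [slice, Pi.add_apply]
    split <;> simp [mul_add, Finset.sum_add_distrib]

theorem Tensors.eval_add (T : Tensors R ι) (w : List OrientedSlice) (u : List Bool)
    (x y : List ι → R) : T.eval w u (x + y) = T.eval w u x + T.eval w u y := by
  induction w generalizing u x y with
  | nil => rfl
  | cons s w ih => rw [eval, slice_add, ih]; rfl

theorem Tensors.eval_twist (ε : R) (T : Tensors R ι) (w : List OrientedSlice) (u : List Bool)
    (x : List ι → R) : (T.twist ε).eval w u x = ε ^ turns w u • T.eval w u x := by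
  induction w generalizing u x with
  | nil => simp [eval, turns]
  | cons s w ih =>
    rw [eval, ih, eval]
    cases s with
    | cup i d =>
      have e : (T.twist ε).slice u (.cup i d) x =
          (if d then 1 else ε : R) • T.slice u (.cup i d) x := by
        funext l
        simp only [slice, twist, Pi.smul_apply, smul_eq_mul]
        cases d <;> split <;> simp [mul_assoc]
      rw [e, eval_smul, smul_smul, turns]
      cases d <;> simp [pow_add, mul_comm]
    | cap i =>
      have e : (T.twist ε).slice u (.cap i) x =
          (if u.getD i true then ε else 1 : R) • T.slice u (.cap i) x := by
        funext l
        simp only [slice, twist, Pi.smul_apply, smul_eq_mul]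
        cases u.getD i true <;> simp [mul_assoc, Finset.mul_sum]
      rw [e, eval_smul, smul_smul, turns]
      cases u.getD i true <;> simp [pow_add, mul_comm]
    | cross i b => rfl

theorem Tensors.value_twist (ε : R) (T : Tensors R ι) (w : List OrientedSlice) :
    (T.twist ε).value w = ε ^ turns w [] * T.value w := by
  rw [value, eval_twist]; rfl

end Transfer

end FramedSkein

namespace FramedSkein

/-! ### State sums with coloured states -/

section Colour

variable {R ι C : Type*} [CommRing R]

/-- The vector is supported on states with the given colours. -/
def HasColours (col : ι → C) (x : List ι → R) (P : List C) : Prop :=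
  ∀ l, l.map col ≠ P → x l = 0

variable {col : ι → C} {x : List ι → R} {P Q : List C} {k k' : C}

theorem HasColours.eq_of_cons_cons {l : List ι} {a b : ι}
    (hx : HasColours col x (P ++ k :: k' :: Q))
    (h : x (l.take P.length ++ a :: b :: l.drop P.length) ≠ 0) :
    col a = k ∧ col b = k' ∧ l.map col = P ++ Q := by
  have h' : (l.take P.length ++ a :: b :: l.drop P.length).map col = P ++ k :: k' :: Q := by
    by_contra hne
    exact h (hx _ hne)
  have hlen := congrArg List.length h'
  simp at hlen
  rw [List.map_append] at h'
  obtain ⟨h1, h2⟩ := List.append_inj h' (by simp; omega)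
  simp only [List.map_cons, List.cons.injEq] at h2
  refine ⟨h2.1, h2.2.1, ?_⟩
  conv_lhs => rw [← List.take_append_drop P.length l]
  rw [List.map_append, h1, h2.2.2]

theorem HasColours.eq_of_cons_cons' {l r : List ι} {a b c e : ι}
    (hx : HasColours col x (P ++ k :: k' :: Q)) (hl : l.drop P.length = c :: e :: r)
    (h : x (l.take P.length ++ a :: b :: r) ≠ 0) :
    col a = k ∧ col b = k' ∧ l.map col = P ++ col c :: col e :: Q := by
  have h' : (l.take P.length ++ a :: b :: r).map col = P ++ k :: k' :: Q := by
    by_contra hne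
    exact h (hx _ hne)
  have hlen := congrArg List.length hl
  simp at hlen
  rw [List.map_append] at h'
  obtain ⟨h1, h2⟩ := List.append_inj h' (by simp; omega)
  simp only [List.map_cons, List.cons.injEq] at h2
  refine ⟨h2.1, h2.2.1, ?_⟩
  conv_lhs => rw [← List.take_append_drop P.length l]
  rw [List.map_append, h1, hl, List.map_cons, List.map_cons, h2.2.2]

variable [Fintype ι] [DecidableEq C]

/-- The coefficients vanish unless the colour of the states is constant along the strands. -/
structure Tensors.Respects (T : Tensors R ι) (col : ι → C) : Prop where
  cup : ∀ d a b, col a ≠ col b → T.cup d a b = 0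
  cap : ∀ d a b, col a ≠ col b → T.cap d a b = 0
  cross : ∀ s d d' a b c e, ¬(col c = col b ∧ col e = col a) → T.cross s d d' a b c e = 0

/-- The state sum over the states of one colour. -/
def Tensors.restrict (T : Tensors R ι) (col : ι → C) (k : C) : Tensors R ι where
  cup d a b := if col a = k ∧ col b = k then T.cup d a b else 0
  cap d a b := if col a = k ∧ col b = k then T.cap d a b else 0
  cross s d d' a b c e :=
    if (col a = k ∧ col b = k) ∧ (col c = k ∧ col e = k) then T.cross s d d' a b c e else 0

variable {T : Tensors R ι} {u : List Bool}

theorem HasColours.cup (hx : HasColours col x (P ++ Q)) (d : Bool) :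
    HasColours col ((T.restrict col k).slice u (.cup P.length d) x) (P ++ k :: k :: Q) := by
  intro l hl
  simp only [Tensors.slice, Tensors.restrict]
  split
  · rename_i a b r h
    split_ifs with hk
    · rw [hx, mul_zero]
      rintro h'
      refine hl ?_
      have hlen := congrArg List.length h
      simp at hlen
      rw [List.map_append] at h'
      obtain ⟨h1, h2⟩ := List.append_inj h' (by simp; omega)
      conv_lhs => rw [← List.take_append_drop P.length l, h]
      simp [h1, h2, hk.1, hk.2]
    · rw [zero_mul]
  · rfl

theorem HasColours.cap (hx : HasColours col x (P ++ k :: k' :: Q)) :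
    HasColours col (T.slice u (.cap P.length) x) (P ++ Q) := by
  intro l hl
  refine Finset.sum_eq_zero fun a _ => Finset.sum_eq_zero fun b _ => ?_
  by_contra h
  exact hl (hx.eq_of_cons_cons (right_ne_zero_of_mul h)).2.2

theorem HasColours.cap_eq_zero (hT : T.Respects col) (hx : HasColours col x (P ++ k :: k' :: Q))
    (hk : k ≠ k') : T.slice u (.cap P.length) x = 0 := by
  funext l
  refine Finset.sum_eq_zero fun a _ => Finset.sum_eq_zero fun b _ => ?_
  by_contra h
  obtain ⟨h1, h2, -⟩ := hx.eq_of_cons_cons (right_ne_zero_of_mul h)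
  exact left_ne_zero_of_mul h (hT.cap _ _ _ (by rw [h1, h2]; exact hk))

theorem HasColours.cap_restrict (hx : HasColours col x (P ++ k :: k :: Q)) :
    (T.restrict col k).slice u (.cap P.length) x = T.slice u (.cap P.length) x := by
  funext l
  refine Finset.sum_congr rfl fun a _ => Finset.sum_congr rfl fun b _ => ?_
  by_cases h : x (l.take P.length ++ a :: b :: l.drop P.length) = 0
  · rw [h, mul_zero, mul_zero]
  · obtain ⟨h1, h2, -⟩ := hx.eq_of_cons_cons h
    simp [Tensors.restrict, h1, h2]

theorem HasColours.cross (hT : T.Respects col) (hx : HasColours col x (P ++ k :: k' :: Q))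
    (s : Bool) : HasColours col (T.slice u (.cross P.length s) x) (P ++ k' :: k :: Q) := by
  intro l hl
  simp only [Tensors.slice]
  split
  · rename_i c e r h
    refine Finset.sum_eq_zero fun a _ => Finset.sum_eq_zero fun b _ => ?_
    by_contra h0
    obtain ⟨h1, h2, h3⟩ := hx.eq_of_cons_cons' h (right_ne_zero_of_mul h0)
    have h4 : col c = col b ∧ col e = col a := by
      by_contra h4
      exact left_ne_zero_of_mul h0 (hT.cross _ _ _ _ _ _ _ h4)
    rw [h4.1, h4.2, h1, h2] at h3
    exact hl h3
  · rfl

theorem HasColours.cross_restrict (hT : T.Respects col)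
    (hx : HasColours col x (P ++ k :: k :: Q)) (s : Bool) :
    (T.restrict col k).slice u (.cross P.length s) x = T.slice u (.cross P.length s) x := by
  funext l
  simp only [Tensors.slice]
  split
  · rename_i c e r h
    refine Finset.sum_congr rfl fun a _ => Finset.sum_congr rfl fun b _ => ?_
    by_cases h0 : x (l.take P.length ++ a :: b :: r) = 0
    · rw [h0, mul_zero, mul_zero]
    · obtain ⟨h1, h2, h3⟩ := hx.eq_of_cons_cons' h h0
      by_cases h4 : col c = col b ∧ col e = col a
      · simp [Tensors.restrict, h1, h2, h4.1, h4.2]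
      · simp [Tensors.restrict, hT.cross _ _ _ _ _ _ _ h4]
  · rfl

/-- Colours enter a state only at local minima. Splitting each minimum by its colour turns the
evaluation into a sum over colourings of the strands. -/
theorem Tensors.slice_cup_eq_sum [Fintype C] (hT : T.Respects col) (i : ℕ) (d : Bool) :
    T.slice u (.cup i d) x = ∑ k, (T.restrict col k).slice u (.cup i d) x := by
  funext l
  rw [Finset.sum_apply]
  simp only [slice]
  split
  · rename_i a b r h
    rw [← Finset.sum_mul]
    congr 1
    by_cases hab : col a = col b
    · simp [restrict, hab]
    · simp only [restrict, hT.cup _ _ _ hab, ite_self, Finset.sum_const_zero]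
  · simp

theorem Tensors.eval_sum (T : Tensors R ι) (w : List OrientedSlice) (u : List Bool)
    {J : Type*} (s : Finset J) (y : J → List ι → R) :
    T.eval w u (∑ j ∈ s, y j) = ∑ j ∈ s, T.eval w u (y j) :=
  map_sum (⟨⟨T.eval w u, T.eval_add w u⟩, T.eval_smul w u⟩ : (List ι → R) →ₗ[R] (List ι → R)) y s

theorem Tensors.eval_zero (T : Tensors R ι) (w : List OrientedSlice) (u : List Bool) :
    T.eval w u 0 = 0 := by
  simpa using T.eval_sum w u (∅ : Finset ℕ) fun _ => 0

/-! ### Labels of the components -/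

theorem length_directions_cup {u : List Bool} {i : ℕ} {d : Bool} (h : i ≤ u.length) :
    (OrientedSlice.directions (.cup i d) u).length = u.length + 2 := by
  simp [OrientedSlice.directions]; omega

theorem length_directions_cap {u : List Bool} {i : ℕ} (h : i + 2 ≤ u.length) :
    (OrientedSlice.directions (.cap i) u).length + 2 = u.length := by
  simp [OrientedSlice.directions]; omega

theorem length_directions_cross {u : List Bool} {i : ℕ} {b : Bool} :
    (OrientedSlice.directions (.cross i b) u).length = u.length := by
  simp only [OrientedSlice.directions]
  split
  · rename_i x y r hr
    have hl := congrArg List.length hr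
    simp at hl ⊢
    omega
  · rfl

theorem OrientedSlice.Fits.cap_le {u : List Bool} {i : ℕ} (h : (OrientedSlice.cap i).Fits u) :
    i + 2 ≤ u.length := by
  obtain ⟨d, r, hr⟩ := h
  have hl := congrArg List.length hr
  simp at hl
  omega

/-- Every label occurs exactly twice. -/
def Paired (L : List ℕ) : Prop := ∀ z ∈ L, L.count z = 2

theorem Paired.cup {A B : List ℕ} {f : ℕ} (h : Paired (A ++ B)) (hf : ∀ z ∈ A ++ B, z < f) :
    Paired (A ++ f :: f :: B) := by
  intro z hz
  have h1 := h z
  have h2 := hf z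
  simp only [List.mem_append, List.mem_cons, List.count_append, List.count_cons] at h1 h2 hz ⊢
  by_cases hzf : f = z
  · have hA : List.count z A = 0 := List.count_eq_zero.2 fun hA => by have := h2 (Or.inl hA); omega
    have hB : List.count z B = 0 := List.count_eq_zero.2 fun hB => by have := h2 (Or.inr hB); omega
    simp [hzf, hA, hB]
  · have := h1 (by tauto)
    simp [hzf]; omega

theorem Paired.cross {A B : List ℕ} {x y : ℕ} (h : Paired (A ++ x :: y :: B)) :
    Paired (A ++ y :: x :: B) := by
  intro z hz
  have := h z (by simp at hz ⊢; tauto)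
  simp only [List.count_append, List.count_cons] at this ⊢
  omega

theorem Paired.count {A B : List ℕ} {x y : ℕ} (h : Paired (A ++ x :: y :: B)) (hxy : x ≠ y) :
    (A ++ B).count x = 1 ∧ (A ++ B).count y = 1 := by
  have h1 := h x (by simp)
  have h2 := h y (by simp)
  simp [List.count_append, hxy, hxy.symm] at h1 h2 ⊢
  omega

theorem Paired.mem {A B : List ℕ} {x y z : ℕ} (h : Paired (A ++ x :: y :: B)) (hxy : x ≠ y)
    (hz : z ∈ A ++ x :: y :: B) : z ∈ A ++ B := by
  obtain ⟨h1, h2⟩ := h.count hxy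
  have : z = x ∨ z = y ∨ z ∈ A ++ B := by simp at hz ⊢; tauto
  rcases this with rfl | rfl | h3
  · exact List.count_pos_iff.1 (by omega)
  · exact List.count_pos_iff.1 (by omega)
  · exact h3

theorem Paired.cap_same {A B : List ℕ} {x : ℕ} (h : Paired (A ++ x :: x :: B)) :
    Paired (A ++ B) := by
  intro z hz
  have h1 := h z (by simp at hz ⊢; tauto)
  have h2 := List.count_pos_iff.2 hz
  simp only [List.count_append, List.count_cons, beq_iff_eq] at h1 h2 ⊢
  split_ifs at h1 <;> omega

theorem Paired.cap {A B : List ℕ} {x y : ℕ} (h : Paired (A ++ x :: y :: B)) (hxy : x ≠ y) :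
    Paired ((A ++ B).map fun z => if z = y then x else z) := by
  intro z hz
  obtain ⟨z', hz', rfl⟩ := List.mem_map.1 hz
  have hcount : ∀ l : List ℕ, (l.map fun z => if z = y then x else z).count x =
      l.count x + l.count y := by
    intro l
    induction l with
    | nil => simp
    | cons a l ih =>
      simp only [List.map_cons, List.count_cons, beq_iff_eq]
      by_cases h1 : a = y
      · subst h1; simp [hxy.symm]; omega
      · simp [h1]; omega
  have hcount' : ∀ l : List ℕ, ∀ a, a ≠ x → a ≠ y →
      (l.map fun z => if z = y then x else z).count a = l.count a := by
    intro l a ha ha'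
    induction l with
    | nil => simp
    | cons b l ih =>
      simp only [List.map_cons, List.count_cons, beq_iff_eq]
      by_cases h1 : b = y
      · subst h1; simp [ha.symm, ha'.symm]; omega
      · simp [h1]; omega
  obtain ⟨hx, hy⟩ := h.count hxy
  have h2 := hcount (A ++ B)
  by_cases h3 : z' = y
  · simp only [h3, if_true]; omega
  · simp only [h3, if_false]
    by_cases h4 : z' = x
    · subst h4; omega
    · rw [hcount' _ z' h4 h3]
      have := h z' (by simp at hz' ⊢; tauto)
      simpa [List.count_append, List.count_cons, Ne.symm h3, Ne.symm h4] using this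

theorem lt_succ_of_mem_cup {A B : List ℕ} {f : ℕ} (h : ∀ z ∈ A ++ B, z < f) :
    ∀ z ∈ A ++ f :: f :: B, z < f + 1 := by
  intro z hz
  have h' := h z
  simp at hz h'
  by_cases hzf : z = f
  · omega
  · have := h' (by tauto); omega

theorem lt_of_mem_cap {A B : List ℕ} {x y f : ℕ} (h : ∀ z ∈ A ++ x :: y :: B, z < f) :
    ∀ z ∈ (A ++ B).map fun z => if z = y then x else z, z < f := by
  intro z hz
  obtain ⟨z', hz', rfl⟩ := List.mem_map.1 hz
  split_ifs
  · exact h x (by simp)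
  · exact h z' (by simp at hz' ⊢; tauto)

/-- Every component of a closed diagram is counted at the maximum that closes it. If none is counted
from here on, no strand is left, and the remaining word, being unable to start a new component, is
empty. -/
theorem eq_nil_of_numComponentsAux_eq_zero {w : List OrientedSlice} {u : List Bool} {L : List ℕ}
    {f : ℕ} (hw : IsOrientedClosed w u) (hlen : L.length = u.length) (hp : Paired L)
    (hf : ∀ z ∈ L, z < f) (hn : numComponentsAux (w.map OrientedSlice.forget) f L = 0) :
    w = [] ∧ L = [] := by
  induction w generalizing u L f with
  | nil =>
    cases hw
    exact ⟨rfl, List.eq_nil_of_length_eq_zero hlen⟩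
  | cons s w ih =>
    exfalso
    obtain ⟨h1, h2⟩ := hw
    rw [List.map_cons] at hn
    cases s with
    | cup i d =>
      obtain ⟨A, B, rfl, rfl⟩ := exists_eq_append (L := L) (i := i) (by rw [hlen]; exact h1)
      rw [OrientedSlice.forget, numComponentsAux_cup] at hn
      have := ih h2 (by rw [length_directions_cup h1, ← hlen]; simp; omega) (hp.cup hf)
        (lt_succ_of_mem_cup hf) hn
      simp at this
    | cap i =>
      obtain ⟨A, x, y, B, rfl, rfl⟩ := exists_eq_append_cons_cons (L := L) (i := i)
        (by rw [hlen]; exact h1.cap_le)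
      by_cases hxy : x = y
      · subst hxy
        rw [OrientedSlice.forget, numComponentsAux_cap_same] at hn
        omega
      · rw [OrientedSlice.forget, numComponentsAux_cap_ne _ _ hxy] at hn
        have hl := length_directions_cap h1.cap_le
        have := ih h2 (by simp at hlen ⊢; omega) (hp.cap hxy) (lt_of_mem_cap hf) hn
        -- Labels occur in pairs, so after joining two different labels the other end of `x` is
        -- still open.
        have hx := hp.mem hxy (z := x) (by simp)
        have h3 : A ++ B = [] := List.map_eq_nil_iff.1 this.2
        rw [h3] at hx
        simp at hx
    | cross i b =>
      obtain ⟨A, x, y, B, rfl, rfl⟩ := exists_eq_append_cons_cons (L := L) (i := i)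
        (by rw [hlen]; exact h1)
      rw [OrientedSlice.forget, numComponentsAux_cross] at hn
      have := ih h2 (by rw [length_directions_cross, ← hlen]; simp) hp.cross
        (fun z hz => hf z (by simp at hz ⊢; tauto)) hn
      simp at this

theorem map_update_eq {D : Type*} {κ : ℕ → D} {A : List ℕ} {f : ℕ} (k : D) (h : ∀ z ∈ A, z < f) :
    A.map (Function.update κ f k) = A.map κ :=
  List.map_congr_left fun z hz => Function.update_of_ne (h z hz).ne _ _

theorem map_cup_colours {D : Type*} {κ : ℕ → D} {A B : List ℕ} {f : ℕ} (k : D)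
    (h : ∀ z ∈ A ++ B, z < f) :
    (A ++ f :: f :: B).map (Function.update κ f k) = A.map κ ++ k :: k :: B.map κ := by
  rw [List.map_append, List.map_cons, List.map_cons, map_update_eq k fun z hz => h z (by simp [hz]),
    map_update_eq k fun z hz => h z (by simp [hz]), Function.update_self]

/-- All open strands belong to the one component that is still to be closed. If two of them have
different colours, then somewhere above a maximum must join different colours, and there the
coefficient vanishes. The map `κ` colours the labels. -/
theorem Tensors.eval_eq_zero [Fintype C] (hT : T.Respects col) {w : List OrientedSlice}
    {u : List Bool} (hw : IsOrientedClosed w u) {L : List ℕ} {f : ℕ} {κ : ℕ → C}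
    {x : List ι → R} (hlen : L.length = u.length) (hp : Paired L) (hf : ∀ z ∈ L, z < f)
    (hx : HasColours col x (L.map κ))
    (hn : numComponentsAux (w.map OrientedSlice.forget) f L = 1)
    (hne : ∃ z ∈ L, ∃ z' ∈ L, κ z ≠ κ z') : T.eval w u x [] = 0 := by
  induction w generalizing u L f κ x with
  | nil => simp [numComponentsAux] at hn
  | cons s w ih =>
    obtain ⟨h1, h2⟩ := hw
    rw [List.map_cons] at hn
    rw [eval]
    cases s with
    | cup i d =>
      obtain ⟨A, B, rfl, rfl⟩ := exists_eq_append (L := L) (i := i) (by rw [hlen]; exact h1)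
      rw [OrientedSlice.forget, numComponentsAux_cup] at hn
      rw [slice_cup_eq_sum hT, eval_sum, Finset.sum_apply]
      refine Finset.sum_eq_zero fun k _ => ?_
      rw [List.map_append] at hx
      -- The fresh label receives the colour `k` of this summand; the older labels lie below `f` and
      -- keep theirs.
      refine ih h2 (by rw [length_directions_cup h1, ← hlen]; simp; omega) (hp.cup hf)
        (lt_succ_of_mem_cup hf) (κ := Function.update κ f k) ?_ hn ?_
      · rw [map_cup_colours k hf]
        simpa using hx.cup (T := T) (u := u) (k := k) d
      · obtain ⟨z, hz, z', hz', hzz⟩ := hne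
        refine ⟨z, by simp at hz ⊢; tauto, z', by simp at hz' ⊢; tauto, ?_⟩
        rwa [Function.update_of_ne (hf z hz).ne, Function.update_of_ne (hf z' hz').ne]
    | cap i =>
      obtain ⟨A, p, q, B, rfl, rfl⟩ := exists_eq_append_cons_cons (L := L) (i := i)
        (by rw [hlen]; exact h1.cap_le)
      have hl := length_directions_cap h1.cap_le
      rw [List.map_append, List.map_cons, List.map_cons] at hx
      by_cases hpq : p = q
      · subst hpq
        rw [OrientedSlice.forget, numComponentsAux_cap_same] at hn
        -- This maximum closes the only component, so nothing else was open, and the list `[p, p]`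
        -- has only one colour.
        have hAB := (eq_nil_of_numComponentsAux_eq_zero h2 (by simp at hlen ⊢; omega) hp.cap_same
          (fun z hz => hf z (by simp at hz ⊢; tauto)) (Nat.succ.inj hn)).2
        exfalso
        obtain ⟨rfl, rfl⟩ := List.append_eq_nil_iff.1 hAB
        obtain ⟨z, hz, z', hz', hzz⟩ := hne
        simp at hz hz'
        exact hzz (by rw [hz, hz'])
      · rw [OrientedSlice.forget, numComponentsAux_cap_ne _ _ hpq] at hn
        by_cases hk : κ p = κ q
        · have hmap : ((A ++ B).map fun z => if z = q then p else z).map κ =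
              A.map κ ++ B.map κ := by
            rw [List.map_map, ← List.map_append]
            refine List.map_congr_left fun z _ => ?_
            by_cases hz : z = q
            · simp [hz, hk]
            · simp [hz]
          refine ih h2 (by simp at hlen ⊢; omega) (hp.cap hpq) (lt_of_mem_cap hf) (κ := κ) ?_ hn ?_
          · rw [hmap]
            simpa using hx.cap (T := T) (u := u)
          · obtain ⟨z, hz, z', hz', hzz⟩ := hne
            have hmem : ∀ z ∈ A ++ p :: q :: B,
                κ z ∈ ((A ++ B).map fun z => if z = q then p else z).map κ := by
              intro z hz
              rw [hmap, ← List.map_append]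
              exact List.mem_map_of_mem (hp.mem hpq hz)
            obtain ⟨y, hy, hyz⟩ := List.mem_map.1 (hmem z hz)
            obtain ⟨y', hy', hyz'⟩ := List.mem_map.1 (hmem z' hz')
            exact ⟨y, hy, y', hy', by rwa [hyz, hyz']⟩
        · have := hx.cap_eq_zero (u := u) hT hk
          rw [List.length_map] at this
          rw [this, eval_zero]
          rfl
    | cross i b =>
      obtain ⟨A, p, q, B, rfl, rfl⟩ := exists_eq_append_cons_cons (L := L) (i := i)
        (by rw [hlen]; exact h1)
      rw [OrientedSlice.forget, numComponentsAux_cross] at hn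
      rw [List.map_append, List.map_cons, List.map_cons] at hx
      have hmem : ∀ z, z ∈ A ++ q :: p :: B ↔ z ∈ A ++ p :: q :: B := by
        intro z; simp; tauto
      refine ih h2 (by rw [length_directions_cross, ← hlen]; simp) hp.cross
        (fun z hz => hf z ((hmem z).1 hz)) (κ := κ) ?_ hn ?_
      · simpa using hx.cross (u := u) hT b
      · obtain ⟨z, hz, z', hz', hzz⟩ := hne
        exact ⟨z, (hmem z).2 hz, z', (hmem z').2 hz', hzz⟩

/-- Once some strand has the colour `k`, a minimum of any other colour contributes zero by the
preceding lemma, while at caps and crossings the vector is already supported on `k`. The condition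
`L ≠ []` supplies that strand. -/
theorem Tensors.eval_eq_eval_restrict [Fintype C] (hT : T.Respects col)
    {w : List OrientedSlice} {u : List Bool} (hw : IsOrientedClosed w u) {L : List ℕ} {f : ℕ}
    {k : C} {x : List ι → R} (hL : L ≠ []) (hlen : L.length = u.length) (hp : Paired L)
    (hf : ∀ z ∈ L, z < f) (hx : HasColours col x (L.map fun _ => k))
    (hn : numComponentsAux (w.map OrientedSlice.forget) f L = 1) :
    T.eval w u x [] = (T.restrict col k).eval w u x [] := by
  induction w generalizing u L f x with
  | nil => simp [numComponentsAux] at hn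
  | cons s w ih =>
    obtain ⟨h1, h2⟩ := hw
    rw [List.map_cons] at hn
    rw [eval, eval]
    cases s with
    | cup i d =>
      obtain ⟨A, B, rfl, rfl⟩ := exists_eq_append (L := L) (i := i) (by rw [hlen]; exact h1)
      rw [OrientedSlice.forget, numComponentsAux_cup] at hn
      rw [slice_cup_eq_sum hT, eval_sum, Finset.sum_apply]
      rw [List.map_append] at hx
      have hl : (A ++ f :: f :: B).length =
          (OrientedSlice.directions (.cup A.length d) u).length := by
        rw [length_directions_cup h1, ← hlen]; simp; omega
      rw [Finset.sum_eq_single k]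
      · refine ih h2 (by simp) hl (hp.cup hf) (lt_succ_of_mem_cup hf) ?_ hn
        simpa using hx.cup (T := T) (u := u) (k := k) d
      · intro k' _ hk'
        refine eval_eq_zero hT h2 hl (hp.cup hf) (lt_succ_of_mem_cup hf)
          (κ := Function.update (fun _ => k) f k') ?_ hn ?_
        · rw [map_cup_colours k' hf]
          simpa using hx.cup (T := T) (u := u) (k := k') d
        · obtain ⟨z, hz⟩ := List.exists_mem_of_ne_nil _ hL
          refine ⟨f, by simp, z, by simp at hz ⊢; tauto, ?_⟩
          rwa [Function.update_self, Function.update_of_ne (hf z hz).ne]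
      · simp
    | cap i =>
      obtain ⟨A, p, q, B, rfl, rfl⟩ := exists_eq_append_cons_cons (L := L) (i := i)
        (by rw [hlen]; exact h1.cap_le)
      have hl := length_directions_cap h1.cap_le
      rw [List.map_append, List.map_cons, List.map_cons] at hx
      have e := hx.cap_restrict (T := T) (u := u)
      rw [List.length_map] at e
      rw [e]
      by_cases hpq : p = q
      · subst hpq
        rw [OrientedSlice.forget, numComponentsAux_cap_same] at hn
        obtain ⟨rfl, -⟩ := eq_nil_of_numComponentsAux_eq_zero h2 (by simp at hlen ⊢; omega)
          hp.cap_same (fun z hz => hf z (by simp at hz ⊢; tauto)) (Nat.succ.inj hn)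
        rfl
      · rw [OrientedSlice.forget, numComponentsAux_cap_ne _ _ hpq] at hn
        refine ih h2 ?_ (by simp at hlen ⊢; omega) (hp.cap hpq) (lt_of_mem_cap hf) ?_ hn
        · intro h0
          have := hp.mem hpq (z := p) (by simp)
          rw [List.map_eq_nil_iff.1 h0] at this
          simp at this
        · rw [List.map_map]
          simpa [Function.comp_def] using hx.cap (T := T) (u := u)
    | cross i b =>
      obtain ⟨A, p, q, B, rfl, rfl⟩ := exists_eq_append_cons_cons (L := L) (i := i)
        (by rw [hlen]; exact h1)
      rw [OrientedSlice.forget, numComponentsAux_cross] at hn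
      rw [List.map_append, List.map_cons, List.map_cons] at hx
      have e := hx.cross_restrict (u := u) hT b
      rw [List.length_map] at e
      rw [e]
      refine ih h2 (by simp) (by rw [length_directions_cross, ← hlen]; simp) hp.cross
        (fun z hz => hf z (by simp at hz ⊢; tauto)) ?_ hn
      simpa using hx.cross (u := u) hT b

/-- The state sum of a knot is the sum of the state sums for the single colours. -/
theorem Tensors.value_eq_sum_restrict [Fintype C] (hT : T.Respects col)
    {w : List OrientedSlice} (hw : IsOrientedClosed w [])
    (hn : numComponents (w.map OrientedSlice.forget) = 1) :
    T.value w = ∑ k, (T.restrict col k).value w := by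
  cases w with
  | nil => simp [numComponents, numComponentsAux] at hn
  | cons s w =>
    obtain ⟨h1, h2⟩ := hw
    cases s with
    | cap i => have := h1.cap_le; simp at this
    | cross i b => simp [OrientedSlice.Fits] at h1
    | cup i d =>
      obtain rfl : i = 0 := by simpa [OrientedSlice.Fits] using h1
      simp only [value, eval]
      -- The first slice is a minimum at position 0, and its colour determines that of the whole
      -- knot.
      rw [slice_cup_eq_sum hT, eval_sum, Finset.sum_apply]
      refine Finset.sum_congr rfl fun k _ => ?_
      have hx : HasColours col (vacuum : List ι → R) ([] ++ []) := by
        intro l hl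
        cases l with
        | nil => exact absurd rfl hl
        | cons a l => rfl
      refine eval_eq_eval_restrict hT h2 (L := [0, 0]) (f := 1) (by simp) rfl ?_ ?_ ?_ hn
      · intro z hz; simp at hz; subst hz; rfl
      · intro z hz; simp at hz; omega
      · exact hx.cup (T := T) (u := []) (k := k) d

end Colour

end FramedSkein

namespace FramedSkein

/-! ### The rotation number modulo two -/

/-- The number of crossings. -/
def crossings : List OrientedSlice → ℕ
  | [] => 0
  | .cross _ _ :: w => crossings w + 1
  | _ :: w => crossings w

theorem even_writheAux_add_crossings (w : List OrientedSlice) (u : List Bool) :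
    Even (writheAux w u + crossings w) := by
  induction w generalizing u with
  | nil => simp [writheAux, crossings]
  | cons s w ih =>
    cases s with
    | cup i d => exact ih _
    | cap i => exact ih _
    | cross i b =>
      rw [writheAux, crossings]
      have h : ∀ x y, Even (OrientedSlice.crossingSign b x y + 1) := by
        intro x y
        rw [OrientedSlice.crossingSign]
        split_ifs <;> decide
      have := (h (u.getD i true) (u.getD (i + 1) true)).add
        (ih (OrientedSlice.directions (.cross i b) u))
      obtain ⟨r, hr⟩ := this
      exact ⟨r, by push_cast; linarith⟩

/-- The state sum with the negative flip as crossing. -/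
def flipTensors : Tensors (ZMod 3) (Fin 2) where
  cup _ a b := if a = b then 1 else 0
  cap _ a b := if a = b then 1 else 0
  cross _ _ _ a b c e := if c = b ∧ e = a then -1 else 0

theorem flipTensors_respects : flipTensors.Respects (id : Fin 2 → Fin 2) where
  cup _ _ _ h := if_neg h
  cap _ _ _ h := if_neg h
  cross _ _ _ _ _ _ _ h := if_neg h

/-- With one colour only a single state is left on each strand, so the state sum is one-dimensional
and only counts a sign for each crossing. -/
theorem realized_restrict_flipTensors (k : Fin 2) :
    (flipTensors.restrict id k).Realized
      (fun _ => (LinearMap.proj k : (Fin 2 → ZMod 3) →ₗ[ZMod 3] ZMod 3))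
      (fun _ s y => match s with
        | .cross _ _ => -y
        | _ => y) where
  shift d u s z _ := by cases s <;> rfl
  cup u d y := by simp [flipTensors, Tensors.restrict]
  cap u d z := by
    fin_cases k <;> simp [flipTensors, Tensors.restrict]
  cross u d d' s z := by
    fin_cases k <;> simp [flipTensors, Tensors.restrict]

theorem value_restrict_flipTensors (k : Fin 2) {w : List OrientedSlice}
    (hw : IsOrientedClosed w []) : (flipTensors.restrict id k).value w = (-1) ^ crossings w := by
  have h := (realized_restrict_flipTensors k).operatorWord_eq 1 hw
  rw [smul_eq_mul, mul_one] at h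
  rw [← h]
  have : ∀ (w : List OrientedSlice) (u : List Bool) (y : ZMod 3),
      operatorWord (fun _ s y => match s with
        | .cross _ _ => -y
        | _ => y) w u y = (-1) ^ crossings w * y := by
    intro w
    induction w with
    | nil => intro u y; simp [operatorWord, crossings]
    | cons s w ih =>
      intro u y
      rw [operatorWord, ih]
      cases s <;> simp [crossings, pow_succ]
  rw [this, mul_one]

theorem kauffmanOp_raise {R : Type*} [CommRing R] (t : Rˣ) (s : OrientedSlice) :
    kauffmanOp t s.raise.forget = under (kauffmanOp t s.forget) := by
  cases s <;> exact under_pow_succ _ _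

/-- At t = -1 both smoothings have the coefficient -1, and the identity plus cup after cap is the
flip, so a crossing is the negative flip. Turning downward strands into upward ones by the
antisymmetric matrix produces the signs of `twist (-1)`. -/
theorem realized_twist_flipTensors :
    (flipTensors.twist (-1)).Realized
      (fun d => headInsert (if d then !![1, 0; 0, 1] else !![0, -1; 1, 0] :
        Matrix (Fin 2) (Fin 2) (ZMod 3)))
      (fun _ s => kauffmanOp (-1) s.forget) where
  shift d u s z _ := by rw [kauffmanOp_raise, under_headInsert]
  cup u d y := by
    funext l
    simp only [OrientedSlice.forget, kauffmanOp_cup_zero_apply, headInsert, LinearMap.coe_mk,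
      AddHom.coe_mk, Fin.sum_univ_two, Pi.smul_apply, smul_eq_mul]
    generalize l.head = a
    generalize l.tail.head = b
    fin_cases a <;> fin_cases b <;> cases d <;>
      simp [kauffmanCup, flipTensors, Tensors.twist]
  cap u d z := by
    funext l
    simp only [OrientedSlice.forget, kauffmanOp_cap_zero_apply, headInsert, LinearMap.coe_mk,
      AddHom.coe_mk, Fin.sum_univ_two, Pi.smul_apply, Pi.add_apply, smul_eq_mul,
      Stream'.head_cons, Stream'.tail_cons]
    cases d <;> simp [kauffmanCap, flipTensors, Tensors.twist, add_comm]
  cross u d d' s z := by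
    funext l
    simp only [OrientedSlice.forget, kauffmanOp_cross_zero_apply, headInsert, LinearMap.coe_mk,
      AddHom.coe_mk, Fin.sum_univ_two, Pi.smul_apply, Pi.add_apply, smul_eq_mul,
      Stream'.head_cons, Stream'.tail_cons]
    generalize l.head = a
    generalize l.tail.head = b
    generalize z 0 0 l.tail.tail = z₀
    generalize z 0 1 l.tail.tail = z₁
    generalize z 1 0 l.tail.tail = z₂
    generalize z 1 1 l.tail.tail = z₃
    have hs : crossingCoeff (-1 : (ZMod 3)ˣ) s = -1 ∧ crossingCoeff (-1 : (ZMod 3)ˣ) (!s) = -1 := by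
      cases s <;> simp [crossingCoeff]
    rw [hs.1, hs.2]
    fin_cases a <;> fin_cases b <;> cases d <;> cases d' <;>
      simp [kauffmanCap, kauffmanCup, flipTensors, Tensors.twist]

/-- Modulo 3 one has -1 - 1 = 1, so resolving a crossing reproduces the value 1. The loop value at t
= -1 is -2 = 1 as well. -/
theorem genericBracket_three (v w : List Slice) :
    genericBracket (fun _ => (-1 : ZMod 3)) (fun _ => -1) 1 v w = 1 := by
  induction w generalizing v with
  | nil => simp [genericBracket]
  | cons s w ih =>
    cases s with
    | cup i => exact ih _
    | cap i => exact ih _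
    | cross i b => rw [genericBracket, ih, ih]; decide

/-- Whitney's theorem on the parity of the rotation number of a closed curve in the plane. -/
theorem neg_one_pow_turns {w : List OrientedSlice} (hw : IsOrientedClosed w [])
    (hn : numComponents (w.map OrientedSlice.forget) = 1) (hwr : writheAux w [] = 0) :
    (-1 : ℤ) ^ turns w [] = -1 := by
  have h1 := realized_twist_flipTensors.operatorWord_eq 1 hw
  have h2 : ∀ (w : List OrientedSlice) (u : List Bool) (y : StreamFun (ZMod 3) (Fin 2)),
      operatorWord (fun _ s => ⇑(kauffmanOp (-1) s.forget)) w u y =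
        kauffmanWord (-1) (w.map OrientedSlice.forget) y := by
    intro w
    induction w with
    | nil => intro u y; rfl
    | cons s w ih => intro u y; rw [operatorWord, ih]; rfl
  have h3 := (isSkeinMap_kauffmanWord (-1 : (ZMod 3)ˣ) 1).eq_genericBracket (isTangle_forget hw)
  have h4 : genericBracket (crossingCoeff (-1 : (ZMod 3)ˣ))
      (fun b => crossingCoeff (-1 : (ZMod 3)ˣ) (!b))
      (-(((-1 : (ZMod 3)ˣ) : ZMod 3)) ^ 2 - (((-1 : (ZMod 3)ˣ)⁻¹ : (ZMod 3)ˣ) : ZMod 3) ^ 2)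
      [] (w.map OrientedSlice.forget) = 1 := by
    rw [← genericBracket_three [] (w.map OrientedSlice.forget)]
    congr 1
    · funext b; cases b <;> simp [crossingCoeff]
    · funext b; cases b <;> simp [crossingCoeff]
  rw [h4, one_smul] at h3
  -- The two evaluations give 1 = (-1)^turns · 2 · (-1)^crossings in `ZMod 3`, the factor 2 counting
  -- the colours. The number of crossings has the parity of the writhe and is even, and 2 = -1, so
  -- the number of turns is odd.
  rw [h2, h3, Tensors.value_twist, Tensors.value_eq_sum_restrict flipTensors_respects hw hn] at h1
  simp only [value_restrict_flipTensors _ hw, Fin.sum_univ_two] at h1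
  have h5 := congrFun h1 (Stream'.const 0)
  have h6 : Even (crossings w) := by
    have := even_writheAux_add_crossings w []
    rw [hwr, zero_add] at this
    exact_mod_cast this
  simp only [kauffmanWord, h6.neg_one_pow, Module.End.one_apply, Pi.one_apply, Pi.smul_apply,
    smul_eq_mul, mul_one] at h5
  rcases neg_one_pow_eq_or ℤ (turns w []) with h7 | h7
  · rw [neg_one_pow_eq_one_iff_even (by norm_num)] at h7
    rw [h7.neg_one_pow] at h5
    exact absurd h5 (by decide)
  · exact h7

end FramedSkein

namespace FramedSkein

/-! ### Quantum integers -/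

theorem qVar_ne_zero : qVar ≠ 0 := pow_ne_zero 2 tVar_ne_zero

theorem qVar_zpow_ne {j k : ℤ} (h : j ≠ k) : qVar ^ j ≠ qVar ^ k := by
  intro h'
  rw [qVar, ← zpow_natCast, ← zpow_mul, ← zpow_mul, ← algebraMap_T, ← algebraMap_T] at h'
  have h2 := FaithfulSMul.algebraMap_injective _ _ h'
  rw [LaurentPolynomial.T, LaurentPolynomial.T] at h2
  have := AddMonoidAlgebra.single_left_injective one_ne_zero h2
  push_cast at this
  omega

theorem qVar_sub_inv_ne_zero : qVar - qVar⁻¹ ≠ 0 := by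
  have := qVar_zpow_ne (show (1 : ℤ) ≠ -1 by decide)
  rw [zpow_one, zpow_neg_one] at this
  exact sub_ne_zero.2 this

theorem quantumInt_mul (k : ℤ) :
    quantumInt k * (qVar - qVar⁻¹) = qVar ^ k - qVar ^ (-k) :=
  div_mul_cancel₀ _ qVar_sub_inv_ne_zero

theorem quantumInt_ne_zero {k : ℤ} (h : k ≠ 0) : quantumInt k ≠ 0 :=
  div_ne_zero (sub_ne_zero.2 (qVar_zpow_ne (by omega))) qVar_sub_inv_ne_zero

theorem quantumInt_zero : quantumInt 0 = 0 := by simp [quantumInt]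

theorem quantumInt_one : quantumInt 1 = 1 := by
  have := qVar_sub_inv_ne_zero
  simp [quantumInt, this]

/-- The one identity behind both the quantum binomial formula and the Clebsch–Gordan computations.
-/
theorem quantumInt_add (i j : ℤ) :
    quantumInt (i + j) = qVar ^ j * quantumInt i + qVar ^ (-i) * quantumInt j := by
  refine mul_right_cancel₀ qVar_sub_inv_ne_zero ?_
  rw [add_mul, mul_assoc, mul_assoc, quantumInt_mul, quantumInt_mul, quantumInt_mul, neg_add,
    zpow_add₀ qVar_ne_zero, zpow_add₀ qVar_ne_zero]
  ring

theorem quantumFactorial_succ (k : ℕ) :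
    quantumFactorial (k + 1) = quantumFactorial k * quantumInt (k + 1) :=
  Finset.prod_range_succ _ _

theorem quantumFactorial_ne_zero (k : ℕ) : quantumFactorial k ≠ 0 :=
  Finset.prod_ne_zero_iff.2 fun j _ => quantumInt_ne_zero (by omega)

/-! ### The quantum exponential function -/

/-- The coefficients of the quantum exponential function. -/
noncomputable def expCoeff (k : ℕ) : RationalFunctions :=
  qVar ^ (k * (k - 1) / 2) * (qVar - qVar⁻¹) ^ k / quantumFactorial k

theorem expCoeff_zero : expCoeff 0 = 1 := by simp [expCoeff, quantumFactorial]

theorem expCoeff_succ (k : ℕ) :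
    expCoeff (k + 1) * quantumInt (k + 1) = expCoeff k * qVar ^ k * (qVar - qVar⁻¹) := by
  have h1 : quantumInt ((k : ℤ) + 1) ≠ 0 := quantumInt_ne_zero (by omega)
  have h2 := quantumFactorial_ne_zero k
  rw [expCoeff, expCoeff, quantumFactorial_succ, Nat.triangle_succ, pow_add, pow_succ]
  field_simp

section QuantumExp

variable {A : Type*} [Ring A] [Algebra RationalFunctions A]

theorem mul_pow_of_qCommute {X Y : A} (h : X * Y = qVar ^ (2 : ℤ) • (Y * X)) (i : ℕ) :
    Y * X ^ i = qVar ^ (-(2 * i) : ℤ) • (X ^ i * Y) := by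
  have h' : Y * X = qVar ^ (-2 : ℤ) • (X * Y) := by
    rw [h, smul_smul, ← zpow_add₀ qVar_ne_zero]
    simp
  induction i with
  | zero => simp
  | succ i ih =>
    rw [pow_succ, ← mul_assoc, ih, smul_mul_assoc, mul_assoc, h', mul_smul_comm, smul_smul,
      ← zpow_add₀ qVar_ne_zero, mul_assoc]
    congr 2
    push_cast
    ring

/-- The quantum binomial formula. -/
theorem expCoeff_smul_add_pow {X Y : A} (h : X * Y = qVar ^ (2 : ℤ) • (Y * X)) (k : ℕ) :
    expCoeff k • (X + Y) ^ k = ∑ p ∈ Finset.HasAntidiagonal.antidiagonal k,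
      (expCoeff p.1 * expCoeff p.2) • (X ^ p.1 * Y ^ p.2) := by
  induction k with
  | zero => simp [expCoeff_zero]
  | succ k ih =>
    have hk : quantumInt ((k : ℤ) + 1) ≠ 0 := quantumInt_ne_zero (by omega)
    -- After multiplication by [k+1], the left side is expanded with the recursion of `expCoeff` and
    -- one factor X + Y pulled out, the right side with [i+j] = q^j [i] + q^(-i) [j] for the
    -- bidegree (i, j). The two pieces then match separately.
    rw [← (isUnit_iff_ne_zero.2 hk).smul_left_cancel]
    have lhs : quantumInt ((k : ℤ) + 1) • expCoeff (k + 1) • (X + Y) ^ (k + 1) =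
        ∑ p ∈ Finset.HasAntidiagonal.antidiagonal k,
          ((qVar ^ k * (qVar - qVar⁻¹)) * (expCoeff p.1 * expCoeff p.2)) •
            (X ^ (p.1 + 1) * Y ^ p.2) +
        ∑ p ∈ Finset.HasAntidiagonal.antidiagonal k,
          ((qVar ^ k * (qVar - qVar⁻¹)) * (expCoeff p.1 * expCoeff p.2) *
            qVar ^ (-(2 * p.1) : ℤ)) • (X ^ p.1 * Y ^ (p.2 + 1)) := by
      have e : quantumInt ((k : ℤ) + 1) • expCoeff (k + 1) • (X + Y) ^ (k + 1) =
          (qVar ^ k * (qVar - qVar⁻¹)) • ((X + Y) * (expCoeff k • (X + Y) ^ k)) := by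
        rw [smul_smul, mul_comm, expCoeff_succ, pow_succ', mul_smul_comm, smul_smul]
        congr 1
        ring
      rw [e, ih, add_mul, Finset.mul_sum, Finset.mul_sum, smul_add, Finset.smul_sum,
        Finset.smul_sum]
      congr 1
      · refine Finset.sum_congr rfl fun p _ => ?_
        rw [mul_smul_comm, smul_smul, ← mul_assoc X, pow_succ']
      · refine Finset.sum_congr rfl fun p _ => ?_
        rw [mul_smul_comm, smul_smul, ← mul_assoc Y, mul_pow_of_qCommute h, smul_mul_assoc,
          smul_smul,
          mul_assoc (X ^ p.1), pow_succ']
    rw [lhs]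
    have rhs : quantumInt ((k : ℤ) + 1) • ∑ p ∈ Finset.HasAntidiagonal.antidiagonal (k + 1),
          (expCoeff p.1 * expCoeff p.2) • (X ^ p.1 * Y ^ p.2) =
        ∑ p ∈ Finset.HasAntidiagonal.antidiagonal (k + 1),
          (qVar ^ (p.2 : ℤ) * quantumInt p.1 * (expCoeff p.1 * expCoeff p.2)) •
            (X ^ p.1 * Y ^ p.2) +
        ∑ p ∈ Finset.HasAntidiagonal.antidiagonal (k + 1),
          (qVar ^ (-p.1 : ℤ) * quantumInt p.2 * (expCoeff p.1 * expCoeff p.2)) •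
            (X ^ p.1 * Y ^ p.2) := by
      rw [← Finset.sum_add_distrib, Finset.smul_sum]
      refine Finset.sum_congr rfl fun p hp => ?_
      rw [Finset.HasAntidiagonal.mem_antidiagonal] at hp
      rw [← add_smul, ← add_mul, ← quantumInt_add, smul_smul]
      congr 3
      exact_mod_cast hp.symm
    rw [rhs, Finset.Nat.sum_antidiagonal_succ, Finset.Nat.sum_antidiagonal_succ']
    simp only [Nat.cast_zero, quantumInt_zero, mul_zero, zero_mul, zero_smul, zero_add]
    congr 1
    · refine Finset.sum_congr rfl fun p hp => ?_
      rw [Finset.HasAntidiagonal.mem_antidiagonal] at hp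
      congr 1
      have e := expCoeff_succ p.1
      push_cast
      calc _ = (qVar ^ p.2 * qVar ^ p.1) * (qVar - qVar⁻¹) * (expCoeff p.1 * expCoeff p.2) := by
            rw [← pow_add, add_comm p.2, hp]
        _ = qVar ^ p.2 * (expCoeff p.1 * qVar ^ p.1 * (qVar - qVar⁻¹)) * expCoeff p.2 := by ring
        _ = _ := by rw [← e, zpow_natCast]; ring
    · refine Finset.sum_congr rfl fun p hp => ?_
      rw [Finset.HasAntidiagonal.mem_antidiagonal] at hp
      congr 1
      have e := expCoeff_succ p.2
      push_cast
      have e2 : qVar ^ k * qVar ^ (-(2 * p.1) : ℤ) = qVar ^ p.2 * qVar ^ (-p.1 : ℤ) := by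
        rw [← zpow_natCast, ← zpow_natCast, ← zpow_add₀ qVar_ne_zero, ← zpow_add₀ qVar_ne_zero,
          ← hp]
        congr 1
        push_cast
        ring
      calc _ = (qVar ^ k * qVar ^ (-(2 * p.1) : ℤ)) * (qVar - qVar⁻¹) *
            (expCoeff p.1 * expCoeff p.2) := by ring
        _ = qVar ^ (-p.1 : ℤ) * (expCoeff p.2 * qVar ^ p.2 * (qVar - qVar⁻¹)) *
            expCoeff p.1 := by rw [e2]; ring
        _ = _ := by rw [← e]; ring

/-- The truncated quantum exponential function. -/
noncomputable def qExp (B : ℕ) (X : A) : A := ∑ k ∈ Finset.range B, expCoeff k • X ^ k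

/-- The place of truncation is immaterial once it exceeds the nilpotency index, so different
exponentials can be given a common bound. -/
theorem qExp_eq_of_le {X : A} {b B : ℕ} (hX : X ^ b = 0) (hB : b ≤ B) : qExp B X = qExp b X := by
  symm
  refine Finset.sum_subset (Finset.range_subset_range.2 hB) fun k _ hk => ?_
  rw [pow_eq_zero_of_le (by simpa using hk) hX, smul_zero]

/-- The exponential law, obtained by summing the quantum binomial formula over all degrees.
Bidegrees outside the square of side `b` vanish by nilpotency, and those inside have total degree
less than b + b. -/
theorem qExp_add {X Y : A} (h : X * Y = qVar ^ (2 : ℤ) • (Y * X)) {b B : ℕ} (hX : X ^ b = 0)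
    (hY : Y ^ b = 0) (hB : b + b ≤ B) : qExp B (X + Y) = qExp b X * qExp b Y := by
  have e : qExp b X * qExp b Y = ∑ p ∈ Finset.range b ×ˢ Finset.range b,
      (expCoeff p.1 * expCoeff p.2) • (X ^ p.1 * Y ^ p.2) := by
    rw [qExp, qExp, Finset.sum_mul_sum, Finset.sum_product]
    refine Finset.sum_congr rfl fun i _ => Finset.sum_congr rfl fun j _ => ?_
    rw [smul_mul_smul_comm]
  rw [e, qExp, ← Finset.sum_fiberwise_of_maps_to (s := Finset.range b ×ˢ Finset.range b)
    (t := Finset.range B) (g := fun p => p.1 + p.2)]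
  · refine Finset.sum_congr rfl fun k _ => ?_
    rw [expCoeff_smul_add_pow h]
    symm
    refine Finset.sum_subset_zero_on_sdiff ?_ ?_ fun _ _ => rfl
    · intro p hp
      rw [Finset.HasAntidiagonal.mem_antidiagonal]
      exact (Finset.mem_filter.1 hp).2
    · intro p hp
      rw [Finset.mem_sdiff, Finset.HasAntidiagonal.mem_antidiagonal, Finset.mem_filter,
        Finset.mem_product,
        Finset.mem_range, Finset.mem_range] at hp
      by_cases hp1 : p.1 < b
      · have hp2 : b ≤ p.2 := by
          by_contra hp2
          exact hp.2 ⟨⟨hp1, by omega⟩, hp.1⟩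
        rw [pow_eq_zero_of_le hp2 hY, mul_zero, smul_zero]
      · rw [pow_eq_zero_of_le (not_lt.1 hp1) hX, zero_mul, smul_zero]
  · intro p hp
    rw [Finset.mem_product, Finset.mem_range, Finset.mem_range] at hp
    rw [Finset.mem_range]
    omega

theorem isUnit_qExp {X : A} {b B : ℕ} (hX : X ^ b = 0) (hB : 0 < B) : IsUnit (qExp B X) := by
  obtain ⟨B, rfl⟩ := Nat.exists_eq_succ_of_ne_zero hB.ne'
  have e : qExp (B + 1) X = 1 + X * ∑ k ∈ Finset.range B, expCoeff (k + 1) • X ^ k := by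
    rw [qExp, Finset.sum_range_succ', add_comm, expCoeff_zero, pow_zero, one_smul,
      Finset.mul_sum]
    congr 1
    refine Finset.sum_congr rfl fun k _ => ?_
    rw [mul_smul_comm, pow_succ']
  rw [e]
  refine IsNilpotent.isUnit_one_add ⟨b, ?_⟩
  rw [Commute.mul_pow, hX, zero_mul]
  exact Commute.sum_right _ _ _ fun k _ =>
    ((Commute.refl X).pow_right k).smul_right _

end QuantumExp

end FramedSkein

namespace FramedSkein

namespace WeightModule

/-! ### Weight modules and their homomorphisms -/

/-- `E` raises and `F` lowers the weight by two. -/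
structure IsGraded {ι : Type} (M : WeightModule ι) : Prop where
  E : ∀ b a, M.E b a ≠ 0 → M.h b = M.h a + 2
  F : ∀ b a, M.F b a ≠ 0 → M.h b = M.h a - 2

variable {ι κ π ι' κ' : Type} [Fintype ι] [DecidableEq ι] [Fintype κ] [DecidableEq κ]
  [Fintype π] [DecidableEq π] [Fintype ι'] [DecidableEq ι'] [Fintype κ'] [DecidableEq κ']

/-- Homomorphisms of weight modules. -/
structure IsHom (M : WeightModule ι) (N : WeightModule κ)
    (f : Matrix κ ι RationalFunctions) : Prop where
  E : f * M.E = N.E * f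
  F : f * M.F = N.F * f
  h : ∀ b a, f b a ≠ 0 → N.h b = M.h a

/-- The tensor product of weight modules. -/
noncomputable def tensor (M : WeightModule ι) (N : WeightModule κ) : WeightModule (ι × κ) where
  E := M.E ⊗ₖ N.K 1 + 1 ⊗ₖ N.E
  F := M.F ⊗ₖ 1 + M.K (-1) ⊗ₖ N.F
  h x := M.h x.1 + N.h x.2

theorem IsGraded.pow_E {M : WeightModule ι} (hM : M.IsGraded) (k : ℕ) (b a : ι)
    (h : (M.E ^ k) b a ≠ 0) : M.h b = M.h a + 2 * k := by
  induction k generalizing b with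
  | zero =>
    rw [pow_zero] at h
    have : b = a := by
      by_contra hne
      exact h (Matrix.one_apply_ne hne)
    simp [this]
  | succ k ih =>
    rw [pow_succ', Matrix.mul_apply] at h
    obtain ⟨c, -, hc⟩ := Finset.exists_ne_zero_of_sum_ne_zero h
    have h1 := hM.E b c (left_ne_zero_of_mul hc)
    have h2 := ih c (right_ne_zero_of_mul hc)
    push_cast
    omega

theorem IsGraded.pow_E_eq_zero {M : WeightModule ι} (hM : M.IsGraded) {k : ℕ}
    (hk : ∀ a b, M.h b < M.h a + 2 * k) : M.E ^ k = 0 := by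
  ext b a
  by_contra h
  have := hM.pow_E k b a h
  have := hk a b
  omega

/-- An exponent for which the power of `E` vanishes. -/
def bound (M : WeightModule ι) : ℕ := (∑ a, |M.h a|).toNat + 1

theorem abs_h_le (M : WeightModule ι) (a : ι) : |M.h a| ≤ ∑ a, |M.h a| :=
  Finset.single_le_sum (f := fun a => |M.h a|) (fun _ _ => abs_nonneg _) (Finset.mem_univ a)

/-- The k-th power of `E` raises the weight by 2k, which eventually exceeds the distance between any
two of the finitely many weights. -/
theorem IsGraded.pow_bound {M : WeightModule ι} (hM : M.IsGraded) : M.E ^ M.bound = 0 := by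
  refine hM.pow_E_eq_zero fun a b => ?_
  have h1 := abs_le.1 (M.abs_h_le a)
  have h2 := abs_le.1 (M.abs_h_le b)
  have h3 : ((∑ a, |M.h a|).toNat : ℤ) = ∑ a, |M.h a| :=
    Int.toNat_of_nonneg (Finset.sum_nonneg fun _ _ => abs_nonneg _)
  rw [bound]
  push_cast
  omega

/-- The diagonal part of the `R`-matrix. -/
noncomputable def weightMatrix (M : WeightModule ι) (N : WeightModule κ) :
    Matrix (ι × κ) (ι × κ) RationalFunctions :=
  Matrix.diagonal fun x => tVar ^ (M.h x.1 * N.h x.2)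

/-- The `R`-matrix of two weight modules. -/
noncomputable def R (M : WeightModule ι) (N : WeightModule κ) :
    Matrix (ι × κ) (ι × κ) RationalFunctions :=
  weightMatrix M N * qExp M.bound (M.E ⊗ₖ N.F)

theorem kronecker_pow {α : Type*} [CommRing α] (A : Matrix ι ι α) (B : Matrix κ κ α) (k : ℕ) :
    (A ⊗ₖ B) ^ k = (A ^ k) ⊗ₖ (B ^ k) := by
  induction k with
  | zero => simp
  | succ k ih => rw [pow_succ, ih, ← Matrix.mul_kronecker_mul, pow_succ, pow_succ]

theorem kronecker_pow_eq_zero {α : Type*} [CommRing α] {A : Matrix ι ι α} (B : Matrix κ κ α)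
    {k : ℕ} (h : A ^ k = 0) : (A ⊗ₖ B) ^ k = 0 := by
  rw [kronecker_pow, h, Matrix.zero_kronecker]

theorem R_eq_of_pow_eq_zero {M : WeightModule ι} (hM : M.IsGraded) (N : WeightModule κ) {B : ℕ}
    (hB : M.E ^ B = 0) : M.R N = weightMatrix M N * qExp B (M.E ⊗ₖ N.F) := by
  rw [R]
  congr 1
  rcases le_total B M.bound with h | h
  · exact qExp_eq_of_le (kronecker_pow_eq_zero _ hB) h
  · exact (qExp_eq_of_le (kronecker_pow_eq_zero _ hM.pow_bound) h).symm

theorem isUnit_weightMatrix (M : WeightModule ι) (N : WeightModule κ) :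
    IsUnit (weightMatrix M N) := by
  rw [weightMatrix, Matrix.isUnit_diagonal, Pi.isUnit_iff]
  exact fun x => isUnit_iff_ne_zero.2 (zpow_ne_zero _ tVar_ne_zero)

theorem isUnit_R {M : WeightModule ι} (hM : M.IsGraded) (N : WeightModule κ) :
    IsUnit (M.R N) :=
  (isUnit_weightMatrix M N).mul
    (isUnit_qExp (kronecker_pow_eq_zero _ hM.pow_bound) (Nat.succ_pos _))

theorem rMatrix_eq_R {M N : WeightModule ι} (hM : M.IsGraded) (h : M.E ^ Fintype.card ι = 0) :
    M.rMatrix N = M.R N := by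
  rw [R_eq_of_pow_eq_zero hM N h, rMatrix, weightMatrix, qExp]
  congr 1
  refine Finset.sum_congr rfl fun k _ => ?_
  rw [kronecker_pow]
  rfl

/-! ### Naturality of the `R`-matrix -/

theorem qExp_intertwine {α β : Type*} [Fintype α] [DecidableEq α] [Fintype β] [DecidableEq β]
    {X : Matrix α α RationalFunctions} {Y : Matrix β β RationalFunctions}
    {f : Matrix β α RationalFunctions} (h : f * X = Y * f) (B : ℕ) :
    f * qExp B X = qExp B Y * f := by
  have hp : ∀ k : ℕ, f * X ^ k = Y ^ k * f := by
    intro k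
    induction k with
    | zero => simp
    | succ k ih => rw [pow_succ, ← Matrix.mul_assoc, ih, Matrix.mul_assoc, h, ← Matrix.mul_assoc,
        pow_succ]
  rw [qExp, qExp, Matrix.mul_sum, Matrix.sum_mul]
  refine Finset.sum_congr rfl fun k _ => ?_
  rw [Matrix.mul_smul, Matrix.smul_mul, hp]

/-- A homomorphism commutes with E and F, hence with the exponential factor, and preserves weights,
hence commutes with the diagonal factor. -/
theorem IsHom.R {M : WeightModule ι} {M' : WeightModule ι'} {N : WeightModule κ}
    {N' : WeightModule κ'} {f : Matrix ι' ι RationalFunctions}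
    {g : Matrix κ' κ RationalFunctions} (hM : M.IsGraded) (hM' : M'.IsGraded)
    (hf : M.IsHom M' f) (hg : N.IsHom N' g) : (f ⊗ₖ g) * M.R N = M'.R N' * (f ⊗ₖ g) := by
  have hB : M.E ^ (M.bound + M'.bound) = 0 := pow_eq_zero_of_le (by omega) hM.pow_bound
  have hB' : M'.E ^ (M.bound + M'.bound) = 0 := pow_eq_zero_of_le (by omega) hM'.pow_bound
  rw [R_eq_of_pow_eq_zero hM N hB, R_eq_of_pow_eq_zero hM' N' hB', Matrix.mul_assoc,
    ← qExp_intertwine (f := f ⊗ₖ g) (X := M.E ⊗ₖ N.F), ← Matrix.mul_assoc, ← Matrix.mul_assoc]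
  · congr 1
    ext x y
    rw [weightMatrix, weightMatrix, Matrix.mul_diagonal, Matrix.diagonal_mul, mul_comm]
    by_cases h : (f ⊗ₖ g) x y = 0
    · rw [h, mul_zero, mul_zero]
    · rw [Matrix.kroneckerMap_apply] at h
      rw [hf.h _ _ (left_ne_zero_of_mul h), hg.h _ _ (right_ne_zero_of_mul h)]
  · rw [← Matrix.mul_kronecker_mul, ← Matrix.mul_kronecker_mul, hf.E, hg.F]

theorem IsHom.R_inv {M : WeightModule ι} {M' : WeightModule ι'} {N : WeightModule κ}
    {N' : WeightModule κ'} {f : Matrix ι' ι RationalFunctions}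
    {g : Matrix κ' κ RationalFunctions} (hM : M.IsGraded) (hM' : M'.IsGraded)
    (hf : M.IsHom M' f) (hg : N.IsHom N' g) :
    (f ⊗ₖ g) * (M.R N)⁻¹ = (M'.R N')⁻¹ * (f ⊗ₖ g) := by
  have h1 := (Matrix.isUnit_iff_isUnit_det _).1 (isUnit_R hM N)
  have h2 := (Matrix.isUnit_iff_isUnit_det _).1 (isUnit_R hM' N')
  have h := hf.R hM hM' hg
  calc (f ⊗ₖ g) * (M.R N)⁻¹
      = (M'.R N')⁻¹ * (M'.R N' * (f ⊗ₖ g)) * (M.R N)⁻¹ := by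
        rw [← Matrix.mul_assoc, Matrix.nonsing_inv_mul _ h2, Matrix.one_mul]
    _ = _ := by rw [← h, ← Matrix.mul_assoc, Matrix.mul_assoc _ (M.R N),
        Matrix.mul_nonsing_inv _ h1, Matrix.mul_one]

/-! ### The `R`-matrix of a tensor product -/

theorem K_apply_ne (M : WeightModule ι) (k : ℤ) {a b : ι} (h : a ≠ b) : M.K k a b = 0 :=
  Matrix.diagonal_apply_ne _ h

theorem IsGraded.K_one_mul_E {M : WeightModule ι} (hM : M.IsGraded) :
    M.K 1 * M.E = qVar ^ (2 : ℤ) • (M.E * M.K 1) := by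
  ext a b
  rw [K, Matrix.diagonal_mul, Matrix.smul_apply, Matrix.mul_diagonal, smul_eq_mul]
  by_cases h : M.E a b = 0
  · simp [h]
  · rw [hM.E a b h, mul_add, zpow_add₀ qVar_ne_zero]
    ring_nf

theorem IsGraded.K_neg_one_mul_F {M : WeightModule ι} (hM : M.IsGraded) :
    M.K (-1) * M.F = qVar ^ (2 : ℤ) • (M.F * M.K (-1)) := by
  ext a b
  rw [K, Matrix.diagonal_mul, Matrix.smul_apply, Matrix.mul_diagonal, smul_eq_mul]
  by_cases h : M.F a b = 0
  · simp [h]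
  · rw [hM.F a b h, show -1 * (M.h b - 2) = -1 * M.h b + 2 by ring, zpow_add₀ qVar_ne_zero]
    ring_nf

theorem IsGraded.tensor {M : WeightModule ι} {N : WeightModule κ} (hM : M.IsGraded)
    (hN : N.IsGraded) : (M.tensor N).IsGraded where
  E b a h := by
    simp only [WeightModule.tensor, Matrix.add_apply, Matrix.kroneckerMap_apply] at h ⊢
    by_cases h1 : M.E b.1 a.1 * N.K 1 b.2 a.2 = 0
    · rw [h1, zero_add] at h
      have h2 : b.1 = a.1 := by
        by_contra hne
        rw [Matrix.one_apply_ne hne, zero_mul] at h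
        exact h rfl
      rw [h2, hN.E _ _ (right_ne_zero_of_mul h)]
      ring
    · have h2 : b.2 = a.2 := by
        by_contra hne
        rw [K_apply_ne _ _ hne, mul_zero] at h1
        exact h1 rfl
      rw [h2, hM.E _ _ (left_ne_zero_of_mul h1)]
      ring
  F b a h := by
    simp only [WeightModule.tensor, Matrix.add_apply, Matrix.kroneckerMap_apply] at h ⊢
    by_cases h1 : M.F b.1 a.1 * (1 : Matrix κ κ RationalFunctions) b.2 a.2 = 0
    · rw [h1, zero_add] at h
      have h2 : b.1 = a.1 := by
        by_contra hne
        rw [K_apply_ne _ _ hne, zero_mul] at h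
        exact h rfl
      rw [h2, hN.F _ _ (right_ne_zero_of_mul h)]
      ring
    · have h2 : b.2 = a.2 := by
        by_contra hne
        rw [Matrix.one_apply_ne hne, mul_zero] at h1
        exact h1 rfl
      rw [h2, hM.F _ _ (left_ne_zero_of_mul h1)]
      ring

/-! ### Matrices acting on one factor of a product -/

section Lift

variable {X Y Z : Type} [Fintype X] [DecidableEq X] [Fintype Y] [DecidableEq Y] [Fintype Z]
  [DecidableEq Z]

/-- The extension of a matrix on one factor of a product by the identity on the other factor. -/
noncomputable def lift (e : X ≃ Y × Z) (A : Matrix Y Y RationalFunctions) :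
    Matrix X X RationalFunctions :=
  (A ⊗ₖ (1 : Matrix Z Z RationalFunctions)).submatrix e e

theorem lift_apply (e : X ≃ Y × Z) (A : Matrix Y Y RationalFunctions) (x y : X) :
    lift e A x y = if (e x).2 = (e y).2 then A (e x).1 (e y).1 else 0 := by
  simp [lift, Matrix.kroneckerMap_apply, Matrix.one_apply]

theorem lift_mul (e : X ≃ Y × Z) (A B : Matrix Y Y RationalFunctions) :
    lift e (A * B) = lift e A * lift e B := by
  rw [lift, lift, lift, Matrix.submatrix_mul_equiv, ← Matrix.mul_kronecker_mul, Matrix.one_mul]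

theorem lift_one (e : X ≃ Y × Z) : lift e 1 = 1 := by
  rw [lift, Matrix.one_kronecker_one, Matrix.submatrix_one_equiv]

theorem lift_smul (e : X ≃ Y × Z) (c : RationalFunctions) (A : Matrix Y Y RationalFunctions) :
    lift e (c • A) = c • lift e A := by
  rw [lift, Matrix.smul_kronecker]; rfl

theorem lift_sum (e : X ≃ Y × Z) {J : Type*} (s : Finset J)
    (A : J → Matrix Y Y RationalFunctions) :
    lift e (∑ j ∈ s, A j) = ∑ j ∈ s, lift e (A j) := by
  ext x y
  rw [Matrix.sum_apply]
  simp only [lift_apply]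
  split_ifs
  · rw [Matrix.sum_apply]
  · simp

theorem lift_pow (e : X ≃ Y × Z) (A : Matrix Y Y RationalFunctions) (k : ℕ) :
    lift e (A ^ k) = lift e A ^ k := by
  induction k with
  | zero => rw [pow_zero, pow_zero, lift_one]
  | succ k ih => rw [pow_succ, lift_mul, ih, pow_succ]

theorem lift_qExp (e : X ≃ Y × Z) (A : Matrix Y Y RationalFunctions) (B : ℕ) :
    lift e (qExp B A) = qExp B (lift e A) := by
  rw [qExp, lift_sum, qExp]
  exact Finset.sum_congr rfl fun k _ => by rw [lift_smul, lift_pow]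

theorem lift_diagonal (e : X ≃ Y × Z) (d : Y → RationalFunctions) :
    lift e (Matrix.diagonal d) = Matrix.diagonal fun x => d (e x).1 := by
  ext x y
  rw [lift_apply, Matrix.diagonal_apply, Matrix.diagonal_apply]
  by_cases h : x = y
  · simp [h]
  · have : ¬((e x).2 = (e y).2 ∧ (e x).1 = (e y).1) := fun h' =>
      h (e.injective (Prod.ext h'.2 h'.1))
    rw [if_neg h]
    split_ifs <;> tauto

theorem lift_inv (e : X ≃ Y × Z) {A : Matrix Y Y RationalFunctions} (h : IsUnit A) :
    (lift e A)⁻¹ = lift e A⁻¹ := by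
  refine Matrix.inv_eq_right_inv ?_
  rw [← lift_mul, Matrix.mul_nonsing_inv _ ((Matrix.isUnit_iff_isUnit_det _).1 h), lift_one]

end Lift

/-- The first and third factor of a product. -/
def equiv13 : (ι × κ) × π ≃ (ι × π) × κ where
  toFun x := ((x.1.1, x.2), x.1.2)
  invFun x := ((x.1.1, x.2), x.1.2)

/-- The second and third factor of a product. -/
def equiv23 : (ι × κ) × π ≃ (κ × π) × ι where
  toFun x := ((x.1.2, x.2), x.1.1)
  invFun x := ((x.2, x.1.1), x.1.2)

/-- The first and second factor of a product. -/
def equiv12' : ι × κ × π ≃ (ι × κ) × π where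
  toFun x := ((x.1, x.2.1), x.2.2)
  invFun x := (x.1.1, x.1.2, x.2)

/-- The first and third factor of a product. -/
def equiv13' : ι × κ × π ≃ (ι × π) × κ where
  toFun x := ((x.1, x.2.2), x.2.1)
  invFun x := (x.1.1, x.2, x.1.2)

/-- The identity (Δ ⊗ 1) R = R₁₃ R₂₃. The coproduct of E gives the sum of X = E ⊗ K ⊗ F and Y = 1 ⊗
E ⊗ F, which q-commute, so the exponential law splits the exponential; the factor K in X is then
absorbed by the diagonal part of R₂₃. -/
theorem R_tensor_left {M : WeightModule ι} {N : WeightModule κ} {P : WeightModule π}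
    (hM : M.IsGraded) (hN : N.IsGraded) (hP : P.IsGraded) :
    (M.tensor N).R P = lift equiv13 (M.R P) * lift equiv23 (N.R P) := by
  set X := (M.E ⊗ₖ N.K 1) ⊗ₖ P.F with hX
  set Y := ((1 : Matrix ι ι RationalFunctions) ⊗ₖ N.E) ⊗ₖ P.F with hY
  have hadd : (M.tensor N).E ⊗ₖ P.F = X + Y := by
    rw [hX, hY, ← Matrix.add_kronecker]; rfl
  have hXY : X * Y = qVar ^ (2 : ℤ) • (Y * X) := by
    rw [hX, hY, ← Matrix.mul_kronecker_mul, ← Matrix.mul_kronecker_mul,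
      ← Matrix.mul_kronecker_mul, ← Matrix.mul_kronecker_mul, hN.K_one_mul_E, Matrix.mul_one,
      Matrix.one_mul, Matrix.kronecker_smul, Matrix.smul_kronecker]
  set b := M.bound + N.bound with hb
  have hMb : M.E ^ b = 0 := pow_eq_zero_of_le (by omega) hM.pow_bound
  have hNb : N.E ^ b = 0 := pow_eq_zero_of_le (by omega) hN.pow_bound
  have hXb : X ^ b = 0 := kronecker_pow_eq_zero _ (kronecker_pow_eq_zero _ hMb)
  have hYb : Y ^ b = 0 := kronecker_pow_eq_zero _ (by
    rw [kronecker_pow, hNb, Matrix.kronecker_zero])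
  have hMN := hM.tensor hN
  have hMNb : (M.tensor N).E ^ (b + b + (M.tensor N).bound) = 0 :=
    pow_eq_zero_of_le (by omega) hMN.pow_bound
  have hX' : lift equiv13 (M.E ⊗ₖ P.F) =
      (M.E ⊗ₖ (1 : Matrix κ κ RationalFunctions)) ⊗ₖ P.F := by
    ext x y
    simp only [lift_apply, equiv13, Matrix.kroneckerMap_apply, Matrix.one_apply, Equiv.coe_fn_mk]
    split_ifs <;> ring
  have hY' : lift equiv23 (N.E ⊗ₖ P.F) = Y := by
    ext x y
    simp only [hY, lift_apply, equiv23, Matrix.kroneckerMap_apply, Matrix.one_apply,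
      Equiv.coe_fn_mk]
    split_ifs <;> ring
  have hD : weightMatrix (M.tensor N) P =
      lift equiv13 (weightMatrix M P) * lift equiv23 (weightMatrix N P) := by
    rw [weightMatrix, weightMatrix, weightMatrix, lift_diagonal, lift_diagonal,
      Matrix.diagonal_mul_diagonal]
    congr 1
    funext x
    rw [← zpow_add₀ tVar_ne_zero]
    congr 1
    exact add_mul _ _ _
  -- F lowers the weight by 2, so passing it changes the diagonal part by t^(-2h) = q^(-h), with h
  -- the weight in `N`, and this cancels K.
  have hcomm : lift equiv23 (weightMatrix N P) * X =
      (M.E ⊗ₖ (1 : Matrix κ κ RationalFunctions)) ⊗ₖ P.F * lift equiv23 (weightMatrix N P) := by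
    ext x y
    rw [weightMatrix, lift_diagonal, Matrix.diagonal_mul, Matrix.mul_diagonal]
    simp only [hX, equiv23, Equiv.coe_fn_mk, Matrix.kroneckerMap_apply]
    by_cases hxy : x.1.2 = y.1.2
    · by_cases hF : P.F x.2 y.2 = 0
      · simp [hF]
      · rw [hxy, hP.F _ _ hF, K, Matrix.diagonal_apply_eq, Matrix.one_apply_eq, mul_sub,
          zpow_sub₀ tVar_ne_zero, qVar, ← zpow_natCast, ← zpow_mul, one_mul]
        have := zpow_ne_zero (N.h y.1.2 * 2) tVar_ne_zero
        push_cast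
        rw [mul_comm (2 : ℤ)]
        field_simp
    · rw [K_apply_ne _ _ hxy, Matrix.one_apply_ne hxy]
      simp
  rw [R_eq_of_pow_eq_zero hMN P hMNb, hadd, qExp_add hXY hXb hYb (by omega),
    R_eq_of_pow_eq_zero hM P hMb, R_eq_of_pow_eq_zero hN P hNb, lift_mul, lift_mul, lift_qExp,
    lift_qExp, hX', hY', hD]
  simp only [Matrix.mul_assoc]
  rw [← Matrix.mul_assoc _ (qExp b X), qExp_intertwine hcomm, Matrix.mul_assoc]

/-- The identity (1 ⊗ Δ) R = R₁₃ R₁₂, by the same argument with Δ F; here the term with K⁻¹ stands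
first in the exponential law. -/
theorem R_tensor_right {M : WeightModule ι} {N : WeightModule κ} {P : WeightModule π}
    (hM : M.IsGraded) (hN : N.IsGraded) :
    M.R (N.tensor P) = lift equiv13' (M.R P) * lift equiv12' (M.R N) := by
  set X := M.E ⊗ₖ (N.F ⊗ₖ (1 : Matrix π π RationalFunctions)) with hX
  set Y := M.E ⊗ₖ (N.K (-1) ⊗ₖ P.F) with hY
  have hadd : M.E ⊗ₖ (N.tensor P).F = Y + X := by
    rw [add_comm, hX, hY, ← Matrix.kronecker_add]; rfl
  have hXY : Y * X = qVar ^ (2 : ℤ) • (X * Y) := by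
    rw [hX, hY, ← Matrix.mul_kronecker_mul, ← Matrix.mul_kronecker_mul,
      ← Matrix.mul_kronecker_mul, ← Matrix.mul_kronecker_mul, hN.K_neg_one_mul_F, Matrix.mul_one,
      Matrix.one_mul, Matrix.smul_kronecker, Matrix.kronecker_smul]
  set b := M.bound with hb
  have hMb : M.E ^ b = 0 := hM.pow_bound
  have hXb : X ^ b = 0 := kronecker_pow_eq_zero _ hMb
  have hYb : Y ^ b = 0 := kronecker_pow_eq_zero _ hMb
  have hMb' : M.E ^ (b + b) = 0 := pow_eq_zero_of_le (by omega) hM.pow_bound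
  have hX' : lift equiv12' (M.E ⊗ₖ N.F) = X := by
    ext x y
    simp only [hX, lift_apply, equiv12', Matrix.kroneckerMap_apply, Matrix.one_apply,
      Equiv.coe_fn_mk]
    split_ifs <;> ring
  have hY' : lift equiv13' (M.E ⊗ₖ P.F) =
      M.E ⊗ₖ ((1 : Matrix κ κ RationalFunctions) ⊗ₖ P.F) := by
    ext x y
    simp only [lift_apply, equiv13', Matrix.kroneckerMap_apply, Matrix.one_apply,
      Equiv.coe_fn_mk]
    split_ifs <;> ring
  have hD : weightMatrix M (N.tensor P) =
      lift equiv13' (weightMatrix M P) * lift equiv12' (weightMatrix M N) := by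
    rw [weightMatrix, weightMatrix, weightMatrix, lift_diagonal, lift_diagonal,
      Matrix.diagonal_mul_diagonal]
    congr 1
    funext x
    rw [← zpow_add₀ tVar_ne_zero]
    congr 1
    exact (mul_add _ _ _).trans (add_comm _ _)
  have hcomm : lift equiv12' (weightMatrix M N) * Y =
      M.E ⊗ₖ ((1 : Matrix κ κ RationalFunctions) ⊗ₖ P.F) * lift equiv12' (weightMatrix M N) := by
    ext x y
    rw [weightMatrix, lift_diagonal, Matrix.diagonal_mul, Matrix.mul_diagonal]
    simp only [hY, equiv12', Equiv.coe_fn_mk, Matrix.kroneckerMap_apply]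
    by_cases hxy : x.2.1 = y.2.1
    · by_cases hE : M.E x.1 y.1 = 0
      · simp [hE]
      · rw [hxy, hM.E _ _ hE, K, Matrix.diagonal_apply_eq, Matrix.one_apply_eq, add_mul,
          zpow_add₀ tVar_ne_zero, qVar, ← zpow_natCast, ← zpow_mul, neg_one_mul, mul_neg, zpow_neg]
        have := zpow_ne_zero (2 * N.h y.2.1) tVar_ne_zero
        push_cast
        field_simp
    · rw [K_apply_ne _ _ hxy, Matrix.one_apply_ne hxy]
      simp
  rw [R_eq_of_pow_eq_zero hM _ hMb', hadd, qExp_add hXY hYb hXb le_rfl,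
    R_eq_of_pow_eq_zero hM P hMb, R_eq_of_pow_eq_zero hM N hMb, lift_mul, lift_mul, lift_qExp,
    lift_qExp, hX', hY', hD]
  simp only [Matrix.mul_assoc]
  rw [← Matrix.mul_assoc _ (qExp b Y), qExp_intertwine hcomm, Matrix.mul_assoc]

end WeightModule

end FramedSkein

namespace FramedSkein

namespace WeightModule

variable {ι κ π ι' κ' : Type} [Fintype ι] [DecidableEq ι] [Fintype κ] [DecidableEq κ]
  [Fintype π] [DecidableEq π] [Fintype ι'] [DecidableEq ι'] [Fintype κ'] [DecidableEq κ']

/-! ### Crossings -/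

/-- The coefficient of `e_c ⊗ e_e` in the image of `e_a ⊗ e_b` under the braiding, for
`s = true`, or under the inverse of the braiding in the other order, for `s = false`. -/
noncomputable def braid (s : Bool) (M : WeightModule ι) (N : WeightModule κ) (a : ι) (b c : κ)
    (e : ι) : RationalFunctions :=
  if s then M.R N (e, c) (a, b) else (N.R M)⁻¹ (c, e) (b, a)

theorem crossing_eq_braid {M N : WeightModule ι} (hM : M.IsGraded) (hN : N.IsGraded)
    (hM' : M.E ^ Fintype.card ι = 0) (hN' : N.E ^ Fintype.card ι = 0) (s : Bool) (a b c e : ι) :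
    M.crossing s N a b c e = braid s M N a b c e := by
  rw [crossing, braid, rMatrix_eq_R hM hM', rMatrix_eq_R hN hN']

/-- Naturality of both kinds of crossing, written in coordinates in the shape that `Tensors.IsHom`
asks for. -/
theorem sum_braid_of_isHom {M : WeightModule ι} {M' : WeightModule ι'} {N : WeightModule κ}
    {N' : WeightModule κ'} {f : Matrix ι' ι RationalFunctions}
    {g : Matrix κ' κ RationalFunctions} (hM : M.IsGraded) (hM' : M'.IsGraded)
    (hN : N.IsGraded) (hN' : N'.IsGraded) (hf : M.IsHom M' f) (hg : N.IsHom N' g)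
    (s : Bool) (a : ι) (b : κ) (c' : κ') (e' : ι') :
    ∑ a', ∑ b', braid s M' N' a' b' c' e' * (f a' a * g b' b) =
      ∑ c, ∑ e, g c' c * (f e' e * braid s M N a b c e) := by
  cases s with
  | true =>
    have := congrFun (congrFun (hf.R hM hM' hg) (e', c')) (a, b)
    rw [Matrix.mul_apply, Matrix.mul_apply, Fintype.sum_prod_type, Fintype.sum_prod_type,
      Finset.sum_comm] at this
    simp only [Matrix.kroneckerMap_apply] at this
    simp only [braid, if_true]
    rw [← this]
    exact Finset.sum_congr rfl fun _ _ => Finset.sum_congr rfl fun _ _ => by ring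
  | false =>
    have := congrFun (congrFun (hg.R_inv hN hN' hf) (c', e')) (b, a)
    rw [Matrix.mul_apply, Matrix.mul_apply, Fintype.sum_prod_type, Fintype.sum_prod_type] at this
    simp only [Matrix.kroneckerMap_apply] at this
    simp only [braid, Bool.false_eq_true, if_false]
    rw [Finset.sum_comm]
    calc _ = _ := ?_
      _ = _ := this.symm
      _ = _ := ?_
    · exact Finset.sum_congr rfl fun _ _ => Finset.sum_congr rfl fun _ _ => by ring
    · exact Finset.sum_congr rfl fun _ _ => Finset.sum_congr rfl fun _ _ => by ring

/-- A bundle crosses a strand one constituent at a time. For `s = false` the inverse braiding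
exchanges the two factors, so this hexagon identity then comes from the coproduct in the other
argument. -/
theorem braid_tensor_left {M₁ : WeightModule ι} {M₂ : WeightModule κ} {N : WeightModule π}
    (h₁ : M₁.IsGraded) (h₂ : M₂.IsGraded) (hN : N.IsGraded) (s : Bool) (a : ι × κ) (b c : π)
    (e : ι × κ) : braid s (M₁.tensor M₂) N a b c e =
      ∑ x, braid s M₂ N a.2 b x e.2 * braid s M₁ N a.1 x c e.1 := by
  cases s with
  | true =>
    simp only [braid, if_true]
    rw [R_tensor_left h₁ h₂ hN, Matrix.mul_apply, Fintype.sum_prod_type,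
      Fintype.sum_eq_single (a.1, e.2)]
    · refine Finset.sum_congr rfl fun x _ => ?_
      simp [lift_apply, equiv13, equiv23, mul_comm]
    · intro y hy
      refine Finset.sum_eq_zero fun x _ => ?_
      simp only [lift_apply, equiv13, equiv23, Equiv.coe_fn_mk]
      split_ifs with h h'
      · exact absurd (Prod.ext_iff.2 ⟨h', h.symm⟩ : y = (a.1, e.2)) hy
      · rw [mul_zero]
      · rw [zero_mul]
      · rw [zero_mul]
  | false =>
    simp only [braid, Bool.false_eq_true, if_false]
    rw [R_tensor_right hN h₁, Matrix.mul_inv_rev, lift_inv _ (isUnit_R hN _),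
      lift_inv _ (isUnit_R hN _), Matrix.mul_apply, Fintype.sum_prod_type]
    refine Finset.sum_congr rfl fun x _ => ?_
    rw [Fintype.sum_eq_single (a.1, e.2)]
    · simp [lift_apply, equiv12', equiv13', mul_comm]
    · intro y hy
      simp only [lift_apply, equiv12', equiv13', Equiv.coe_fn_mk]
      split_ifs with h h'
      · exact absurd (Prod.ext_iff.2 ⟨h', h.symm⟩ : y = (a.1, e.2)) hy
      · rw [mul_zero]
      · rw [zero_mul]
      · rw [zero_mul]

theorem braid_tensor_right {M : WeightModule ι} {N₁ : WeightModule κ} {N₂ : WeightModule π}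
    (hM : M.IsGraded) (h₁ : N₁.IsGraded) (h₂ : N₂.IsGraded) (s : Bool) (a : ι) (b c : κ × π)
    (e : ι) : braid s M (N₁.tensor N₂) a b c e =
      ∑ x, braid s M N₁ a b.1 c.1 x * braid s M N₂ x b.2 c.2 e := by
  cases s with
  | true =>
    simp only [braid, if_true]
    rw [R_tensor_right hM h₁, Matrix.mul_apply, Fintype.sum_prod_type]
    refine Finset.sum_congr rfl fun x _ => ?_
    rw [Fintype.sum_eq_single (c.1, b.2)]
    · simp [lift_apply, equiv12', equiv13', mul_comm]
    · intro y hy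
      simp only [lift_apply, equiv12', equiv13', Equiv.coe_fn_mk]
      split_ifs with h h'
      · exact absurd (Prod.ext_iff.2 ⟨h.symm, h'⟩ : y = (c.1, b.2)) hy
      · rw [mul_zero]
      · rw [zero_mul]
      · rw [zero_mul]
  | false =>
    simp only [braid, Bool.false_eq_true, if_false]
    rw [R_tensor_left h₁ h₂ hM, Matrix.mul_inv_rev, lift_inv _ (isUnit_R h₁ _),
      lift_inv _ (isUnit_R h₂ _), Matrix.mul_apply, Fintype.sum_prod_type,
      Fintype.sum_eq_single (c.1, b.2)]
    · refine Finset.sum_congr rfl fun x _ => ?_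
      simp [lift_apply, equiv13, equiv23, mul_comm]
    · intro y hy
      refine Finset.sum_eq_zero fun x _ => ?_
      simp only [lift_apply, equiv13, equiv23, Equiv.coe_fn_mk]
      split_ifs with h h'
      · exact absurd (Prod.ext_iff.2 ⟨h.symm, h'⟩ : y = (c.1, b.2)) hy
      · rw [mul_zero]
      · rw [zero_mul]
      · rw [zero_mul]

theorem qExp_zero {A : Type*} [Ring A] [Algebra RationalFunctions A] (B : ℕ) (hB : 0 < B) :
    qExp B (0 : A) = 1 := by
  rw [qExp_eq_of_le (b := 1) (by simp) hB, qExp]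
  simp [expCoeff_zero]

theorem R_trivial_left {M : WeightModule ι} (hE : M.E = 0) (hh : ∀ a, M.h a = 0)
    (N : WeightModule κ) : M.R N = 1 := by
  rw [R, hE, Matrix.zero_kronecker, qExp_zero M.bound (Nat.succ_pos _), mul_one, weightMatrix]
  simp [hh]

theorem R_trivial_right {N : WeightModule κ} (hF : N.F = 0) (hh : ∀ a, N.h a = 0)
    (M : WeightModule ι) : M.R N = 1 := by
  rw [R, hF, Matrix.kronecker_zero, qExp_zero M.bound (Nat.succ_pos _), mul_one, weightMatrix]
  simp [hh]

theorem braid_trivial_left {M : WeightModule ι} (hE : M.E = 0) (hF : M.F = 0)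
    (hh : ∀ a, M.h a = 0) (N : WeightModule κ) (s : Bool) (a : ι) (b c : κ) (e : ι) :
    braid s M N a b c e = if c = b ∧ e = a then 1 else 0 := by
  rw [braid, R_trivial_left hE hh, R_trivial_right hF hh, inv_one]
  simp [Matrix.one_apply, and_comm]

theorem braid_trivial_right {N : WeightModule κ} (hE : N.E = 0) (hF : N.F = 0)
    (hh : ∀ a, N.h a = 0) (M : WeightModule ι) (s : Bool) (a : ι) (b c : κ) (e : ι) :
    braid s M N a b c e = if c = b ∧ e = a then 1 else 0 := by
  rw [braid, R_trivial_left hE hh, R_trivial_right hF hh, inv_one]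
  simp [Matrix.one_apply, and_comm]

/-! ### Duals and permutations of bases -/

theorem IsGraded.dual {M : WeightModule ι} (hM : M.IsGraded) : M.dual.IsGraded where
  E b a h := by
    simp only [WeightModule.dual, Matrix.transpose_apply, Matrix.neg_apply, K, Matrix.mul_diagonal,
      neg_ne_zero] at h ⊢
    have := hM.E _ _ (left_ne_zero_of_mul h)
    omega
  F b a h := by
    simp only [WeightModule.dual, Matrix.transpose_apply, Matrix.neg_apply, K, Matrix.diagonal_mul,
      neg_ne_zero] at h ⊢
    have := hM.F _ _ (right_ne_zero_of_mul h)
    omega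

theorem IsHom.K {M : WeightModule ι} {N : WeightModule κ} {f : Matrix κ ι RationalFunctions}
    (hf : M.IsHom N f) (k : ℤ) : f * M.K k = N.K k * f := by
  ext b a
  rw [WeightModule.K, WeightModule.K, Matrix.mul_diagonal, Matrix.diagonal_mul, mul_comm]
  by_cases h : f b a = 0
  · simp [h]
  · rw [hf.h _ _ h]

theorem IsHom.dual {M : WeightModule ι} {N : WeightModule κ} {f : Matrix κ ι RationalFunctions}
    (hf : M.IsHom N f) : N.dual.IsHom M.dual f.transpose where
  E := by
    simp only [WeightModule.dual, ← Matrix.transpose_mul]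
    rw [Matrix.neg_mul, Matrix.mul_neg, Matrix.mul_assoc, ← hf.K, ← Matrix.mul_assoc, ← hf.E,
      Matrix.mul_assoc]
  F := by
    simp only [WeightModule.dual, ← Matrix.transpose_mul]
    rw [Matrix.neg_mul, Matrix.mul_neg, Matrix.mul_assoc, ← hf.F, ← Matrix.mul_assoc, ← hf.K,
      Matrix.mul_assoc]
  h b a h := by
    simp only [WeightModule.dual]
    rw [hf.h _ _ h]

theorem IsHom.comp {M : WeightModule ι} {N : WeightModule κ} {P : WeightModule π}
    {f : Matrix κ ι RationalFunctions} {g : Matrix π κ RationalFunctions}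
    (hg : N.IsHom P g) (hf : M.IsHom N f) : M.IsHom P (g * f) where
  E := by rw [Matrix.mul_assoc, hf.E, ← Matrix.mul_assoc, hg.E, Matrix.mul_assoc]
  F := by rw [Matrix.mul_assoc, hf.F, ← Matrix.mul_assoc, hg.F, Matrix.mul_assoc]
  h b a h := by
    rw [Matrix.mul_apply] at h
    obtain ⟨c, -, hc⟩ := Finset.exists_ne_zero_of_sum_ne_zero h
    rw [hg.h _ _ (left_ne_zero_of_mul hc), hf.h _ _ (right_ne_zero_of_mul hc)]

theorem isHom_one (M : WeightModule ι) : M.IsHom M 1 where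
  E := by rw [Matrix.one_mul, Matrix.mul_one]
  F := by rw [Matrix.one_mul, Matrix.mul_one]
  h b a h := by
    by_cases hba : b = a
    · rw [hba]
    · exact absurd (Matrix.one_apply_ne hba) h

theorem IsHom.tensor {M : WeightModule ι} {M' : WeightModule ι'} {N : WeightModule κ}
    {N' : WeightModule κ'} {f : Matrix ι' ι RationalFunctions}
    {g : Matrix κ' κ RationalFunctions} (hf : M.IsHom M' f) (hg : N.IsHom N' g) :
    (M.tensor N).IsHom (M'.tensor N') (f ⊗ₖ g) where
  E := by
    simp only [WeightModule.tensor, Matrix.mul_add, Matrix.add_mul, ← Matrix.mul_kronecker_mul,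
      hf.E, hg.E, hg.K, Matrix.mul_one, Matrix.one_mul]
  F := by
    simp only [WeightModule.tensor, Matrix.mul_add, Matrix.add_mul, ← Matrix.mul_kronecker_mul,
      hf.F, hg.F, hf.K, Matrix.mul_one, Matrix.one_mul]
  h b a h := by
    rw [Matrix.kroneckerMap_apply] at h
    simp only [WeightModule.tensor, hf.h _ _ (left_ne_zero_of_mul h),
      hg.h _ _ (right_ne_zero_of_mul h)]

/-- The matrix that permutes the basis. -/
noncomputable def permMatrix (e : ι ≃ κ) : Matrix κ ι RationalFunctions :=
  (1 : Matrix ι ι RationalFunctions).submatrix e.symm id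

theorem permMatrix_apply (e : ι ≃ κ) (b : κ) (a : ι) :
    permMatrix e b a = if b = e a then 1 else 0 := by
  simp [permMatrix, Matrix.one_apply, Equiv.symm_apply_eq]

theorem isHom_permMatrix {M : WeightModule ι} {N : WeightModule κ} (e : ι ≃ κ)
    (hE : ∀ b a, N.E (e b) (e a) = M.E b a) (hF : ∀ b a, N.F (e b) (e a) = M.F b a)
    (hh : ∀ a, N.h (e a) = M.h a) : M.IsHom N (permMatrix e) where
  E := by
    ext b a
    obtain ⟨b, rfl⟩ := e.surjective b
    simp [Matrix.mul_apply, permMatrix_apply, hE]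
  F := by
    ext b a
    obtain ⟨b, rfl⟩ := e.surjective b
    simp [Matrix.mul_apply, permMatrix_apply, hF]
  h b a h := by
    rw [permMatrix_apply] at h
    have : b = e a := by
      by_contra hne
      exact h (if_neg hne)
    rw [this, hh]

/-- The antipode reverses the coproduct, so the dual of a product is the product of the duals in the
opposite order. This matches the fact that a bundle of parallel strands is seen in reverse order
after a turn. -/
theorem isHom_dual_tensor (M : WeightModule ι) (N : WeightModule κ) :
    (M.tensor N).dual.IsHom (N.dual.tensor M.dual) (permMatrix (Equiv.prodComm ι κ)) := by
  refine isHom_permMatrix _ ?_ ?_ ?_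
  · rintro ⟨a, b⟩ ⟨a', b'⟩
    simp only [Equiv.prodComm_apply, Prod.swap_prod_mk, tensor, dual, K, Matrix.add_apply,
      Matrix.kroneckerMap_apply, Matrix.transpose_apply, Matrix.neg_apply, Matrix.mul_diagonal,
      Matrix.one_apply, Matrix.diagonal_apply]
    have e : qVar ^ (-1 * (M.h a + N.h b)) = qVar ^ (-1 * M.h a) * qVar ^ (-1 * N.h b) := by
      rw [← zpow_add₀ qVar_ne_zero]; ring_nf
    have e2 : qVar ^ (1 * N.h b) * qVar ^ (-N.h b) = 1 := by
      rw [← zpow_add₀ qVar_ne_zero]; simp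
    rw [e]
    by_cases h1 : a = a' <;> by_cases h2 : b = b'
    · subst h1 h2
      simp only [if_true, one_mul] at e2 ⊢
      simp only [neg_mul, one_mul]
      linear_combination (M.E a a * qVar ^ (-M.h a)) * e2
    · subst h1
      simp only [if_true, h2, Ne.symm h2, if_false]
      simp only [mul_neg, neg_mul, one_mul]
      ring
    · subst h2
      simp only [if_true, h1, Ne.symm h1, if_false, one_mul] at e2 ⊢
      simp only [neg_mul, one_mul]
      linear_combination (M.E a' a * qVar ^ (-M.h a)) * e2
    · simp [h1, h2, Ne.symm h1, Ne.symm h2]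
  · rintro ⟨a, b⟩ ⟨a', b'⟩
    simp only [Equiv.prodComm_apply, Prod.swap_prod_mk, tensor, dual, K, Matrix.add_apply,
      Matrix.kroneckerMap_apply, Matrix.transpose_apply, Matrix.neg_apply, Matrix.diagonal_mul,
      Matrix.one_apply, Matrix.diagonal_apply]
    have e : qVar ^ (1 * (M.h a' + N.h b')) = qVar ^ (1 * M.h a') * qVar ^ (1 * N.h b') := by
      rw [← zpow_add₀ qVar_ne_zero]; ring_nf
    have e2 : qVar ^ (1 * M.h a') * qVar ^ (-M.h a') = 1 := by
      rw [← zpow_add₀ qVar_ne_zero]; simp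
    rw [e]
    by_cases h1 : a = a' <;> by_cases h2 : b = b'
    · subst h1 h2
      simp only [if_true, one_mul] at e2 ⊢
      simp only [mul_neg, neg_mul, one_mul, neg_neg]
      linear_combination (N.F b b * qVar ^ (N.h b)) * e2
    · subst h1
      simp only [if_true, h2, Ne.symm h2, if_false, one_mul] at e2 ⊢
      simp only [mul_neg, neg_mul, one_mul]
      linear_combination (N.F b' b * qVar ^ (N.h b')) * e2
    · subst h2
      simp only [if_true, h1, Ne.symm h1, if_false]
      simp only [mul_neg, neg_mul, one_mul, neg_neg]
      ring
    · simp [h1, h2, Ne.symm h1, Ne.symm h2]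
  · rintro ⟨a, b⟩
    simp only [Equiv.prodComm_apply, Prod.swap_prod_mk, tensor, dual]
    ring

end WeightModule

end FramedSkein

namespace FramedSkein

namespace WeightModule

/-! ### The two-dimensional module -/

theorem isGraded_irrep (n : ℕ) : (irrep n).IsGraded where
  E b a h := by
    simp only [irrep, Matrix.of_apply, ne_eq, ite_eq_right_iff, Classical.not_imp] at h ⊢
    omega
  F b a h := by
    simp only [irrep, Matrix.of_apply, ne_eq, ite_eq_right_iff, Classical.not_imp] at h ⊢
    omega

theorem pow_irrep_E (n : ℕ) : (irrep n).E ^ (n + 1) = 0 := by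
  refine (isGraded_irrep n).pow_E_eq_zero fun a b => ?_
  simp only [irrep]
  push_cast
  omega

theorem pow_dual_irrep_E (n : ℕ) : (irrep n).dual.E ^ (n + 1) = 0 := by
  refine (isGraded_irrep n).dual.pow_E_eq_zero fun a b => ?_
  simp only [irrep, dual]
  push_cast
  omega

/-- The `R`-matrix of the two-dimensional module with the parameter `t`. -/
noncomputable def fundamentalR (t : RationalFunctions) :
    Matrix (Fin 2 × Fin 2) (Fin 2 × Fin 2) RationalFunctions :=
  Matrix.of fun x y => if x = y then (if x.1 = x.2 then t else t⁻¹) else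
    if x = (1, 0) ∧ y = (0, 1) then t - t⁻¹ ^ 3 else 0

/-- Since E² = 0 only two terms of the exponential survive; the off-diagonal entry is t⁻¹ (q - q⁻¹)
= t - t⁻³. -/
theorem R_irrep_one : (irrep 1).R (irrep 1) = fundamentalR tVar := by
  have h0 := tVar_ne_zero
  rw [R_eq_of_pow_eq_zero (isGraded_irrep 1) _ (pow_irrep_E 1), qExp, Finset.sum_range_succ,
    Finset.sum_range_one]
  ext ⟨a, b⟩ ⟨c, d⟩
  rw [weightMatrix, Matrix.diagonal_mul]
  fin_cases a <;> fin_cases b <;> fin_cases c <;> fin_cases d <;>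
    simp [irrep, fundamentalR, expCoeff, quantumFactorial, quantumInt_one, qVar]
  field_simp

theorem fundamentalR_mul_inv {t : RationalFunctions} (h : t ≠ 0) :
    fundamentalR t * fundamentalR t⁻¹ = 1 := by
  ext ⟨a, b⟩ ⟨c, d⟩
  rw [Matrix.mul_apply, Fintype.sum_prod_type]
  simp only [Fin.sum_univ_two]
  fin_cases a <;> fin_cases b <;> fin_cases c <;> fin_cases d <;>
    simp [fundamentalR, h]
  field_simp
  ring

/-- The meeting point of the two theories: the braiding of the two-dimensional module is the
Kauffman resolution of a crossing. Everything else about crossings follows by naturality and the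
hexagon identities. -/
theorem braid_irrep_one (s : Bool) (a b c e : Fin 2) :
    braid s (irrep 1) (irrep 1) a b c e =
      crossingCoeff tUnit s * (if c = a ∧ e = b then 1 else 0) +
        crossingCoeff tUnit (!s) * (kauffmanCup tUnit c e * kauffmanCap tUnit a b) := by
  have h0 := tVar_ne_zero
  have hi : (fundamentalR tVar)⁻¹ = fundamentalR tVar⁻¹ :=
    Matrix.inv_eq_right_inv (fundamentalR_mul_inv h0)
  rw [braid, R_irrep_one, hi]
  fin_cases a <;> fin_cases b <;> fin_cases c <;> fin_cases e <;> cases s <;>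
    simp [fundamentalR, crossingCoeff, kauffmanCup, kauffmanCap, tUnit] <;> field_simp <;> ring

/-- The matrix of an isomorphism of the dual of the two-dimensional module with the module. -/
noncomputable def selfDual : Matrix (Fin 2) (Fin 2) RationalFunctions := !![0, -qVar; 1, 0]

theorem isHom_selfDual : (irrep 1).dual.IsHom (irrep 1) selfDual where
  E := by
    ext a b
    rw [Matrix.mul_apply, Matrix.mul_apply]
    fin_cases a <;> fin_cases b <;>
      simp [Fin.sum_univ_two, irrep, dual, selfDual, K, quantumInt_one, Matrix.mul_apply]
  F := by
    have := qVar_ne_zero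
    ext a b
    rw [Matrix.mul_apply, Matrix.mul_apply]
    fin_cases a <;> fin_cases b <;>
      simp [Fin.sum_univ_two, irrep, dual, selfDual, K, quantumInt_one, Matrix.mul_apply, this]
  h b a h := by
    fin_cases a <;> fin_cases b <;> simp [selfDual, irrep, dual] at h ⊢

/-- The module on a strand with the direction `d`. -/
noncomputable def strand {ι : Type} [Fintype ι] [DecidableEq ι] (M : WeightModule ι) (d : Bool) :
    WeightModule ι :=
  if d then M else M.dual

theorem IsGraded.strand {ι : Type} [Fintype ι] [DecidableEq ι] {M : WeightModule ι}
    (hM : M.IsGraded) (d : Bool) : (M.strand d).IsGraded := by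
  cases d
  · exact hM.dual
  · exact hM

/-- The coefficients of the state sum in which the strands carry the module `M`. -/
noncomputable def tensors {ι : Type} [Fintype ι] [DecidableEq ι] (M : WeightModule ι) :
    Tensors RationalFunctions ι where
  cup d a b := if d then (if a = b then 1 else 0) else M.K (-1) b a
  cap d a b := if d then M.K 1 b a else (if a = b then 1 else 0)
  cross s d d' := braid s (M.strand d) (M.strand d')

end WeightModule

theorem sliceMap_eq (n : ℕ) (u : List Bool) (s : OrientedSlice)
    (x : List (Fin (n + 1)) → RationalFunctions) :
    sliceMap n u s x = (WeightModule.irrep n).tensors.slice u s x := by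
  have hg : ∀ d, (strandModule n d).IsGraded := (WeightModule.isGraded_irrep n).strand
  have hp : ∀ d, (strandModule n d).E ^ Fintype.card (Fin (n + 1)) = 0 := by
    intro d
    rw [Fintype.card_fin]
    cases d
    · exact WeightModule.pow_dual_irrep_E n
    · exact WeightModule.pow_irrep_E n
  funext l
  cases s with
  | cup i d =>
    simp only [sliceMap, Tensors.slice]
    rcases l.drop i with _ | ⟨a, _ | ⟨b, r⟩⟩ <;> rfl
  | cap i => rfl
  | cross i s =>
    simp only [sliceMap, WeightModule.crossing_eq_braid (hg _) (hg _) (hp _) (hp _), Tensors.slice]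
    rcases l.drop i with _ | ⟨a, _ | ⟨b, r⟩⟩ <;> rfl

theorem coloredJones_eq_value (n : ℕ) (D : OrientedLinkDiagram) :
    coloredJones n D = (WeightModule.irrep n).tensors.value D.word := by
  have h : ∀ (w : List OrientedSlice) (u : List Bool)
      (x : List (Fin (n + 1)) → RationalFunctions),
      wordMap n w u x = (WeightModule.irrep n).tensors.eval w u x := by
    intro w
    induction w with
    | nil => exact fun _ _ => rfl
    | cons s w ih => exact fun u x => by rw [wordMap, sliceMap_eq, ih]; rfl
  rw [coloredJones, h, Tensors.value]
  congr 1
  funext l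
  cases l <;> rfl

end FramedSkein

namespace FramedSkein

open WeightModule

/-! ### Strands of the state model of the Kauffman bracket -/

/-- The vectors of the state model of the Kauffman bracket. -/
abbrev KauffmanSpace : Type := StreamFun RationalFunctions (Fin 2)

/-- Insert on the left a vector of a space with the basis `ι`, embedded in a tensor power of the
two-dimensional space. -/
structure StrandMap (ι : Type) where
  size : ℕ
  toFun : (ι → KauffmanSpace) →ₗ[RationalFunctions] KauffmanSpace
  shift : ∀ (A : Module.End RationalFunctions KauffmanSpace) (z : ι → KauffmanSpace),
    (under ^ size) A (toFun z) = toFun fun a => A (z a)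

namespace StrandMap

noncomputable instance (ι : Type) : CoeFun (StrandMap ι) fun _ =>
    (ι → KauffmanSpace) → KauffmanSpace :=
  ⟨fun X => X.toFun⟩

variable {ι κ π : Type} [Fintype ι] [DecidableEq ι] [Fintype κ] [DecidableEq κ]
  [Fintype π] [DecidableEq π]

theorem map_sum {J : Type*} (X : StrandMap ι) (s : Finset J) (z : J → ι → KauffmanSpace) :
    X (fun a => ∑ j ∈ s, z j a) = ∑ j ∈ s, X (z j) := by
  rw [← _root_.map_sum]
  congr 1
  funext a
  rw [Finset.sum_apply]

theorem map_smul (X : StrandMap ι) (c : RationalFunctions) (z : ι → KauffmanSpace) :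
    X (fun a => c • z a) = c • X z :=
  X.toFun.map_smul c z

/-- No strand. -/
noncomputable def unit : StrandMap (Fin 1) where
  size := 0
  toFun := LinearMap.proj 0
  shift _ _ := rfl

/-- One strand. -/
noncomputable def leaf : StrandMap (Fin 2) where
  size := 1
  toFun :=
    { toFun := fun z l => z l.head l.tail
      map_add' := fun _ _ => rfl
      map_smul' := fun _ _ => rfl }
  shift _ _ := rfl

/-- The strands of `X`, and to their right the strands of `Y`. -/
noncomputable def tensor (X : StrandMap ι) (Y : StrandMap κ) : StrandMap (ι × κ) where
  size := X.size + Y.size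
  toFun := X.toFun ∘ₗ LinearMap.pi fun a =>
    Y.toFun ∘ₗ LinearMap.funLeft RationalFunctions KauffmanSpace (Prod.mk a)
  shift A z := by
    rw [under_pow_add]
    refine (X.shift _ _).trans (congrArg X.toFun ?_)
    funext a
    exact Y.shift _ _

theorem tensor_apply (X : StrandMap ι) (Y : StrandMap κ) (z : ι × κ → KauffmanSpace) :
    X.tensor Y z = X fun a => Y fun b => z (a, b) := rfl

/-- Precompose with a linear map. -/
noncomputable def comp (X : StrandMap ι) (f : Matrix ι κ RationalFunctions) : StrandMap κ where
  size := X.size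
  toFun := X.toFun ∘ₗ LinearMap.pi fun a => ∑ b, f a b • LinearMap.proj b
  shift A z := by
    refine (X.shift _ _).trans (congrArg X.toFun ?_)
    funext a
    simp [_root_.map_sum]

theorem comp_apply (X : StrandMap ι) (f : Matrix ι κ RationalFunctions) (z : κ → KauffmanSpace) :
    X.comp f z = X fun a => ∑ b, f a b • z b := by
  refine congrArg X.toFun ?_
  funext a
  simp

end StrandMap

/-- The same slice with `k` more strands to its left. -/
def Slice.shiftBy (k : ℕ) : Slice → Slice
  | cup i => cup (k + i)
  | cap i => cap (k + i)
  | cross i b => cross (k + i) b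

theorem kauffmanWord_shiftBy {R : Type*} [CommRing R] (t : Rˣ) (k : ℕ) (w : List Slice) :
    kauffmanWord t (w.map (Slice.shiftBy k)) = (under ^ k) (kauffmanWord t w) := by
  induction w with
  | nil => exact (map_one _).symm
  | cons s w ih =>
    rw [List.map_cons, kauffmanWord, ih, kauffmanWord, map_mul]
    congr 1
    cases s <;> exact under_pow_add _ _ _

/-- The crossings of `p` strands on the left with `r` strands on the right. -/
def crossBlock (p r : ℕ) (s : Bool) : List Slice :=
  (List.range p).reverse.flatMap fun k => (List.range r).map fun l => .cross (k + l) s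

/-- The left strands cross one after the other, beginning with the rightmost one, so the block of
the right-hand `p'` strands comes first. -/
theorem crossBlock_add_left (p p' r : ℕ) (s : Bool) :
    crossBlock (p + p') r s =
      (crossBlock p' r s).map (Slice.shiftBy p) ++ crossBlock p r s := by
  simp [crossBlock, List.range_add, List.flatMap_map, List.map_flatMap, ← List.map_reverse,
    Function.comp_def, Slice.shiftBy, add_assoc]

theorem crossBlock_one_add (r r' : ℕ) (s : Bool) :
    crossBlock 1 (r + r') s =
      crossBlock 1 r s ++ (crossBlock 1 r' s).map (Slice.shiftBy r) := by
  simp [crossBlock, List.range_add, Function.comp_def, Slice.shiftBy]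

/-! ### Bundles of strands whose crossings realize the braiding -/

section Crosses

variable {ι κ π : Type} [Fintype ι] [DecidableEq ι] [Fintype κ] [DecidableEq κ]
  [Fintype π] [DecidableEq π]

/-- The crossings of the strands of `X` with those of `Y` realize the crossing of the modules. -/
def Crosses (M : WeightModule ι) (X : StrandMap ι) (N : WeightModule κ) (Y : StrandMap κ) :
    Prop :=
  ∀ (s : Bool) (z : ι → κ → KauffmanSpace),
    kauffmanWord tUnit (crossBlock X.size Y.size s) (X fun a => Y fun b => z a b) =
      Y fun c => X fun e => ∑ a, ∑ b, braid s M N a b c e • z a b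

theorem crosses_unit_left {M : WeightModule (Fin 1)} (hE : M.E = 0) (hF : M.F = 0)
    (hh : ∀ a, M.h a = 0) (N : WeightModule κ) (Y : StrandMap κ) :
    Crosses M .unit N Y := by
  intro s z
  simp only [braid_trivial_left hE hF hh]
  refine congrArg Y.toFun ?_
  funext c
  simp [ite_and, StrandMap.unit]

theorem crosses_unit_right {N : WeightModule (Fin 1)} (hE : N.E = 0) (hF : N.F = 0)
    (hh : ∀ a, N.h a = 0) (M : WeightModule ι) (X : StrandMap ι) :
    Crosses M X N .unit := by
  intro s z
  simp only [braid_trivial_right hE hF hh]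
  have : crossBlock X.size (StrandMap.unit).size s = [] := by
    simp [crossBlock, StrandMap.unit]
  rw [this]
  refine congrArg X.toFun ?_
  funext c
  simp [ite_and, StrandMap.unit]

theorem crosses_leaf_leaf : Crosses (irrep 1) .leaf (irrep 1) .leaf := by
  intro s z
  funext l
  change kauffmanOp tUnit (.cross 0 s) (StrandMap.leaf fun a => StrandMap.leaf fun b => z a b) l = _
  rw [kauffmanOp_cross_zero_apply]
  simp only [StrandMap.leaf, LinearMap.coe_mk, AddHom.coe_mk, Finset.sum_apply, Pi.smul_apply,
    smul_eq_mul, braid_irrep_one, add_mul, Finset.sum_add_distrib, Stream'.head_cons,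
    Stream'.tail_cons, Finset.mul_sum]
  congr 1
  · simp [ite_and]
  · exact Finset.sum_congr rfl fun a _ => Finset.sum_congr rfl fun b _ => by ring

theorem Crosses.tensor_left {M : WeightModule ι} {X : StrandMap ι} {M' : WeightModule κ}
    {X' : StrandMap κ} {N : WeightModule π} {Y : StrandMap π} (hM : M.IsGraded)
    (hM' : M'.IsGraded) (hN : N.IsGraded) (h : Crosses M X N Y) (h' : Crosses M' X' N Y) :
    Crosses (M.tensor M') (X.tensor X') N Y := by
  intro s z
  have e : crossBlock (X.tensor X').size Y.size s = _ := crossBlock_add_left X.size X'.size _ s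
  rw [e, kauffmanWord_append, kauffmanWord_shiftBy, Module.End.mul_apply]
  simp only [StrandMap.tensor_apply]
  rw [X.shift]
  simp only [h' s]
  rw [h s]
  simp only [← StrandMap.map_smul, ← StrandMap.map_sum]
  congr 1
  funext c
  congr 1
  funext e
  congr 1
  funext e'
  simp only [braid_tensor_left hM hM' hN, Fintype.sum_prod_type, Finset.smul_sum, smul_smul,
    Finset.sum_smul]
  refine Finset.sum_congr rfl fun a _ => ?_
  rw [Finset.sum_comm]
  refine Finset.sum_congr rfl fun a' _ => ?_
  rw [Finset.sum_comm]
  exact Finset.sum_congr rfl fun b _ => Finset.sum_congr rfl fun x _ => by rw [mul_comm]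

/-- Only for a single left strand does the word of crossings split literally along the right bundle.
For larger left bundles the general case is recovered from `Crosses.tensor_left`. -/
theorem Crosses.leaf_tensor {N : WeightModule κ} {Y : StrandMap κ} {N' : WeightModule π}
    {Y' : StrandMap π} (hN : N.IsGraded) (hN' : N'.IsGraded)
    (h : Crosses (irrep 1) .leaf N Y) (h' : Crosses (irrep 1) .leaf N' Y') :
    Crosses (irrep 1) .leaf (N.tensor N') (Y.tensor Y') := by
  intro s z
  have e : crossBlock 1 (Y.tensor Y').size s = _ := crossBlock_one_add Y.size Y'.size s
  change kauffmanWord tUnit (crossBlock 1 _ s) _ = _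
  rw [e, kauffmanWord_append, kauffmanWord_shiftBy, Module.End.mul_apply]
  simp only [StrandMap.tensor_apply]
  have h1 := h s fun a b => Y' fun b' => z a (b, b')
  rw [show StrandMap.leaf.size = 1 from rfl] at h1
  rw [h1, Y.shift]
  simp only [← StrandMap.map_smul, ← StrandMap.map_sum]
  congr 1
  funext c
  have h2 := h' s fun x b' => ∑ a, ∑ b, braid s (irrep 1) N a b c x • z a (b, b')
  rw [show StrandMap.leaf.size = 1 from rfl] at h2
  rw [h2]
  congr 1
  funext c'
  congr 1
  funext e
  simp only [braid_tensor_right (isGraded_irrep 1) hN hN', Fintype.sum_prod_type, Finset.smul_sum,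
    smul_smul, Finset.sum_smul]
  rw [Finset.sum_congr rfl fun _ _ => Finset.sum_comm, Finset.sum_comm]
  refine Finset.sum_congr rfl fun a _ => ?_
  rw [Finset.sum_congr rfl fun _ _ => Finset.sum_comm, Finset.sum_comm]
  refine Finset.sum_congr rfl fun b _ => ?_
  rw [Finset.sum_comm]
  exact Finset.sum_congr rfl fun b' _ => Finset.sum_congr rfl fun x _ => by rw [mul_comm]

/-- Naturality of the braiding lets a homomorphism be pushed through the crossing, so a bundle may
be reinterpreted as carrying another module. This brings in the duals. -/
theorem Crosses.comp_left {M : WeightModule ι} {X : StrandMap ι} {M' : WeightModule κ}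
    {N : WeightModule π} {Y : StrandMap π} {f : Matrix ι κ RationalFunctions} (hM : M.IsGraded)
    (hM' : M'.IsGraded) (hN : N.IsGraded) (hf : M'.IsHom M f) (h : Crosses M X N Y) :
    Crosses M' (X.comp f) N Y := by
  intro s z
  simp only [StrandMap.comp_apply]
  have e : ∀ a, (∑ a', f a a' • Y fun b => z a' b) = Y fun b => ∑ a', f a a' • z a' b := by
    intro a
    simp only [← StrandMap.map_smul, ← StrandMap.map_sum]
  simp only [e]
  refine (h s _).trans ?_
  congr 1
  funext c
  congr 1
  funext e
  have key := fun a b => sum_braid_of_isHom hM' hM hN hN hf (isHom_one N) s a b c e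
  simp only [Matrix.one_apply, mul_ite, ite_mul, mul_one, one_mul, mul_zero, zero_mul,
    Finset.sum_ite_eq, Finset.sum_ite_eq', Finset.mem_univ, if_true, Finset.sum_ite_irrel,
    Finset.sum_const_zero] at key
  simp only [Finset.smul_sum, smul_smul]
  calc _ = ∑ a', ∑ b, (∑ a, braid s M N a b c e * f a a') • z a' b := ?_
    _ = _ := ?_
  · simp only [Finset.sum_smul]
    rw [Finset.sum_congr rfl fun _ _ => Finset.sum_comm, Finset.sum_comm]
    exact Finset.sum_congr rfl fun a' _ => Finset.sum_comm
  · simp only [key, Finset.sum_smul]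
    rw [Finset.sum_congr rfl fun _ _ => Finset.sum_comm, Finset.sum_comm]

theorem Crosses.comp_right {M : WeightModule ι} {X : StrandMap ι} {N : WeightModule κ}
    {N' : WeightModule π} {Y : StrandMap κ} {f : Matrix κ π RationalFunctions} (hM : M.IsGraded)
    (hN : N.IsGraded) (hN' : N'.IsGraded) (hf : N'.IsHom N f) (h : Crosses M X N Y) :
    Crosses M X N' (Y.comp f) := by
  intro s z
  simp only [StrandMap.comp_apply]
  refine (h s _).trans ?_
  simp only [← StrandMap.map_smul, ← StrandMap.map_sum]
  congr 1
  funext c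
  congr 1
  funext e
  have key := fun a b => sum_braid_of_isHom hM hM hN' hN (isHom_one M) hf s a b c e
  simp only [Matrix.one_apply, mul_ite, ite_mul, one_mul, mul_zero, zero_mul,
    Finset.sum_ite_eq, Finset.sum_ite_eq', Finset.mem_univ, if_true, Finset.sum_ite_irrel,
    Finset.sum_const_zero] at key
  simp only [Finset.smul_sum, smul_smul]
  calc _ = ∑ a, ∑ b, (∑ b', braid s M N a b' c e * f b' b) • z a b := ?_
    _ = _ := ?_
  · simp only [Finset.sum_smul]
    exact Finset.sum_congr rfl fun a _ => Finset.sum_comm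
  · simp only [key, Finset.sum_smul]
    rw [Finset.sum_congr rfl fun _ _ => Finset.sum_comm, Finset.sum_comm]

/-- The strands of `X` realize the braidings of the module `M`. -/
structure IsBraided (M : WeightModule ι) (X : StrandMap ι) : Prop where
  graded : M.IsGraded
  leaf : Crosses (irrep 1) .leaf M X
  crosses : ∀ {κ : Type} [Fintype κ] [DecidableEq κ] {N : WeightModule κ} {Y : StrandMap κ},
    N.IsGraded → Crosses (irrep 1) .leaf N Y → Crosses M X N Y

/-- The field `crosses` is conditional: whatever a single strand crosses correctly is crossed
correctly by the bundle. In this form the property passes to tensor products by splitting only the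
left bundle, while `leaf` takes care of the right one. -/
theorem IsBraided.tensor {M : WeightModule ι} {X : StrandMap ι} {N : WeightModule κ}
    {Y : StrandMap κ} (hX : IsBraided M X) (hY : IsBraided N Y) :
    IsBraided (M.tensor N) (X.tensor Y) where
  graded := hX.graded.tensor hY.graded
  leaf := hX.leaf.leaf_tensor hX.graded hY.graded hY.leaf
  crosses hN h := (hX.crosses hN h).tensor_left hX.graded hY.graded hN (hY.crosses hN h)

theorem IsBraided.comp {M : WeightModule ι} {X : StrandMap ι} {N : WeightModule κ}
    {f : Matrix ι κ RationalFunctions} (hX : IsBraided M X) (hN : N.IsGraded)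
    (hf : N.IsHom M f) : IsBraided N (X.comp f) where
  graded := hN
  leaf := hX.leaf.comp_right (isGraded_irrep 1) hX.graded hN hf
  crosses hN' h := (hX.crosses hN' h).comp_left hX.graded hN hN' hf

theorem isBraided_leaf : IsBraided (irrep 1) .leaf where
  graded := isGraded_irrep 1
  leaf := crosses_leaf_leaf
  crosses _ h := h

theorem isBraided_unit {M : WeightModule (Fin 1)} (hE : M.E = 0) (hF : M.F = 0)
    (hh : ∀ a, M.h a = 0) : IsBraided M .unit where
  graded := ⟨fun b a h => by simp [hE] at h, fun b a h => by simp [hF] at h⟩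
  leaf := crosses_unit_right hE hF hh _ _
  crosses _ _ := crosses_unit_left hE hF hh _ _

end Crosses

end FramedSkein

namespace FramedSkein

open WeightModule

variable {ι : Type} [Fintype ι] [DecidableEq ι]

/-! ### Cables -/

theorem StrandMap.leaf_apply_apply (z : Fin 2 → Fin 2 → KauffmanSpace) (l : Stream' (Fin 2)) :
    StrandMap.leaf (fun a => StrandMap.leaf fun b => z a b) l = z l.head l.tail.head l.tail.tail :=
  rfl

theorem kauffmanOp_cup_zero (y : KauffmanSpace) :
    kauffmanOp tUnit (.cup 0) y =
      StrandMap.leaf fun a => StrandMap.leaf fun b => kauffmanCup tUnit a b • y := by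
  funext l
  rfl

theorem kauffmanOp_cap_zero (z : Fin 2 → Fin 2 → KauffmanSpace) :
    kauffmanOp tUnit (.cap 0) (StrandMap.leaf fun a => StrandMap.leaf fun b => z a b) =
      ∑ a, ∑ b, kauffmanCap tUnit a b • z a b := by
  funext l
  rw [kauffmanOp_cap_zero_apply]
  simp only [StrandMap.leaf_apply_apply, Finset.sum_apply]
  rfl

theorem cableSlice_raise (m : ℕ) (s : OrientedSlice) :
    cableSlice m s.raise.forget = (cableSlice m s.forget).map (Slice.shiftBy m) := by
  cases s <;> simp [cableSlice, OrientedSlice.raise, OrientedSlice.forget, Slice.shiftBy,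
    Function.comp_def, List.map_flatMap] <;> ring_nf <;> simp

theorem cableSlice_cross_zero (m : ℕ) (s : Bool) :
    cableSlice m (.cross 0 s) = crossBlock m m s := by
  simp [cableSlice, crossBlock]

theorem kauffmanOp_shiftBy {R : Type*} [CommRing R] (t : Rˣ) (k : ℕ) (s : Slice) :
    kauffmanOp t (s.shiftBy k) = (under ^ k) (kauffmanOp t s) := by
  cases s <;> exact under_pow_add _ _ _

/-- Nested arcs can be peeled at the innermost or at the outermost arc, and both are needed: with
the left bundle directed upwards, the strand added by `cableStep` belongs to the innermost arc;
otherwise to the outermost. -/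
theorem cableSlice_cup_inner (m : ℕ) :
    cableSlice (m + 1) (.cup 0) = cableSlice m (.cup 0) ++ [Slice.shiftBy m (.cup 0)] := by
  simp [cableSlice, List.range_succ, Slice.shiftBy]

theorem cableSlice_cup_outer (m : ℕ) :
    cableSlice (m + 1) (.cup 0) =
      Slice.cup 0 :: (cableSlice m (.cup 0)).map (Slice.shiftBy 1) := by
  simp [cableSlice, List.range_succ_eq_map, Slice.shiftBy, Function.comp_def, add_comm]

theorem cableSlice_cap_inner (m : ℕ) :
    cableSlice (m + 1) (.cap 0) = Slice.shiftBy m (.cap 0) :: cableSlice m (.cap 0) := by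
  simp [cableSlice, List.range_succ, Slice.shiftBy]

theorem cableSlice_cap_outer (m : ℕ) :
    cableSlice (m + 1) (.cap 0) =
      (cableSlice m (.cap 0)).map (Slice.shiftBy 1) ++ [Slice.cap 0] := by
  simp [cableSlice, List.range_succ_eq_map, Slice.shiftBy, Function.comp_def, add_comm]

/-- An embedding of the module `M` in the `p`th tensor power of the two-dimensional module, such
that the `p`-fold cable of a diagram realizes the state sum with the module `M` on the strands. -/
structure Cabled (M : WeightModule ι) (p : ℕ) (X : Bool → StrandMap ι) : Prop where
  size : ∀ d, (X d).size = p
  braided : ∀ d, IsBraided (M.strand d) (X d)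
  cup : ∀ d y, kauffmanWord tUnit (cableSlice p (.cup 0)) y =
    X d fun a => X (!d) fun b => (M.tensors.twist ((-1) ^ p)).cup d a b • y
  cap : ∀ d (z : ι → ι → KauffmanSpace),
    kauffmanWord tUnit (cableSlice p (.cap 0)) (X d fun a => X (!d) fun b => z a b) =
      ∑ a, ∑ b, (M.tensors.twist ((-1) ^ p)).cap d a b • z a b

theorem Cabled.realized {M : WeightModule ι} {p : ℕ} {X : Bool → StrandMap ι}
    (h : Cabled M p X) : (M.tensors.twist ((-1) ^ p)).Realized (fun d => (X d).toFun)
      fun _ s => kauffmanWord tUnit (cableSlice p s.forget) where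
  shift d u s z _ := by
    rw [cableSlice_raise, kauffmanWord_shiftBy, ← h.size d, (X d).shift]
  cup u d y := h.cup d y
  cap u d z := h.cap d z
  cross u d d' s z := by
    have := (h.braided d).crosses (h.braided d').graded (h.braided d').leaf s z
    rw [h.size, h.size, ← cableSlice_cross_zero] at this
    exact this

theorem operatorWord_cable (m : ℕ) (w : List OrientedSlice) (u : List Bool) (x : KauffmanSpace) :
    operatorWord (fun _ s => kauffmanWord tUnit (cableSlice m s.forget)) w u x =
      kauffmanWord tUnit (cableWord m (w.map OrientedSlice.forget)) x := by
  induction w generalizing u x with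
  | nil => rfl
  | cons s w ih =>
    rw [operatorWord, ih, List.map_cons, cableWord, cableWord, List.flatMap_cons,
      kauffmanWord_append]
    rfl

/-- The cabled word acts on the constant function 1 by its bracket, and also by the twisted state
sum that it realizes; the twist contributes one sign for each turn. -/
theorem Cabled.bracket_cable {M : WeightModule ι} {p : ℕ} {X : Bool → StrandMap ι}
    (h : Cabled M p X) (D : OrientedLinkDiagram) :
    algebraMap ℂ[T;T⁻¹] RationalFunctions (bracket (D.toLinkDiagram.cable p)) =
      ((-1) ^ p) ^ turns D.word [] * M.tensors.value D.word := by
  have h1 := h.realized.operatorWord_eq 1 D.closed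
  rw [operatorWord_cable, Tensors.value_twist] at h1
  have h2 := kauffmanWord_one (D.toLinkDiagram.cable p).closed
  have h3 := congrFun (h2.symm.trans h1) (Stream'.const 0)
  simpa using h3

theorem cabled_irrep_zero : Cabled (irrep 0) 0 fun _ => .unit where
  size _ := rfl
  braided d := by
    have hE : (irrep 0).E = 0 := by
      ext a b
      simp [irrep]
    have hF : (irrep 0).F = 0 := by
      ext a b
      simp [irrep]
    cases d
    · exact isBraided_unit (M := (irrep 0).dual) (by simp [dual, hE]) (by simp [dual, hF])
        fun a => by simp [dual, irrep]
    · exact isBraided_unit (M := irrep 0) hE hF fun a => by simp [irrep]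
  cup d y := by
    cases d <;> simp [cableSlice, kauffmanWord, StrandMap.unit, Tensors.twist, tensors, K, irrep]
  cap d z := by
    cases d <;> simp [cableSlice, kauffmanWord, StrandMap.unit, Tensors.twist, tensors, K, irrep]

/-- The embedding of the tensor product with the two-dimensional module. -/
noncomputable def cableStep (X : Bool → StrandMap ι) : Bool → StrandMap (ι × Fin 2)
  | true => (X true).tensor .leaf
  | false => (StrandMap.leaf.tensor (X false)).comp
      ((selfDual ⊗ₖ (1 : Matrix ι ι RationalFunctions)) * permMatrix (Equiv.prodComm ι (Fin 2)))

theorem cableStep_true_apply (X : Bool → StrandMap ι) (z : ι × Fin 2 → KauffmanSpace) :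
    cableStep X true z = X true fun a => StrandMap.leaf fun i => z (a, i) := rfl

theorem cableStep_false_apply (X : Bool → StrandMap ι) (z : ι × Fin 2 → KauffmanSpace) :
    cableStep X false z =
      StrandMap.leaf fun i => X false fun a => ∑ j, selfDual i j • z (a, j) := by
  rw [cableStep, StrandMap.comp_apply, StrandMap.tensor_apply]
  refine congrArg StrandMap.leaf.toFun (funext fun i => congrArg (X false).toFun
      (funext fun a => ?_))
  simp only [Matrix.mul_apply, permMatrix_apply, Matrix.kroneckerMap_apply, Matrix.one_apply,
    Fintype.sum_prod_type, Equiv.prodComm_apply, Prod.swap_prod_mk, Prod.mk.injEq]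
  simp [ite_and]

/-- The four identities from here on compare cups and caps of the two models for a single strand.
The minus sign occurs only at minima with left strand downwards (`kauffmanCup_eq_neg_sum`) and
maxima with left strand upwards (`sum_kauffmanCap_mul`), hence the definition of `twist`. -/
theorem kauffmanCup_eq (i i' : Fin 2) : kauffmanCup tUnit i i' = selfDual i' i := by
  fin_cases i <;> fin_cases i' <;> simp [kauffmanCup, selfDual, tUnit, qVar]

theorem kauffmanCup_eq_neg_sum (i i' : Fin 2) :
    kauffmanCup tUnit i i' = -∑ j, selfDual i j * (irrep 1).K (-1) i' j := by
  have := tVar_ne_zero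
  fin_cases i <;> fin_cases i' <;> simp [kauffmanCup, selfDual, tUnit, qVar, K, irrep, this]

theorem sum_kauffmanCap_mul (i j : Fin 2) :
    ∑ i', kauffmanCap tUnit i i' * selfDual i' j = -(irrep 1).K 1 j i := by
  have := tVar_ne_zero
  fin_cases i <;> fin_cases j <;> simp [kauffmanCap, selfDual, tUnit, qVar, K, irrep]

theorem sum_kauffmanCap_mul' (i' j : Fin 2) :
    ∑ i, kauffmanCap tUnit i i' * selfDual i j = if j = i' then 1 else 0 := by
  have := tVar_ne_zero
  fin_cases i' <;> fin_cases j <;> simp [kauffmanCap, selfDual, tUnit, qVar, this]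

theorem K_tensor {κ : Type} [Fintype κ] [DecidableEq κ] (M : WeightModule ι) (N : WeightModule κ)
    (k : ℤ) (a b : ι) (i j : κ) : (M.tensor N).K k (a, i) (b, j) = M.K k a b * N.K k i j := by
  simp only [K, tensor, Matrix.diagonal_apply, mul_add, zpow_add₀ qVar_ne_zero, Prod.mk.injEq,
    ite_and]
  split_ifs <;> simp

/-- The new strand goes to the right of an upward bundle and to the left of a downward one, so that
at a turn it meets itself. It contributes one more sign -1 to the twist. -/
theorem Cabled.step {M : WeightModule ι} {p : ℕ} {X : Bool → StrandMap ι} (h : Cabled M p X) :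
    Cabled (M.tensor (κ := Fin 2) (irrep 1)) (p + 1) (cableStep X) where
  size d := by
    cases d
    · exact (congrArg (1 + ·) (h.size false)).trans (add_comm _ _)
    · exact congrArg (· + 1) (h.size true)
  braided d := by
    have hM := (h.braided true).graded.tensor (isGraded_irrep 1)
    cases d
    -- The dual of M ⊗ V_1 is the product of the duals in reverse order, and the factor from V_1 is
    -- turned into V_1 by `selfDual`.
    · refine (isBraided_leaf.tensor (h.braided false)).comp hM.dual ?_
      exact (isHom_selfDual.tensor (isHom_one _)).comp (isHom_dual_tensor M (irrep 1))
    · exact (h.braided true).tensor isBraided_leaf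
  cup d y := by
    cases d
    · rw [cableSlice_cup_outer, kauffmanWord, kauffmanWord_shiftBy, Module.End.mul_apply,
        kauffmanOp_cup_zero]
      refine (StrandMap.leaf.shift _ _).trans ?_
      rw [cableStep_false_apply]
      refine congrArg StrandMap.leaf.toFun (funext fun i => ?_)
      rw [h.cup false]
      refine congrArg (X false).toFun (funext fun a => ?_)
      simp only [Bool.not_false, cableStep_true_apply]
      simp only [← StrandMap.map_smul, ← StrandMap.map_sum]
      refine congrArg (X true).toFun (funext fun b => ?_)
      refine congrArg StrandMap.leaf.toFun (funext fun i' => ?_)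
      simp only [smul_smul, ← Finset.sum_smul]
      congr 1
      simp only [Tensors.twist, tensors, K_tensor, kauffmanCup_eq_neg_sum, Bool.false_eq_true,
        if_false, pow_succ, mul_neg, Finset.mul_sum, ← Finset.sum_neg_distrib]
      exact Finset.sum_congr rfl fun j _ => by ring
    · rw [cableSlice_cup_inner, kauffmanWord_append, Module.End.mul_apply, h.cup]
      simp only [kauffmanWord, one_mul, kauffmanOp_shiftBy]
      conv_lhs => rw [← h.size true, (X true).shift]
      rw [cableStep_true_apply]
      refine congrArg (X true).toFun (funext fun a => ?_)
      rw [kauffmanOp_cup_zero]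
      refine congrArg StrandMap.leaf.toFun (funext fun i => ?_)
      rw [Bool.not_true, cableStep_false_apply]
      refine congrArg StrandMap.leaf.toFun (funext fun i' => ?_)
      rw [← StrandMap.map_smul]
      refine congrArg (X false).toFun (funext fun b => ?_)
      simp only [smul_smul, ← Finset.sum_smul]
      congr 1
      by_cases hab : a = b <;>
        simp [Tensors.twist, tensors, kauffmanCup_eq, hab]
  cap d z := by
    cases d
    · rw [cableSlice_cap_outer, kauffmanWord_append, Module.End.mul_apply, kauffmanWord_shiftBy,
        cableStep_false_apply, Bool.not_false]
      -- The outermost maximum comes last in the word. Before it, the `p` inner maxima act to the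
      -- right of the leftmost strand, which stays in the state `i`.
      have e : ∀ i, kauffmanWord tUnit (cableSlice p (.cap 0)) (X false fun a => ∑ j,
          selfDual i j • cableStep X true fun y => z (a, j) y) =
          StrandMap.leaf fun i' => ∑ a, ∑ j, selfDual i j • z (a, j) (a, i') := by
        intro i
        simp only [cableStep_true_apply, ← StrandMap.map_smul, ← StrandMap.map_sum]
        rw [← Bool.not_false, h.cap false]
        simp only [← StrandMap.map_smul, ← StrandMap.map_sum]
        refine congrArg StrandMap.leaf.toFun (funext fun i' => ?_)
        simp only [Tensors.twist, tensors, Bool.false_eq_true, if_false, ite_smul, one_smul,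
          zero_smul, Finset.sum_ite_eq, Finset.mem_univ, if_true]
      have e2 := StrandMap.leaf.shift (kauffmanWord tUnit (cableSlice p (.cap 0)))
        fun i => X false fun a => ∑ j, selfDual i j • cableStep X true fun y => z (a, j) y
      simp only [e] at e2
      refine (congrArg (kauffmanWord tUnit [.cap 0]) e2).trans ?_
      rw [kauffmanWord, kauffmanWord, one_mul, kauffmanOp_cap_zero]
      simp only [Fintype.sum_prod_type, Tensors.twist, tensors, Bool.false_eq_true, if_false,
        ite_smul, one_smul, zero_smul, Finset.sum_ite_eq, Finset.mem_univ, if_true, Finset.smul_sum,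
        smul_smul]
      rw [Finset.sum_congr rfl fun _ _ => Finset.sum_comm, Finset.sum_comm]
      refine Finset.sum_congr rfl fun a _ => ?_
      rw [Finset.sum_congr rfl fun _ _ => Finset.sum_comm, Finset.sum_comm]
      refine Finset.sum_congr rfl fun j _ => ?_
      rw [Finset.sum_comm]
      simp only [← Finset.sum_smul, sum_kauffmanCap_mul', ite_smul, one_smul, zero_smul,
        Finset.sum_ite_eq, Finset.mem_univ, if_true]
    · rw [cableSlice_cap_inner, kauffmanWord, kauffmanOp_shiftBy, Module.End.mul_apply,
        cableStep_true_apply, Bool.not_true]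
      conv_lhs => rw [← h.size true, (X true).shift]
      simp only [cableStep_false_apply, kauffmanOp_cap_zero]
      simp only [← StrandMap.map_smul, ← StrandMap.map_sum]
      rw [h.size true, ← Bool.not_true, h.cap true]
      simp only [Fintype.sum_prod_type, Tensors.twist, tensors, if_true, K_tensor,
        Finset.smul_sum, smul_smul]
      refine Finset.sum_congr rfl fun a _ => ?_
      rw [Finset.sum_comm]
      refine Finset.sum_congr rfl fun i _ => Finset.sum_congr rfl fun b _ => ?_
      rw [Finset.sum_comm]
      refine Finset.sum_congr rfl fun j _ => ?_
      rw [← Finset.sum_smul, ← Finset.mul_sum, sum_kauffmanCap_mul]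
      congr 1
      ring

end FramedSkein

namespace FramedSkein

namespace WeightModule

variable {ι κ π : Type} [Fintype ι] [DecidableEq ι] [Fintype κ] [DecidableEq κ]
  [Fintype π] [DecidableEq π]

/-! ### State sums of direct sums -/

/-- An isomorphism of modules acts on upward strands by itself and on downward strands by its
contragredient, the transposed inverse. Isomorphic modules therefore have equal state sums. -/
theorem isHom_tensors {M : WeightModule ι} {N : WeightModule κ} (hM : M.IsGraded)
    (hN : N.IsGraded) {f : Matrix κ ι RationalFunctions} {f' : Matrix ι κ RationalFunctions}
    (hf : M.IsHom N f) (hf' : N.IsHom M f') (h : f * f' = 1) (h' : f' * f = 1) :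
    M.tensors.IsHom N.tensors fun d => if d then f else f'.transpose where
  cup d a b := by
    cases d
    · have := congrFun (congrFun (show f * M.K (-1) * f' = N.K (-1) by
        rw [hf.K, Matrix.mul_assoc, h, Matrix.mul_one]) b) a
      simp only [tensors, Bool.not_false, Bool.false_eq_true, if_false, if_true,
        Matrix.transpose_apply]
      rw [← this, Matrix.mul_apply]
      refine Finset.sum_congr rfl fun x _ => ?_
      rw [Matrix.mul_apply, Finset.sum_mul]
      exact Finset.sum_congr rfl fun y _ => by ring
    · have := congrFun (congrFun h a) b
      rw [Matrix.mul_apply, Matrix.one_apply] at this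
      simp [tensors, ← this]
  cap d a b := by
    cases d
    · have := congrFun (congrFun h' a) b
      rw [Matrix.mul_apply, Matrix.one_apply] at this
      simp [tensors, ← this]
    · have := congrFun (congrFun (show f' * N.K 1 * f = M.K 1 by
        rw [hf'.K, Matrix.mul_assoc, h', Matrix.mul_one]) b) a
      simp only [tensors, Bool.not_true, Bool.false_eq_true, if_false, if_true,
        Matrix.transpose_apply]
      rw [← this, Matrix.mul_apply]
      refine Finset.sum_congr rfl fun x _ => ?_
      rw [Matrix.mul_apply, Finset.sum_mul]
      exact Finset.sum_congr rfl fun y _ => by ring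
  cross s d d' a b c e := by
    have hs : ∀ d : Bool, (M.strand d).IsHom (N.strand d) (if d then f else f'.transpose) := by
      intro d
      cases d
      · exact hf'.dual
      · exact hf
    exact sum_braid_of_isHom (hM.strand d) (hN.strand d) (hM.strand d') (hN.strand d') (hs d)
      (hs d') s a b c e

/-- The matrix of a map of the bases. -/
noncomputable def baseMatrix (j : κ → ι) : Matrix ι κ RationalFunctions :=
  Matrix.of fun x a => if x = j a then 1 else 0

theorem isHom_strand {M : WeightModule ι} {N : WeightModule κ}
    {f : Matrix κ ι RationalFunctions} (hf : M.IsHom N f) (hf' : N.IsHom M f.transpose)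
    (d : Bool) : (M.strand d).IsHom (N.strand d) f := by
  cases d
  · exact hf'.dual
  · exact hf

/-- When part of the basis of `M` spans a direct summand `N`, both the inclusion of bases and its
transpose are homomorphisms, so the inclusion intertwines the state sum of `N` with that of `M`
restricted to these states, on upward and downward strands alike. -/
theorem value_restrict [Nonempty ι] {M : WeightModule ι} {N : WeightModule κ} (hM : M.IsGraded)
    (hN : N.IsGraded) {j : κ → ι} (hj : Function.Injective j)
    (h : N.IsHom M (baseMatrix j)) (h' : M.IsHom N (baseMatrix j).transpose) {col : ι → Bool}
    {k : Bool} (hcol : ∀ x, col x = k ↔ ∃ a, x = j a) {w : List OrientedSlice}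
    (hw : IsOrientedClosed w []) :
    (M.tensors.restrict col k).value w = N.tensors.value w := by
  have hK : ∀ (l : ℤ) (a b : κ), M.K l (j a) (j b) = N.K l a b := by
    intro l a b
    have := congrFun (congrFun (h.K l) (j a)) b
    simpa [Matrix.mul_apply, baseMatrix, hj.eq_iff] using this.symm
  have hg : N.tensors.IsHom (M.tensors.restrict col k) fun _ => baseMatrix j := by
    refine ⟨fun d x y => ?_, fun d a b => ?_, fun s d d' a b c e => ?_⟩
    · simp only [Tensors.restrict, hcol]
      split_ifs with hxy
      · obtain ⟨⟨a, rfl⟩, ⟨b, rfl⟩⟩ := hxy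
        cases d <;> simp [tensors, baseMatrix, hj.eq_iff, hK]
      · symm
        refine Finset.sum_eq_zero fun a _ => Finset.sum_eq_zero fun b _ => ?_
        simp only [baseMatrix, Matrix.of_apply]
        split_ifs with h1 h2
        · exact absurd ⟨⟨a, h1⟩, ⟨b, h2⟩⟩ hxy
        · simp
        · simp
        · simp
    · have h1 : col (j a) = k := (hcol _).2 ⟨a, rfl⟩
      have h2 : col (j b) = k := (hcol _).2 ⟨b, rfl⟩
      cases d <;> simp [Tensors.restrict, tensors, baseMatrix, hj.eq_iff, hK, h1, h2]
    · have key := sum_braid_of_isHom (hN.strand d) (hM.strand d) (hN.strand d') (hM.strand d')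
        (isHom_strand h h' d) (isHom_strand h h' d') s a b c e
      by_cases hce : col c = k ∧ col e = k
      · refine Eq.trans ?_ key
        refine Finset.sum_congr rfl fun x _ => Finset.sum_congr rfl fun y _ => ?_
        by_cases hxy : col x = k ∧ col y = k
        · simp [Tensors.restrict, tensors, hce, hxy]
        · have : baseMatrix j x a * baseMatrix j y b = 0 := by
            simp only [baseMatrix, Matrix.of_apply]
            split_ifs with h1 h2
            · exact absurd ⟨(hcol x).2 ⟨a, h1⟩, (hcol y).2 ⟨b, h2⟩⟩ hxy
            · simp
            · simp
            · simp
          rw [this, mul_zero, mul_zero]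
      · simp only [Tensors.restrict, hce, and_false, if_false, zero_mul, Finset.sum_const_zero]
        symm
        refine Finset.sum_eq_zero fun x _ => Finset.sum_eq_zero fun y _ => ?_
        simp only [baseMatrix, Matrix.of_apply]
        split_ifs with h1 h2
        · exact absurd ⟨(hcol c).2 ⟨x, h1⟩, (hcol e).2 ⟨y, h2⟩⟩ hce
        · simp
        · simp
        · simp
  exact (hg.value_eq hw).symm

/-- The direct sum of weight modules. -/
noncomputable def directSum (M : WeightModule ι) (N : WeightModule κ) : WeightModule (ι ⊕ κ) where
  E := Matrix.fromBlocks M.E 0 0 N.E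
  F := Matrix.fromBlocks M.F 0 0 N.F
  h := Sum.elim M.h N.h

theorem IsGraded.directSum {M : WeightModule ι} {N : WeightModule κ} (hM : M.IsGraded)
    (hN : N.IsGraded) : (M.directSum N).IsGraded where
  E := by
    rintro (b | b) (a | a) h
    · exact hM.E b a h
    · exact absurd rfl h
    · exact absurd rfl h
    · exact hN.E b a h
  F := by
    rintro (b | b) (a | a) h
    · exact hM.F b a h
    · exact absurd rfl h
    · exact absurd rfl h
    · exact hN.F b a h

theorem isHom_inl (M : WeightModule ι) (N : WeightModule κ) :
    M.IsHom (M.directSum N) (baseMatrix Sum.inl) where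
  E := by ext (b | b) a <;> simp [Matrix.mul_apply, baseMatrix, directSum]
  F := by ext (b | b) a <;> simp [Matrix.mul_apply, baseMatrix, directSum]
  h := by rintro (b | b) a h <;> simp [baseMatrix, directSum] at h ⊢; rw [h]

theorem isHom_inr (M : WeightModule ι) (N : WeightModule κ) :
    N.IsHom (M.directSum N) (baseMatrix Sum.inr) where
  E := by ext (b | b) a <;> simp [Matrix.mul_apply, baseMatrix, directSum]
  F := by ext (b | b) a <;> simp [Matrix.mul_apply, baseMatrix, directSum]
  h := by rintro (b | b) a h <;> simp [baseMatrix, directSum] at h ⊢; rw [h]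

theorem isHom_transpose_inl (M : WeightModule ι) (N : WeightModule κ) :
    (M.directSum N).IsHom M (baseMatrix Sum.inl).transpose where
  E := by ext b (a | a) <;> simp [Matrix.mul_apply, baseMatrix, directSum]
  F := by ext b (a | a) <;> simp [Matrix.mul_apply, baseMatrix, directSum]
  h := by rintro b (a | a) h <;> simp [baseMatrix, directSum] at h ⊢; rw [h]

theorem isHom_transpose_inr (M : WeightModule ι) (N : WeightModule κ) :
    (M.directSum N).IsHom N (baseMatrix Sum.inr).transpose where
  E := by ext b (a | a) <;> simp [Matrix.mul_apply, baseMatrix, directSum]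
  F := by ext b (a | a) <;> simp [Matrix.mul_apply, baseMatrix, directSum]
  h := by rintro b (a | a) h <;> simp [baseMatrix, directSum] at h ⊢; rw [h]

theorem isHom_projection (M : WeightModule ι) (N : WeightModule κ) (k : Bool) :
    (M.directSum N).IsHom (M.directSum N)
      (Matrix.diagonal fun x => if Sum.isLeft x = k then 1 else 0) where
  E := by
    ext b a
    rw [Matrix.diagonal_mul, Matrix.mul_diagonal]
    cases a <;> cases b <;> cases k <;> simp [directSum]
  F := by
    ext b a
    rw [Matrix.diagonal_mul, Matrix.mul_diagonal]
    cases a <;> cases b <;> cases k <;> simp [directSum]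
  h b a h := by
    by_cases hba : b = a
    · rw [hba]
    · exact absurd (Matrix.diagonal_apply_ne _ hba) h

/-- The braiding is natural with respect to the projections to the summands, so each strand keeps
its summand through a crossing. Cups and caps are diagonal in the chosen bases. -/
theorem tensors_directSum_respects {M : WeightModule ι} {N : WeightModule κ} (hM : M.IsGraded)
    (hN : N.IsGraded) : (M.directSum N).tensors.Respects Sum.isLeft where
  cup d a b h := by
    have hab : a ≠ b := fun hab => h (by rw [hab])
    cases d
    · exact K_apply_ne _ _ hab.symm
    · exact if_neg hab
  cap d a b h := by
    have hab : a ≠ b := fun hab => h (by rw [hab])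
    cases d
    · exact if_neg hab
    · exact K_apply_ne _ _ hab.symm
  cross s d d' a b c e h := by
    have hS := hM.directSum hN
    have hp : ∀ d k, ((M.directSum N).strand d).IsHom _ _ := fun d k =>
      isHom_strand (isHom_projection M N k)
        (by rw [Matrix.diagonal_transpose]; exact isHom_projection M N k) d
    have := sum_braid_of_isHom (hS.strand d) (hS.strand d) (hS.strand d') (hS.strand d')
      (hp d (Sum.isLeft a)) (hp d' (Sum.isLeft b)) s a b c e
    simp only [Matrix.diagonal_apply, ite_mul, mul_ite, mul_zero, zero_mul, Finset.sum_ite_eq,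
      Finset.sum_ite_eq', Finset.mem_univ, if_true, mul_one, one_mul] at this
    change braid s _ _ a b c e = 0
    rw [this]
    split_ifs with h1 h2
    · exact absurd ⟨h2, h1⟩ h
    · simp
    · simp

/-- With the summand as colour, a knot has only the two constant colourings. A link with several
components would also have mixed terms. -/
theorem value_directSum [Nonempty ι] {M : WeightModule ι} {N : WeightModule κ} (hM : M.IsGraded)
    (hN : N.IsGraded) {w : List OrientedSlice} (hw : IsOrientedClosed w [])
    (hn : numComponents (w.map OrientedSlice.forget) = 1) :
    (M.directSum N).tensors.value w = M.tensors.value w + N.tensors.value w := by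
  have hS := hM.directSum hN
  rw [Tensors.value_eq_sum_restrict (tensors_directSum_respects hM hN) hw hn, Fintype.sum_bool,
    value_restrict hS hM Sum.inl_injective (isHom_inl M N) (isHom_transpose_inl M N) ?_ hw,
    value_restrict hS hN Sum.inr_injective (isHom_inr M N) (isHom_transpose_inr M N) ?_ hw]
  · rintro (x | x) <;> simp
  · rintro (x | x) <;> simp

/-! ### Decompositions -/

/-- The maps `i` and `p` are the inclusions and the projections of a decomposition of the module
`M` as a direct sum of `N` and `P`. -/
structure IsDirectSum (M : WeightModule ι) (N : WeightModule κ) (P : WeightModule π)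
    (i : Matrix ι κ RationalFunctions) (p : Matrix κ ι RationalFunctions)
    (i' : Matrix ι π RationalFunctions) (p' : Matrix π ι RationalFunctions) : Prop where
  hom_i : N.IsHom M i
  hom_p : M.IsHom N p
  hom_i' : P.IsHom M i'
  hom_p' : M.IsHom P p'
  p_mul_i : p * i = 1
  p_mul_i' : p * i' = 0
  p'_mul_i : p' * i = 0
  p'_mul_i' : p' * i' = 1
  add : i * p + i' * p' = 1

theorem IsDirectSum.tensor {M : WeightModule ι} {N : WeightModule κ} {P : WeightModule π}
    {i : Matrix ι κ RationalFunctions} {p : Matrix κ ι RationalFunctions}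
    {i' : Matrix ι π RationalFunctions} {p' : Matrix π ι RationalFunctions}
    (h : IsDirectSum M N P i p i' p') {κ' : Type} [Fintype κ'] [DecidableEq κ']
    (Q : WeightModule κ') :
    IsDirectSum (M.tensor Q) (N.tensor Q) (P.tensor Q) (i ⊗ₖ (1 : Matrix κ' κ' RationalFunctions))
      (p ⊗ₖ (1 : Matrix κ' κ' RationalFunctions)) (i' ⊗ₖ (1 : Matrix κ' κ' RationalFunctions))
      (p' ⊗ₖ (1 : Matrix κ' κ' RationalFunctions)) where
  hom_i := h.hom_i.tensor (isHom_one Q)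
  hom_p := h.hom_p.tensor (isHom_one Q)
  hom_i' := h.hom_i'.tensor (isHom_one Q)
  hom_p' := h.hom_p'.tensor (isHom_one Q)
  p_mul_i := by rw [← Matrix.mul_kronecker_mul, h.p_mul_i, Matrix.one_mul, Matrix.one_kronecker_one]
  p_mul_i' := by rw [← Matrix.mul_kronecker_mul, h.p_mul_i', Matrix.zero_kronecker]
  p'_mul_i := by rw [← Matrix.mul_kronecker_mul, h.p'_mul_i, Matrix.zero_kronecker]
  p'_mul_i' := by
    rw [← Matrix.mul_kronecker_mul, h.p'_mul_i', Matrix.one_mul, Matrix.one_kronecker_one]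
  add := by
    rw [← Matrix.mul_kronecker_mul, ← Matrix.mul_kronecker_mul, ← Matrix.add_kronecker, h.add,
      Matrix.one_mul, Matrix.one_kronecker_one]

theorem isHom_fromRows {M : WeightModule ι} {N : WeightModule κ} {P : WeightModule π}
    {p : Matrix κ ι RationalFunctions} {p' : Matrix π ι RationalFunctions}
    (h : M.IsHom N p) (h' : M.IsHom P p') :
    M.IsHom (N.directSum P) (Matrix.fromRows p p') where
  E := by simp [directSum, Matrix.fromRows_mul, Matrix.fromBlocks_mul_fromRows, h.E, h'.E]
  F := by simp [directSum, Matrix.fromRows_mul, Matrix.fromBlocks_mul_fromRows, h.F, h'.F]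
  h := by
    rintro (b | b) a hb
    · exact h.h b a hb
    · exact h'.h b a hb

theorem isHom_fromCols {M : WeightModule ι} {N : WeightModule κ} {P : WeightModule π}
    {i : Matrix ι κ RationalFunctions} {i' : Matrix ι π RationalFunctions}
    (h : N.IsHom M i) (h' : P.IsHom M i') :
    (N.directSum P).IsHom M (Matrix.fromCols i i') where
  E := by simp [directSum, Matrix.mul_fromCols, Matrix.fromCols_mul_fromBlocks, h.E, h'.E]
  F := by simp [directSum, Matrix.mul_fromCols, Matrix.fromCols_mul_fromBlocks, h.F, h'.F]
  h := by
    rintro b (a | a) hb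
    · exact h.h b a hb
    · exact h'.h b a hb

theorem IsDirectSum.value_eq [Nonempty κ] {M : WeightModule ι} {N : WeightModule κ}
    {P : WeightModule π} {i : Matrix ι κ RationalFunctions} {p : Matrix κ ι RationalFunctions}
    {i' : Matrix ι π RationalFunctions} {p' : Matrix π ι RationalFunctions}
    (h : IsDirectSum M N P i p i' p') (hM : M.IsGraded) (hN : N.IsGraded) (hP : P.IsGraded)
    {w : List OrientedSlice} (hw : IsOrientedClosed w [])
    (hn : numComponents (w.map OrientedSlice.forget) = 1) :
    M.tensors.value w = N.tensors.value w + P.tensors.value w := by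
  rw [← value_directSum hN hP hw hn]
  refine (isHom_tensors hM (hN.directSum hP) (isHom_fromRows h.hom_p h.hom_p')
    (isHom_fromCols h.hom_i h.hom_i') ?_ ?_).value_eq hw
  · rw [Matrix.fromRows_mul_fromCols, h.p_mul_i, h.p_mul_i', h.p'_mul_i, h.p'_mul_i',
      Matrix.fromBlocks_one]
  · rw [Matrix.fromCols_mul_fromRows, h.add]

end WeightModule

end FramedSkein

namespace FramedSkein

namespace WeightModule

variable {ι κ : Type} [Fintype ι] [DecidableEq ι] [Fintype κ] [DecidableEq κ]

/-! ### Tensor products with the two-dimensional module -/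

theorem tensor_E_mul_apply_zero (M : WeightModule ι) (f : Matrix (ι × Fin 2) κ RationalFunctions)
    (a : ι) (b : κ) : ((M.tensor (κ := Fin 2) (irrep 1)).E * f) (a, 0) b =
      qVar⁻¹ * ∑ a', M.E a a' * f (a', 0) b := by
  simp [Matrix.mul_apply, Fintype.sum_prod_type, tensor, irrep, K, Matrix.one_apply,
    Finset.mul_sum]
  refine Finset.sum_congr rfl fun x _ => by ring

theorem tensor_E_mul_apply_one (M : WeightModule ι) (f : Matrix (ι × Fin 2) κ RationalFunctions)
    (a : ι) (b : κ) : ((M.tensor (κ := Fin 2) (irrep 1)).E * f) (a, 1) b =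
      qVar * (∑ a', M.E a a' * f (a', 1) b) + f (a, 0) b := by
  simp [Matrix.mul_apply, Fintype.sum_prod_type, tensor, irrep, K, Matrix.one_apply,
    Finset.mul_sum, Finset.sum_add_distrib, quantumInt_one]
  rw [add_comm]
  congr 1
  refine Finset.sum_congr rfl fun x _ => by ring

theorem tensor_F_mul_apply_zero (M : WeightModule ι) (f : Matrix (ι × Fin 2) κ RationalFunctions)
    (a : ι) (b : κ) : ((M.tensor (κ := Fin 2) (irrep 1)).F * f) (a, 0) b =
      (∑ a', M.F a a' * f (a', 0) b) + qVar ^ (-M.h a) * f (a, 1) b := by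
  simp [Matrix.mul_apply, Fintype.sum_prod_type, tensor, irrep, K, Matrix.one_apply,
    Finset.sum_add_distrib, quantumInt_one, Matrix.diagonal_apply]

theorem tensor_F_mul_apply_one (M : WeightModule ι) (f : Matrix (ι × Fin 2) κ RationalFunctions)
    (a : ι) (b : κ) : ((M.tensor (κ := Fin 2) (irrep 1)).F * f) (a, 1) b =
      ∑ a', M.F a a' * f (a', 1) b := by
  simp [Matrix.mul_apply, Fintype.sum_prod_type, tensor, irrep, K, Matrix.one_apply]

/-- The irreducible module of dimension `n`; it is zero for `n = 0`. -/
noncomputable def simple (n : ℕ) : WeightModule (Fin n) where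
  E := Matrix.of fun b a => if (b : ℕ) = a + 1 then quantumInt (a + 1) else 0
  F := Matrix.of fun b a => if (a : ℕ) = b + 1 then quantumInt (n - a) else 0
  h a := 2 * a - n + 1

theorem isGraded_simple (n : ℕ) : (simple n).IsGraded where
  E b a h := by
    simp only [simple, Matrix.of_apply, ne_eq, ite_eq_right_iff, Classical.not_imp] at h ⊢
    omega
  F b a h := by
    simp only [simple, Matrix.of_apply, ne_eq, ite_eq_right_iff, Classical.not_imp] at h ⊢
    omega

/-- The indexing by the dimension in `simple` keeps the Clebsch–Gordan rule uniform: for V_0 ⊗ V_1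
the second summand is the zero module `simple 0`. -/
theorem simple_succ (n : ℕ) : simple (n + 1) = irrep n := by
  simp only [simple, irrep]
  congr 1
  · ext b a
    simp only [Matrix.of_apply]
    push_cast
    rw [show (n : ℤ) + 1 - a = n - a + 1 by ring]
  · funext a
    push_cast
    ring

/-- All matrices below have at most one relevant entry in each sum. Naming its index by a natural
number, possibly out of range, avoids separate treatment of the boundary. -/
theorem sum_fin_eq {n : ℕ} {A : Type*} [AddCommMonoid A] (j : ℕ) (f : Fin n → A)
    (h : ∀ x : Fin n, (x : ℕ) ≠ j → f x = 0) :
    ∑ x, f x = if h : j < n then f ⟨j, h⟩ else 0 := by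
  split_ifs with hj
  · exact Fintype.sum_eq_single _ fun x hx => h x fun h' => hx (Fin.ext h')
  · exact Finset.sum_eq_zero fun x _ => h x fun h' => hj (h' ▸ x.2)

/-- The inclusion of the summand of highest weight in the tensor product of a module with the
two-dimensional module. -/
noncomputable def topInclusion (k : ℕ) :
    Matrix (Fin (k + 1) × Fin 2) (Fin (k + 2)) RationalFunctions :=
  Matrix.of fun x b => if x.2 = 0 then (if (x.1 : ℕ) = b then qVar ^ (-(b : ℤ)) else 0) else
    if (x.1 : ℕ) + 1 = b then 1 else 0

/-- The inclusion of the other summand. -/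
noncomputable def bottomInclusion (k : ℕ) :
    Matrix (Fin (k + 1) × Fin 2) (Fin k) RationalFunctions :=
  Matrix.of fun x c => if x.2 = 0 then
      (if (x.1 : ℕ) = c + 1 then qVar ^ ((k : ℤ) - c) * quantumInt (c + 1) else 0) else
    if (x.1 : ℕ) = c then -quantumInt (k - c) else 0

/-- The projection to the summand of highest weight. -/
noncomputable def topProjection (k : ℕ) :
    Matrix (Fin (k + 2)) (Fin (k + 1) × Fin 2) RationalFunctions :=
  Matrix.of fun b x => if x.2 = 0 then
      (if (x.1 : ℕ) = b then quantumInt (k - b + 1) / quantumInt (k + 1) else 0) else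
    if (x.1 : ℕ) + 1 = b then qVar ^ ((k : ℤ) - b + 1) * quantumInt b / quantumInt (k + 1) else 0

/-- The projection to the other summand. -/
noncomputable def bottomProjection (k : ℕ) :
    Matrix (Fin k) (Fin (k + 1) × Fin 2) RationalFunctions :=
  Matrix.of fun c x => if x.2 = 0 then
      (if (x.1 : ℕ) = c + 1 then 1 / quantumInt (k + 1) else 0) else
    if (x.1 : ℕ) = c then -qVar ^ (-(c : ℤ) - 1) / quantumInt (k + 1) else 0

/-- Column `b` is the divided power E^b / [b]! applied to the lowest weight vector e_0 ⊗ e_0. The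
entries reduce to `quantumInt_add` with one argument equal to 1. -/
theorem isHom_topInclusion (k : ℕ) :
    (irrep (k + 1)).IsHom ((irrep k).tensor (κ := Fin 2) (irrep 1)) (topInclusion k) where
  E := by
    ext ⟨a, s⟩ b
    have ha := a.2
    have hb := b.2
    fin_cases s
    · change _ = (((irrep k).tensor (irrep 1)).E * topInclusion k) (a, 0) b
      rw [tensor_E_mul_apply_zero, Matrix.mul_apply, sum_fin_eq a, sum_fin_eq b]
      · by_cases h : (a : ℕ) = b + 1
        · have h1 : (a : ℕ) < k + 1 + 1 := by omega
          have h2 : (b : ℕ) < k + 1 := by omega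
          simp [topInclusion, irrep, h, h2]
          rw [pow_succ, mul_inv]
          ring
        · simp [topInclusion, irrep, h]
      · intro x hx
        simp [topInclusion, irrep, hx]
      · intro x hx
        simp [topInclusion, irrep, hx.symm]
    · change _ = (((irrep k).tensor (irrep 1)).E * topInclusion k) (a, 1) b
      rw [tensor_E_mul_apply_one, Matrix.mul_apply, sum_fin_eq (a + 1), sum_fin_eq (b - 1)]
      · by_cases h : (a : ℕ) = b
        · have h1 : (a : ℕ) + 1 < k + 1 + 1 := by omega
          have h2 : (b : ℕ) - 1 < k + 1 := by omega
          have e := quantumInt_add a 1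
          simp [topInclusion, irrep, h, h2]
          have h3 : (b : ℕ) ≤ k := by omega
          rw [h] at e
          rw [if_pos h3, e, quantumInt_one]
          -- For b = 0 the truncated index b - 1 does not point to a nonzero entry; the formula
          -- persists because [0] = 0.
          obtain hc | ⟨c, hc⟩ : (b : ℕ) = 0 ∨ ∃ c, (b : ℕ) = c + 1 := by
            cases (b : ℕ) <;> simp
          · simp [hc, quantumInt_zero]
          · simp only [hc, Nat.add_sub_cancel, if_true, zpow_one, mul_one, zpow_neg,
              Nat.cast_add, Nat.cast_one]
            rw [← zpow_natCast]
            push_cast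
            rfl
        · simp [topInclusion, irrep, h]
          omega
      · intro x hx
        simp [topInclusion, irrep]
        omega
      · intro x hx
        simp [topInclusion, irrep, hx.symm]
  F := by
    ext ⟨a, s⟩ b
    have ha := a.2
    have hb := b.2
    fin_cases s
    · change _ = (((irrep k).tensor (irrep 1)).F * topInclusion k) (a, 0) b
      rw [tensor_F_mul_apply_zero, Matrix.mul_apply, sum_fin_eq a, sum_fin_eq b]
      · by_cases h : (b : ℕ) = a + 1
        · have h1 : (a : ℕ) < k + 1 + 1 := by omega
          simp [topInclusion, irrep, h, h1]
          have e := quantumInt_add 1 (k - a)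
          rw [show (k : ℤ) - a + 1 = 1 + (k - a) by ring,
            show (k : ℤ) - (a + 1) + 1 = k - a by ring, e, quantumInt_one, ← zpow_natCast,
            ← zpow_neg,
            mul_add, ← mul_assoc, ← mul_assoc, ← zpow_add₀ qVar_ne_zero, ← zpow_add₀ qVar_ne_zero]
          -- For a = k the vector e_{a+1} is out of range, which agrees with [k - a] = 0.
          split_ifs with h3
          · rw [← zpow_natCast, ← zpow_neg, add_comm, mul_comm]
            push_cast
            ring_nf
          · have : (a : ℕ) = k := by omega
            rw [this]
            simp [quantumInt_zero]
            rw [← zpow_natCast, ← zpow_neg]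
            ring_nf
        · simp [topInclusion, irrep, h, Ne.symm h]
      · intro x hx
        simp [topInclusion, irrep, hx]
      · intro x hx
        simp [topInclusion, irrep, hx.symm]
    · change _ = (((irrep k).tensor (irrep 1)).F * topInclusion k) (a, 1) b
      rw [tensor_F_mul_apply_one, Matrix.mul_apply, sum_fin_eq (a + 1), sum_fin_eq (a + 1)]
      · by_cases h : (b : ℕ) = a + 2
        · have h1 : (a : ℕ) + 1 < k + 1 := by omega
          simp [topInclusion, irrep, h, h1]
          rw [if_pos (by omega)]
          congr 1
          ring
        · simp [topInclusion, irrep, h]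
          intro h2 h3
          omega
      · intro x hx
        simp [topInclusion, irrep, hx]
      · intro x hx
        simp [topInclusion, irrep, hx.symm]
  h := by
    rintro ⟨a, s⟩ b h
    fin_cases s <;> simp [topInclusion, irrep, tensor] at h ⊢ <;> omega

/-- Column 0 is q^k e_1 ⊗ e_0 - [k] e_0 ⊗ e_1, a vector killed by F, and the other columns are its
divided powers under E. -/
theorem isHom_bottomInclusion (k : ℕ) :
    (simple k).IsHom ((irrep k).tensor (κ := Fin 2) (irrep 1)) (bottomInclusion k) where
  E := by
    ext ⟨a, s⟩ c
    have ha := a.2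
    have hc := c.2
    fin_cases s
    · change _ = (((irrep k).tensor (irrep 1)).E * bottomInclusion k) (a, 0) c
      rw [tensor_E_mul_apply_zero, Matrix.mul_apply, sum_fin_eq (c + 1), sum_fin_eq (c + 1)]
      · by_cases h : (a : ℕ) = c + 2
        · have h2 : (c : ℕ) + 1 < k := by omega
          simp [bottomInclusion, simple, irrep, h, h2]
          rw [show (k : ℤ) - (c + 1) = k - c + (-1) by ring, zpow_add₀ qVar_ne_zero, zpow_neg_one]
          ring
        · simp [bottomInclusion, simple, irrep, h]
      · intro x hx
        simp [bottomInclusion, irrep, hx]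
      · intro x hx
        simp [bottomInclusion, simple, hx]
    · change _ = (((irrep k).tensor (irrep 1)).E * bottomInclusion k) (a, 1) c
      rw [tensor_E_mul_apply_one, Matrix.mul_apply, sum_fin_eq a, sum_fin_eq c]
      · by_cases h : (a : ℕ) = c + 1
        · have h2 : (c : ℕ) < k + 1 := by omega
          have e := quantumInt_add 1 (k - c - 1)
          simp [bottomInclusion, simple, irrep, h, h2]
          have h3 : (if (c : ℕ) + 1 < k then
            -(quantumInt (k - (c + 1)) * quantumInt (c + 1)) else 0) =
              -(quantumInt (k - c - 1) * quantumInt (c + 1)) := by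
            split_ifs with h3
            · rw [sub_sub]
            · have : (k : ℤ) - c - 1 = 0 := by omega
              rw [this, quantumInt_zero, zero_mul, neg_zero]
          have h4 : qVar ^ ((k : ℤ) - c) = qVar ^ ((k : ℤ) - c - 1) * qVar := by
            rw [← zpow_add_one₀ qVar_ne_zero, sub_add_cancel]
          have h5 := qVar_ne_zero
          rw [show 1 + ((k : ℤ) - c - 1) = k - c by ring, quantumInt_one, zpow_neg_one] at e
          rw [h3, h4, e]
          field_simp
          ring
        · simp [bottomInclusion, simple, irrep, h]
      · intro x hx
        simp [bottomInclusion, irrep, hx]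
      · intro x hx
        simp [bottomInclusion, simple, hx.symm]
  F := by
    ext ⟨a, s⟩ c
    have ha := a.2
    have hc := c.2
    fin_cases s
    · change _ = (((irrep k).tensor (irrep 1)).F * bottomInclusion k) (a, 0) c
      rw [tensor_F_mul_apply_zero, Matrix.mul_apply, sum_fin_eq (a - 1), sum_fin_eq (c + 1)]
      · by_cases h : (a : ℕ) = c
        · have h2 : (c : ℕ) - 1 < k := by omega
          have h3 : (c : ℕ) ≠ c + 1 := by omega
          simp [bottomInclusion, simple, irrep, h, h2]
          obtain hd | ⟨d, hd⟩ : (c : ℕ) = 0 ∨ ∃ d, (c : ℕ) = d + 1 := by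
            cases (c : ℕ) <;> simp
          · simp [hd, quantumInt_one]
            ring
          · have e := quantumInt_add (d + 1) 1
            simp only [hd, Nat.add_sub_cancel, if_true, Nat.cast_add, Nat.cast_one]
            rw [e, quantumInt_one, mul_one, mul_add, ← mul_assoc (qVar ^ _),
              ← zpow_add₀ qVar_ne_zero,
              ← zpow_add₀ qVar_ne_zero]
            ring_nf
        · simp [bottomInclusion, simple, irrep, h, Ne.symm h]
          intro h1 h2 h3
          omega
      · intro x hx
        simp [bottomInclusion, irrep, hx]
      · intro x hx
        simp [bottomInclusion, simple]
        omega
    · change _ = (((irrep k).tensor (irrep 1)).F * bottomInclusion k) (a, 1) c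
      rw [tensor_F_mul_apply_one, Matrix.mul_apply, sum_fin_eq a, sum_fin_eq c]
      · by_cases h : (c : ℕ) = a + 1
        · have h1 : (a : ℕ) < k := by omega
          have h2 : (a : ℕ) + 1 < k + 1 := by omega
          simp [bottomInclusion, simple, irrep, h, h1, h2]
          left
          congr 1
          ring
        · simp [bottomInclusion, simple, irrep, h]
      · intro x hx
        simp [bottomInclusion, irrep, hx]
      · intro x hx
        simp [bottomInclusion, simple, hx.symm]
  h := by
    rintro ⟨a, s⟩ b h
    fin_cases s <;> simp [bottomInclusion, irrep, simple, tensor] at h ⊢ <;> omega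

end WeightModule

end FramedSkein

namespace FramedSkein

/-! ### The Clebsch–Gordan projections -/

namespace WeightModule

/-- On the diagonal this is the splitting of [k+1] as [b + (k - b + 1)], whence the denominator in
the projection. The terms missing at the ends b = 0 and b = k + 1 carry the factor [0]. -/
theorem topProjection_mul_topInclusion (k : ℕ) : topProjection k * topInclusion k = 1 := by
  have hk : quantumInt (k + 1) ≠ 0 := quantumInt_ne_zero (by omega)
  ext b b'
  have hb := b.2
  rw [Matrix.mul_apply, Fintype.sum_prod_type_right, Fin.sum_univ_two, sum_fin_eq b,
    sum_fin_eq (b - 1)]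
  · by_cases h : b = b'
    · subst h
      have h2 : (b : ℕ) - 1 < k + 1 := by omega
      have e := quantumInt_add b (k - b + 1)
      rw [show (b : ℤ) + (k - b + 1) = k + 1 by ring] at e
      simp [topProjection, topInclusion, h2]
      have h3 : (if (b : ℕ) ≤ k then quantumInt (k - b + 1) / quantumInt (k + 1) *
          (qVar ^ (b : ℕ))⁻¹ else 0) =
          quantumInt (k - b + 1) / quantumInt (k + 1) * qVar ^ (-(b : ℤ)) := by
        split_ifs with h3
        · rw [zpow_neg, zpow_natCast]
        · have : (k : ℤ) - b + 1 = 0 := by omega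
          rw [this, quantumInt_zero, zero_div, zero_mul]
      have h4 : (if (b : ℕ) - 1 + 1 = b then
          if (b : ℕ) - 1 + 1 = b then qVar ^ ((k : ℤ) - b + 1) * quantumInt b / quantumInt (k + 1)
          else 0 else 0) = qVar ^ ((k : ℤ) - b + 1) * quantumInt b / quantumInt (k + 1) := by
        split_ifs with h4
        · rfl
        · have : (b : ℕ) = 0 := by omega
          simp [this, quantumInt_zero]
      rw [h3, h4]
      field_simp
      rw [e]
      ring
    · have h' : (b : ℕ) ≠ b' := fun h' => h (Fin.ext h')
      simp [topProjection, topInclusion, h, h']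
      intro _ h1 h2
      omega
  · intro x hx
    simp [topProjection]
    omega
  · intro x hx
    simp [topProjection, hx]

theorem topProjection_mul_bottomInclusion (k : ℕ) :
    topProjection k * bottomInclusion k = 0 := by
  ext b c
  have hc := c.2
  rw [Matrix.mul_apply, Fintype.sum_prod_type_right, Fin.sum_univ_two, sum_fin_eq (c + 1),
    sum_fin_eq c]
  · have h1 : (c : ℕ) < k + 1 := by omega
    by_cases h : (b : ℕ) = c + 1
    · simp [topProjection, bottomInclusion, h, h1]
      rw [show (k : ℤ) - (c + 1) + 1 = k - c by ring]
      ring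
    · simp [topProjection, bottomInclusion, Ne.symm h]
  · intro x hx
    simp [bottomInclusion, hx]
  · intro x hx
    simp [bottomInclusion, hx]

theorem bottomProjection_mul_topInclusion (k : ℕ) :
    bottomProjection k * topInclusion k = 0 := by
  ext c b
  have hc := c.2
  rw [Matrix.mul_apply, Fintype.sum_prod_type_right, Fin.sum_univ_two, sum_fin_eq (c + 1),
    sum_fin_eq c]
  · have h1 : (c : ℕ) < k + 1 := by omega
    by_cases h : (b : ℕ) = c + 1
    · simp [bottomProjection, topInclusion, h, h1]
      rw [← zpow_natCast, ← zpow_neg]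
      push_cast
      rw [neg_add']
      ring
    · simp [bottomProjection, topInclusion, Ne.symm h]
  · intro x hx
    simp [bottomProjection, hx]
  · intro x hx
    simp [bottomProjection, hx]

theorem bottomProjection_mul_bottomInclusion (k : ℕ) :
    bottomProjection k * bottomInclusion k = 1 := by
  have hk : quantumInt (k + 1) ≠ 0 := quantumInt_ne_zero (by omega)
  ext c c'
  have hc := c.2
  rw [Matrix.mul_apply, Fintype.sum_prod_type_right, Fin.sum_univ_two, sum_fin_eq (c + 1),
    sum_fin_eq c]
  · have h1 : (c : ℕ) < k + 1 := by omega
    by_cases h : c = c'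
    · subst h
      have e := quantumInt_add (c + 1) (k - c)
      rw [show (c : ℤ) + 1 + (k - c) = k + 1 by ring] at e
      simp [bottomProjection, bottomInclusion, h1]
      rw [neg_add'] at e
      field_simp
      rw [e]
    · have h' : (c : ℕ) ≠ c' := fun h' => h (Fin.ext h')
      simp [bottomProjection, bottomInclusion, h, h']
  · intro x hx
    simp [bottomProjection, hx]
  · intro x hx
    simp [bottomProjection, hx]

/-- The projection of a decomposition along submodules commutes with the action because both
inclusions do, so only the weights of the projections need checking. -/
theorem isHom_of_mul_eq_one {ι κ π : Type} [Fintype ι] [DecidableEq ι] [Fintype κ] [DecidableEq κ]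
    [Fintype π] [DecidableEq π] {M : WeightModule ι} {N : WeightModule κ} {P : WeightModule π}
    {i : Matrix ι κ RationalFunctions} {p : Matrix κ ι RationalFunctions}
    {i' : Matrix ι π RationalFunctions} {p' : Matrix π ι RationalFunctions} (hi : N.IsHom M i)
    (hi' : P.IsHom M i') (h1 : p * i = 1) (h2 : p * i' = 0) (h : i * p + i' * p' = 1)
    (hp : ∀ b a, p b a ≠ 0 → N.h b = M.h a) : M.IsHom N p where
  E := by
    calc p * M.E = p * M.E * (i * p + i' * p') := by rw [h, Matrix.mul_one]
      _ = p * (M.E * i) * p + p * (M.E * i') * p' := by simp only [Matrix.mul_add, Matrix.mul_assoc]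
      _ = (p * i) * N.E * p + (p * i') * P.E * p' := by
        rw [← hi.E, ← hi'.E]; simp only [Matrix.mul_assoc]
      _ = N.E * p := by rw [h1, h2]; simp
  F := by
    calc p * M.F = p * M.F * (i * p + i' * p') := by rw [h, Matrix.mul_one]
      _ = p * (M.F * i) * p + p * (M.F * i') * p' := by simp only [Matrix.mul_add, Matrix.mul_assoc]
      _ = (p * i) * N.F * p + (p * i') * P.F * p' := by
        rw [← hi.F, ← hi'.F]; simp only [Matrix.mul_assoc]
      _ = N.F * p := by rw [h1, h2]; simp
  h := hp

/-- A one-sided inverse is two-sided because the dimensions agree: (k + 2) + k = 2 (k + 1). -/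
theorem inclusion_mul_projection (k : ℕ) :
    topInclusion k * topProjection k + bottomInclusion k * bottomProjection k = 1 := by
  have h : Matrix.fromRows (topProjection k) (bottomProjection k) *
      Matrix.fromCols (topInclusion k) (bottomInclusion k) = 1 := by
    rw [Matrix.fromRows_mul_fromCols, topProjection_mul_topInclusion,
      topProjection_mul_bottomInclusion, bottomProjection_mul_topInclusion,
      bottomProjection_mul_bottomInclusion, Matrix.fromBlocks_one]
  rw [← Matrix.fromCols_mul_fromRows]
  exact (Matrix.mul_eq_one_comm_of_card_eq _ _ _ (by
    rw [Fintype.card_sum, Fintype.card_prod]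
    simp only [Fintype.card_fin]
    ring)).1 h

/-- The Clebsch–Gordan decomposition of the tensor product with the two-dimensional module. -/
theorem isDirectSum_tensor_irrep_one (k : ℕ) :
    IsDirectSum ((irrep k).tensor (κ := Fin 2) (irrep 1)) (irrep (k + 1)) (simple k)
      (topInclusion k) (topProjection k) (bottomInclusion k) (bottomProjection k) where
  hom_i := isHom_topInclusion k
  hom_p := isHom_of_mul_eq_one (isHom_topInclusion k) (isHom_bottomInclusion k)
    (topProjection_mul_topInclusion k) (topProjection_mul_bottomInclusion k)
    (inclusion_mul_projection k) (by
      rintro b ⟨a, s⟩ h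
      fin_cases s <;> simp [topProjection, irrep, tensor] at h ⊢ <;> omega)
  hom_i' := isHom_bottomInclusion k
  hom_p' := isHom_of_mul_eq_one (isHom_bottomInclusion k) (isHom_topInclusion k)
    (bottomProjection_mul_bottomInclusion k) (bottomProjection_mul_topInclusion k)
    ((add_comm _ _).trans (inclusion_mul_projection k)) (by
      rintro b ⟨a, s⟩ h
      fin_cases s <;> simp [bottomProjection, irrep, simple, tensor] at h ⊢ <;> omega)
  p_mul_i := topProjection_mul_topInclusion k
  p_mul_i' := topProjection_mul_bottomInclusion k
  p'_mul_i := bottomProjection_mul_topInclusion k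
  p'_mul_i' := bottomProjection_mul_bottomInclusion k
  add := inclusion_mul_projection k

end WeightModule

end FramedSkein

namespace FramedSkein

open WeightModule

/-! ### Tensor powers of the two-dimensional module -/

/-- A weight module with an index type for its basis. -/
structure BasedModule where
  index : Type
  fintype : Fintype index
  decidableEq : DecidableEq index
  module : WeightModule index
  graded : module.IsGraded

namespace BasedModule

attribute [instance] fintype decidableEq

/-- The tensor product with the two-dimensional module. -/
noncomputable def step (X : BasedModule) : BasedModule where
  index := X.index × Fin 2
  fintype := inferInstance
  decidableEq := inferInstance
  module := X.module.tensor (κ := Fin 2) (irrep 1)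
  graded := X.graded.tensor (isGraded_irrep 1)

/-- The tensor product with a tensor power of the two-dimensional module. -/
noncomputable def tensorPower (X : BasedModule) : ℕ → BasedModule
  | 0 => X
  | m + 1 => X.step.tensorPower m

/-- The irreducible module of dimension `k + 1`. -/
noncomputable def ofIrrep (k : ℕ) : BasedModule :=
  ⟨Fin (k + 1), inferInstance, inferInstance, irrep k, isGraded_irrep k⟩

/-- The irreducible module of dimension `k`, or zero. -/
noncomputable def ofSimple (k : ℕ) : BasedModule :=
  ⟨Fin k, inferInstance, inferInstance, simple k, isGraded_simple k⟩

theorem ofSimple_succ (k : ℕ) : ofSimple (k + 1) = ofIrrep k := by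
  simp only [ofSimple, ofIrrep]
  congr 1
  exact simple_succ k

theorem exists_cabled (X : BasedModule) {p : ℕ} {S : Bool → StrandMap X.index}
    (h : Cabled X.module p S) (m : ℕ) :
    ∃ S' : Bool → StrandMap (X.tensorPower m).index,
      Cabled (X.tensorPower m).module (p + m) S' := by
  induction m generalizing X p with
  | zero => exact ⟨S, h⟩
  | succ m ih =>
    obtain ⟨S', h'⟩ := ih X.step h.step
    rw [add_assoc, add_comm 1] at h'
    exact ⟨S', h'⟩

/-- `tensorPower` enlarges its base before recursing, so a decomposition of the base is tensored
with one copy of V_1 at a time and remains a decomposition. -/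
theorem value_tensorPower_add {X Y Z : BasedModule} [Nonempty Y.index] {i p i' p'}
    (h : IsDirectSum X.module Y.module Z.module i p i' p') (m : ℕ) {w : List OrientedSlice}
    (hw : IsOrientedClosed w []) (hn : numComponents (w.map OrientedSlice.forget) = 1) :
    (X.tensorPower m).module.tensors.value w =
      (Y.tensorPower m).module.tensors.value w + (Z.tensorPower m).module.tensors.value w := by
  induction m generalizing X Y Z with
  | zero => exact h.value_eq X.graded Y.graded Z.graded hw hn
  | succ m ih =>
    have : Nonempty Y.step.index := inferInstanceAs (Nonempty (Y.index × Fin 2))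
    exact ih (X := X.step) (Y := Y.step) (Z := Z.step) (h.tensor (irrep 1))

/-- With an empty set of colours the decomposition of a knot's state sum by colours is an empty sum.
-/
theorem value_tensorPower_of_isEmpty {X : BasedModule} (hX : IsEmpty X.index) (m : ℕ)
    {w : List OrientedSlice} (hw : IsOrientedClosed w [])
    (hn : numComponents (w.map OrientedSlice.forget) = 1) :
    (X.tensorPower m).module.tensors.value w = 0 := by
  induction m generalizing X with
  | zero =>
    have h : X.module.tensors.Respects (isEmptyElim : X.index → Empty) :=
      ⟨fun _ a => isEmptyElim a, fun _ a => isEmptyElim a, fun _ _ _ a => isEmptyElim a⟩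
    exact (Tensors.value_eq_sum_restrict h hw hn).trans (Finset.sum_empty)
  | succ m ih => exact ih (X := X.step) (inferInstanceAs (IsEmpty (X.index × Fin 2)))

/-- The state sums of a knot satisfy the recursion of the Chebyshev polynomials. -/
theorem value_tensorPower_succ (k m : ℕ) {w : List OrientedSlice} (hw : IsOrientedClosed w [])
    (hn : numComponents (w.map OrientedSlice.forget) = 1) :
    ((ofIrrep k).tensorPower (m + 1)).module.tensors.value w =
      ((ofIrrep (k + 1)).tensorPower m).module.tensors.value w +
        ((ofSimple k).tensorPower m).module.tensors.value w := by
  have : Nonempty (ofIrrep (k + 1)).index := inferInstanceAs (Nonempty (Fin (k + 2)))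
  exact value_tensorPower_add (X := (ofIrrep k).step) (Y := ofIrrep (k + 1)) (Z := ofSimple k)
    (isDirectSum_tensor_irrep_one k) m hw hn

end BasedModule

/-! ### The colored Jones polynomial -/

/-- The state sum of a knot for the tensor product of the irreducible module of dimension `k + 1`
with the `m`th tensor power of the two-dimensional module, with a sign. -/
noncomputable def signedValue (w : List OrientedSlice) (k m : ℕ) : RationalFunctions :=
  (-1) ^ (k + m) * ((BasedModule.ofIrrep k).tensorPower m).module.tensors.value w

theorem signedValue_zero_succ {w : List OrientedSlice} (hw : IsOrientedClosed w [])
    (hn : numComponents (w.map OrientedSlice.forget) = 1) (m : ℕ) :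
    signedValue w 0 (m + 1) = signedValue w 1 m := by
  rw [signedValue, BasedModule.value_tensorPower_succ 0 m hw hn,
    BasedModule.value_tensorPower_of_isEmpty (X := BasedModule.ofSimple 0)
      (inferInstanceAs (IsEmpty (Fin 0))) m hw hn, signedValue, add_zero]
  ring

/-- The sign depends only on the parity of k + m, which the Clebsch–Gordan rule preserves. -/
theorem signedValue_succ_succ {w : List OrientedSlice} (hw : IsOrientedClosed w [])
    (hn : numComponents (w.map OrientedSlice.forget) = 1) (k m : ℕ) :
    signedValue w (k + 1) (m + 1) = signedValue w (k + 2) m + signedValue w k m := by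
  rw [signedValue, BasedModule.value_tensorPower_succ (k + 1) m hw hn, signedValue, signedValue,
    BasedModule.ofSimple_succ]
  ring

/-- Starting from the trivial module, m steps build the m-th tensor power of V_1. The sign
((-1)^m)^turns equals (-1)^m since the number of turns is odd; only here does the zero framing
enter. -/
theorem algebraMap_bracket_cable (K : OrientedLinkDiagram)
    (hknot : numComponents K.toLinkDiagram.word = 1) (hframing : K.writhe = 0) (m : ℕ) :
    algebraMap ℂ[T;T⁻¹] RationalFunctions (bracket (K.toLinkDiagram.cable m)) =
      signedValue K.word 0 m := by
  obtain ⟨S, h⟩ := (BasedModule.ofIrrep 0).exists_cabled cabled_irrep_zero m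
  have h' : ((-1 : RationalFunctions) ^ turns K.word []) = -1 := by
    have := congrArg (Int.cast : ℤ → RationalFunctions) (neg_one_pow_turns K.closed hknot hframing)
    simpa using this
  rw [zero_add] at h
  rw [h.bracket_cable, ← pow_mul, mul_comm m, pow_mul, h', signedValue, zero_add]

/-- The linear extension of the Kauffman bracket to linear combinations of cables. -/
noncomputable def cableBracket (D : LinkDiagram) :
    Polynomial ℂ[T;T⁻¹] →ₗ[ℂ[T;T⁻¹]] ℂ[T;T⁻¹] :=
  Polynomial.lsum fun m => LinearMap.toSpanSingleton _ _ (bracket (D.cable m))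

theorem cableBracket_apply (D : LinkDiagram) (P : Polynomial ℂ[T;T⁻¹]) :
    cableBracket D P = P.sum fun m c => c * bracket (D.cable m) := by
  simp [cableBracket, Polynomial.lsum_apply]

/-- X^m S_k corresponds to V_k tensored with m copies of V_1. The exponent m stays free in the
induction on k, since X S_{k+1} = S_{k+2} + S_k uses up one factor X. -/
theorem algebraMap_cableBracket (K : OrientedLinkDiagram)
    (hknot : numComponents K.toLinkDiagram.word = 1) (hframing : K.writhe = 0) (k : ℕ) :
    ∀ m : ℕ, algebraMap ℂ[T;T⁻¹] RationalFunctions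
      (cableBracket K.toLinkDiagram (Polynomial.X ^ m * Polynomial.Chebyshev.S ℂ[T;T⁻¹] k)) =
        signedValue K.word k m := by
  have h0 : ∀ m : ℕ, algebraMap ℂ[T;T⁻¹] RationalFunctions
      (cableBracket K.toLinkDiagram (Polynomial.X ^ m)) = signedValue K.word 0 m := by
    intro m
    rw [cableBracket_apply, ← Polynomial.monomial_one_right_eq_X_pow,
      Polynomial.sum_monomial_index _ _ (by simp), one_mul,
      algebraMap_bracket_cable K hknot hframing]
  induction k using Nat.twoStepInduction with
  | zero => simpa using h0
  | one =>
    intro m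
    rw [Nat.cast_one, Polynomial.Chebyshev.S_one, ← pow_succ, h0,
      signedValue_zero_succ K.closed hknot]
  | more k ih ih' =>
    intro m
    have e := signedValue_succ_succ K.closed hknot k m
    rw [← ih' (m + 1), ← ih m] at e
    rw [Nat.cast_add, Nat.cast_two, Polynomial.Chebyshev.S_add_two, mul_sub, ← mul_assoc,
      ← pow_succ, map_sub, map_sub, sub_eq_iff_eq_add]
    push_cast at e
    exact e

theorem algebraMap_coloredBracket (K : OrientedLinkDiagram)
    (hknot : numComponents K.toLinkDiagram.word = 1) (hframing : K.writhe = 0) (n : ℕ) :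
    algebraMap ℂ[T;T⁻¹] RationalFunctions (coloredBracket n K.toLinkDiagram) =
      (-1) ^ n * coloredJones n K := by
  have h := algebraMap_cableBracket K hknot hframing n 0
  rw [pow_zero, one_mul, cableBracket_apply, signedValue, add_zero] at h
  rw [coloredJones_eq_value]
  exact h

end FramedSkein

theorem mainTheorem6 (K : FramedSkein.OrientedLinkDiagram)
    (hknot : FramedSkein.numComponents K.toLinkDiagram.word = 1)
    (hframing : K.writhe = 0) (n : ℕ) :
    ∃ J : LaurentPolynomial ℂ,
      algebraMap (LaurentPolynomial ℂ) FramedSkein.RationalFunctions J =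
          FramedSkein.coloredJones n K ∧
        J = (-1) ^ n * FramedSkein.coloredBracket n K.toLinkDiagram ∧
        FramedSkein.skeinS n K.toLinkDiagram =
          ((-1) ^ n * J) • FramedSkein.skein FramedSkein.LinkDiagram.empty := by
  have hsign : ∀ {R : Type} [CommRing R], ((-1 : R) ^ n) * (-1) ^ n = 1 := by
    intro R _
    rw [← mul_pow, neg_one_mul, neg_neg, one_pow]
  -- The witness is a Laurent polynomial by construction, so integrality of the colored Jones
  -- polynomial needs no separate argument.
  refine ⟨(-1) ^ n * FramedSkein.coloredBracket n K.toLinkDiagram, ?_, rfl, ?_⟩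
  · rw [map_mul, FramedSkein.algebraMap_coloredBracket K hknot hframing, map_pow, map_neg, map_one,
      ← mul_assoc, hsign, one_mul]
  · rw [← mul_assoc, hsign, one_mul, FramedSkein.skeinS_eq_coloredBracket_smul]
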